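/- Conventions. Let $N\subset N_{\mathbb R}=\mathbb R^r$ ($r\ge 0$) be a lattice of rank $r$ with dual lattice $M=\mathrm{Hom}(N,\mathbb Z)$ and $M_{\mathbb C}=M\otimes\mathbb C$. Let $\Sigma$ be a complete (finite) fan in $N_{\mathbb R}$ of strongly convex cones, rational polyhedral with respect to $N$, and let $\deg\colon N\to\mathbb C$ be a function that is linear on $C\cap N$ for every cone $C\in\Sigma$ and satisfies $\deg(d)\notin\mathbb Z$ for the primitive lattice generator $d$ of every one-dimensional cone of $\Sigma$. For $\tau\in\mathfrak H$ (the upper half-plane), $q=e^{2\pi i\tau}$ and $C\in\Sigma$, let $f_C(q,m)$ denote the analytic continuation in $(\tau,m)\in\mathfrak H\times M_{\mathbb C}$ of $\sum_{n\in C\cap N}q^{m\cdot n}e^{2\pi i\deg(n)}$ (where $q^{m\cdot n}=e^{2\pi i\tau (m\cdot n)}$) from the region where this series converges absolutely. The toric form attached to $(N,\deg)$ is $$f_{N,\deg}(\tau)=\sum_{m\in M}\ \sum_{C\in\Sigma}(-1)^{\operatorname{codim}C}f_C(q,m).$$ For a positive integer $l$, let $\mathscr T_r(l)$ be the complex span of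 all $f_{N,\deg}$ as above with $\operatorname{rank}N=r$ and $\deg(N)\subset\frac1l\mathbb Z$, and let $\mathscr T(l)=\sum_r\mathscr T_r(l)$; its elements are called toric forms of level $l$. Statement. Let $l$ and $p$ be positive integers. If $f\in\mathscr T_r(l)$, then the function $\tau\mapsto f(p\tau)$ belongs to $\mathscr T_r(pl)$; consequently, if $f\in\mathscr T(l)$ then $\tau\mapsto f(p\tau)$ belongs to $\mathscr T(pl)$. Explicitly, suppose that $N,\Sigma,\deg$ are as above with $\deg(N)\subset\frac1l\mathbb Z$, and let $\{m_k\}\subset M$ be a complete set of representatives of $M/pM$. Write $[m_k/p]$ for the function $n\mapsto (m_k\cdot n)/p$. Then each $\deg/p+[m_k/p]$ satisfies the conditions above with respect to the same fan $\Sigma$ and takes values in $\frac1{pl}\mathbb Z$, the functions $f_{N,\deg}$ and $f_{N,\deg/p+[m_k/p]}$ are well defined on all of $\mathfrak H$ (the continued values $f_C(q,m)$, $m\in M$, exist and are unique, and the sums over $M$ converge absolutely), and for all $\tau\in\mathfrak H$ $$f_{N,\deg}(p\tau)=p^{-r}\sum_k f_{N,\deg/p+[m_k/p]}(\tau).$$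 -/

import Mathlib

/-!
Toric forms: modular forms attached to a lattice `N` in `ℝ^r`, a complete rational polyhedral fan
and a piecewise linear degree function on `N`.
-/

noncomputable section

namespace ToricForm

/-- The ambient real vector space `N_ℝ = ℝ^r`. -/
abbrev RealSpace (r : ℕ) : Type := Fin r → ℝ

/-- The complexified dual space `M_ℂ`, as the real-linear maps `N_ℝ → ℂ`. -/
abbrev ComplexDual (r : ℕ) : Type := RealSpace r →L[ℝ] ℂ

/-- The dual lattice `M = Hom(N, ℤ)`, realised as the real functionals that are integral on `N`. -/
def dualLattice {r : ℕ} (N : Submodule ℤ (RealSpace r)) : AddSubgroup (RealSpace r →L[ℝ] ℝ) where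
  carrier := {m | ∀ n ∈ N, ∃ k : ℤ, m n = k}
  zero_mem' := fun _ _ => ⟨0, by simp⟩
  add_mem' := by
    intro a b ha hb n hn
    obtain ⟨k, hk⟩ := ha n hn
    obtain ⟨j, hj⟩ := hb n hn
    exact ⟨k + j, by simp [hk, hj]⟩
  neg_mem' := by
    intro a ha n hn
    obtain ⟨k, hk⟩ := ha n hn
    exact ⟨-k, by simp [hk]⟩

/-- The inclusion of `M_ℝ` in `M_ℂ`. -/
def toComplexDual {r : ℕ} (m : RealSpace r →L[ℝ] ℝ) : ComplexDual r :=
  Complex.ofRealCLM.comp m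

/-- `C` is a rational polyhedral cone: a finite intersection of half-spaces `m · x ≥ 0` with
`m ∈ M`, containing no line. -/
def IsRationalCone {r : ℕ} (N : Submodule ℤ (RealSpace r)) (C : Set (RealSpace r)) : Prop :=
  (∃ S : Finset (RealSpace r →L[ℝ] ℝ),
    (∀ m ∈ S, m ∈ dualLattice N) ∧ C = {x | ∀ m ∈ S, 0 ≤ m x}) ∧
  ∀ x ∈ C, -x ∈ C → x = 0

/-- `F` is a face of the cone `C`: it is cut out of `C` by an equation `u · x = 0`, where `u ∈ M`
is nonnegative on `C`. -/
def IsFace {r : ℕ} (N : Submodule ℤ (RealSpace r)) (F C : Set (RealSpace r)) : Prop :=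
  ∃ u ∈ dualLattice N, (∀ x ∈ C, 0 ≤ u x) ∧ F = {x ∈ C | u x = 0}

/-- A complete fan of rational polyhedral cones (rational with respect to `N`). -/
structure CompleteFan {r : ℕ} (N : Submodule ℤ (RealSpace r)) where
  cones : Finset (Set (RealSpace r))
  rational : ∀ C ∈ cones, IsRationalCone N C
  face_mem : ∀ C ∈ cones, ∀ F, IsFace N F C → F ∈ cones
  inter_face : ∀ C ∈ cones, ∀ D ∈ cones, IsFace N (C ∩ D) C ∧ IsFace N (C ∩ D) D
  complete : ∀ x : RealSpace r, ∃ C ∈ cones, x ∈ C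

/-- The dimension of a cone, i.e. of the subspace that it spans. -/
def coneDim {r : ℕ} (C : Set (RealSpace r)) : ℕ :=
  Module.finrank ℝ (Submodule.span ℝ C)

/-- `d` is the generator of the one-dimensional cone `C`: the lattice points of `C` are the
nonnegative integer multiples of `d`. -/
def IsRayGenerator {r : ℕ} (N : Submodule ℤ (RealSpace r)) (C : Set (RealSpace r)) (d : N) : Prop :=
  coneDim C = 1 ∧ ∀ n : N, (n : RealSpace r) ∈ C ↔ ∃ k : ℕ, n = k • d

/-- `deg` is a degree function with respect to the fan `Σ`: it is linear on every cone. -/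
def IsDegreeFunction {r : ℕ} {N : Submodule ℤ (RealSpace r)} (Fan : CompleteFan N)
    (deg : N → ℂ) : Prop :=
  ∀ C ∈ Fan.cones, ∃ L : ComplexDual r, ∀ n : N, (n : RealSpace r) ∈ C → deg n = L n

/-- The data defining a toric form: a degree function that takes a non-integral value at the
generator of each one-dimensional cone. -/
def IsToricData {r : ℕ} {N : Submodule ℤ (RealSpace r)} (Fan : CompleteFan N)
    (deg : N → ℂ) : Prop :=
  IsDegreeFunction Fan deg ∧
  ∀ C ∈ Fan.cones, ∀ d : N, IsRayGenerator N C d → ∀ k : ℤ, deg d ≠ k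

/-- Toric data of level `l`: moreover `deg` takes its values in `(1/l)ℤ`. -/
def IsToricDataOfLevel {r : ℕ} {N : Submodule ℤ (RealSpace r)} (Fan : CompleteFan N)
    (deg : N → ℂ) (l : ℕ) : Prop :=
  IsToricData Fan deg ∧ ∀ n : N, ∃ k : ℤ, deg n = (k : ℂ) / (l : ℂ)

/-- The summand `q^{m·n} e^{2πi deg(n)}`, where `q^{m·n} = e^{2πi τ (m·n)}` and `m ∈ M_ℂ`. -/
def coneSummand {r : ℕ} {N : Submodule ℤ (RealSpace r)} (deg : N → ℂ)
    (τ : ℂ) (m : ComplexDual r) (n : N) : ℂ :=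
  Complex.exp (2 * Real.pi * Complex.I * (τ * m n)) *
    Complex.exp (2 * Real.pi * Complex.I * deg n)

/-- `v` is the value at `(τ, m)` of the analytic continuation of
`(τ, m) ↦ ∑_{n ∈ C ∩ N} q^{m·n} e^{2πi deg(n)}` in `ℍ × M_ℂ`: there are a connected open subset `U`
of `ℍ × M_ℂ` containing `(τ, m)` and an analytic function on `U` that has value `v` at `(τ, m)` and
is the sum of the (absolutely convergent) series on a nonempty open subset of `U`. -/
def IsContinuationValue {r : ℕ} {N : Submodule ℤ (RealSpace r)} (deg : N → ℂ)
    (C : Set (RealSpace r)) (τ : ℂ) (m : ComplexDual r) (v : ℂ) : Prop :=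
  ∃ (U V : Set (ℂ × ComplexDual r)) (F : ℂ × ComplexDual r → ℂ),
    IsOpen U ∧ IsPreconnected U ∧ (∀ x ∈ U, 0 < x.1.im) ∧ (τ, m) ∈ U ∧ AnalyticOnNhd ℂ F U ∧
    IsOpen V ∧ V.Nonempty ∧ V ⊆ U ∧
    (∀ x ∈ V, HasSum
      (fun n : {n : N // (n : RealSpace r) ∈ C} => coneSummand deg x.1 x.2 n.1) (F x)) ∧
    F (τ, m) = v

open Classical in
/-- The analytically continued cone sum `f_C(q, m)`. -/
def coneSum {r : ℕ} {N : Submodule ℤ (RealSpace r)} (deg : N → ℂ)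
    (C : Set (RealSpace r)) (τ : ℂ) (m : ComplexDual r) : ℂ :=
  if h : ∃ v, IsContinuationValue deg C τ m v then h.choose else 0

/-- The alternating sum `∑_{C ∈ Σ} (-1)^{codim C} f_C(q, m)`. -/
def fanSum {r : ℕ} {N : Submodule ℤ (RealSpace r)} (Fan : CompleteFan N) (deg : N → ℂ)
    (τ : ℂ) (m : dualLattice N) : ℂ :=
  ∑ C ∈ Fan.cones, (-1 : ℂ) ^ (r - coneDim C) * coneSum deg C τ (toComplexDual m)

/-- The toric form `f_{N,deg}`. -/
def toricForm {r : ℕ} {N : Submodule ℤ (RealSpace r)} (Fan : CompleteFan N) (deg : N → ℂ) :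
    UpperHalfPlane → ℂ :=
  fun τ => ∑' m : dualLattice N, fanSum Fan deg τ m

/-- The defining expression of `f_{N,deg}` makes sense at every `τ ∈ ℍ`: each cone sum has exactly
one analytic continuation value at each `m ∈ M`, and the sum over `M` converges absolutely. -/
def IsWellDefined {r : ℕ} {N : Submodule ℤ (RealSpace r)} (Fan : CompleteFan N)
    (deg : N → ℂ) : Prop :=
  ∀ τ : UpperHalfPlane,
    (∀ C ∈ Fan.cones, ∀ m : dualLattice N,
      ∃! v, IsContinuationValue deg C τ (toComplexDual m) v) ∧
    Summable (fun m : dualLattice N => fanSum Fan deg τ m)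

/-- The space `𝒯_r(l)` of toric forms of weight `r` and level `l`. -/
def toricSpace (r l : ℕ) : Submodule ℂ (UpperHalfPlane → ℂ) :=
  Submodule.span ℂ {f | ∃ (N : Submodule ℤ (RealSpace r)) (_ : DiscreteTopology N)
    (_ : IsZLattice ℝ N) (Fan : CompleteFan N) (deg : N → ℂ),
    IsToricDataOfLevel Fan deg l ∧ f = toricForm Fan deg}

/-- The space `𝒯(l)` of all toric forms of level `l`, the sum of the `𝒯_r(l)`. -/
def toricRing (l : ℕ) : Submodule ℂ (UpperHalfPlane → ℂ) :=
  ⨆ r : ℕ, toricSpace r l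

/-- The point `pτ` of the upper half-plane. -/
def scale (p : ℕ) (hp : 0 < p) (τ : UpperHalfPlane) : UpperHalfPlane :=
  ⟨(p : ℂ) * (τ : ℂ), by
    have h : (0 : ℝ) < p := by exact_mod_cast hp
    simpa using mul_pos h τ.im_pos⟩

/-- The function `deg/p + [m/p]`, where `[m/p](n) = (m · n)/p`. -/
def shiftedDeg {r : ℕ} {N : Submodule ℤ (RealSpace r)} (deg : N → ℂ) (p : ℕ)
    (m : dualLattice N) : N → ℂ :=
  fun n => deg n / (p : ℂ) + ((m.1 n : ℝ) : ℂ) / (p : ℂ)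

/-- `R` is a complete set of representatives of the residue classes of `M` modulo `pM`. -/
def IsCompleteResidueSystem {r : ℕ} {N : Submodule ℤ (RealSpace r)} (p : ℕ)
    (R : Finset (dualLattice N)) : Prop :=
  ∀ m : dualLattice N, ∃! k, k ∈ R ∧ ∃ j : dualLattice N, m - k = p • j

end ToricForm

end

/-! Formally the identity is short. Replacing τ by pτ turns q^{m·n} into q^{m·(pn)}, and deg(n) =
deg(pn)/p because deg is linear on each cone; so f_C at pτ is the series over C ∩ pN with degree
deg/p. Orthogonality of the characters of N/pN says that the indicator of pN in N is p^{-r} ∑_k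
e^{2πi (m_k·n)/p}. Hence f_C at pτ is the average of the f_C for the shifted degrees
(`coneSum_scale`). Summing over C and M gives the formula, and the membership statements follow
since the shifted degrees are toric data of level pl.

Two points need work: the terms are continued values rather than sums, and the sum over M must
converge absolutely.

For the first, continuation is replaced by algebra. A function `a` on N has regularised value
h(χ)/g(χ) at a character χ if g * a = h with g, h in the group algebra and g(χ) ≠ 0 (`IsReg`). This
value is unique, linear in `a`, compatible with injective endomorphisms of N, and equal to the sum
when the series converges. For a cone, g can be the product of 1 - e^{2πi deg(d)}[d] over its rays,
by triangulation. The identity theorem then makes the regularised value the only continuation value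
(`isContinuationValue_iff`).

For the second, the Euler relation `sum_sign_cones_containing` shows that the alternating sum over
the fan is the regularised value of e^{2πi deg} on all of N (`isReg_weight_fanSum`). It can
therefore be computed from any other decomposition of N. Given m ≠ 0, take a generic ξ with m·ξ <
-‖m‖/2 and cut N into half-open simplicial cones, a point n being assigned to the open simplex
containing n + εξ for small ε > 0. The value on each piece is an explicit quotient bounded by a
multiple of a sum of terms e^{-c‖m‖} (`exists_simplexPart_bound`). Only finitely many patterns of
removed faces occur as ξ varies, so the bounds are summable over M. -/

noncomputable section

namespace ToricForm

/-! ### Regularised values of divergent series, by the group algebra. -/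

section Regularization

variable {A : Type*} [AddCommGroup A]

/-- Translation of functions on `A`. -/
def translation : Multiplicative A →* Module.End ℂ (A → ℂ) where
  toFun n :=
    { toFun := fun a k => a (k - n.toAdd)
      map_add' := fun _ _ => rfl
      map_smul' := fun _ _ => rfl }
  map_one' := by ext a k; simp
  map_mul' := by
    intro x y
    ext a k
    simp [sub_sub]

/-- The action of the group algebra on functions by convolution. -/
def convAct : AddMonoidAlgebra ℂ A →ₐ[ℂ] Module.End ℂ (A → ℂ) :=
  AddMonoidAlgebra.lift ℂ (Module.End ℂ (A → ℂ)) A translation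

/-- Evaluation of the group algebra at a character. -/
def evalChar (χ : Multiplicative A →* ℂ) : AddMonoidAlgebra ℂ A →ₐ[ℂ] ℂ :=
  AddMonoidAlgebra.lift ℂ ℂ A χ

theorem convAct_single (n : A) (c : ℂ) (a : A → ℂ) (k : A) :
    convAct (AddMonoidAlgebra.single n c) a k = c * a (k - n) := by
  simp [convAct, AddMonoidAlgebra.lift_single, translation]

theorem evalChar_single (χ : Multiplicative A →* ℂ) (n : A) (c : ℂ) :
    evalChar χ (AddMonoidAlgebra.single n c) = c * χ (Multiplicative.ofAdd n) := by
  simp [evalChar, AddMonoidAlgebra.lift_single]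

theorem evalChar_eq_sum (χ : Multiplicative A →* ℂ) (h : AddMonoidAlgebra ℂ A) :
    evalChar χ h = ∑ n ∈ h.coeff.support, h.coeff n * χ (Multiplicative.ofAdd n) := by
  rw [evalChar, AddMonoidAlgebra.lift_apply]
  simp [Finsupp.sum]

theorem convAct_coeff (g h : AddMonoidAlgebra ℂ A) :
    convAct g (⇑h.coeff) = ⇑(g * h).coeff := by
  induction g using AddMonoidAlgebra.induction_linear with
  | zero => simp
  | add f g hf hg => simp [add_mul, hf, hg]
  | single n c =>
    ext k
    rw [convAct_single, AddMonoidAlgebra.coeff_single_mul_apply]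
    congr 2
    abel

/-- `v` is the regularised value of the series `∑ a n * χ n`: some element of the group algebra
that does not vanish at `χ` carries `a` to a finitely supported function. -/
def IsReg (χ : Multiplicative A →* ℂ) (a : A → ℂ) (v : ℂ) : Prop :=
  ∃ g h : AddMonoidAlgebra ℂ A,
    convAct g a = ⇑h.coeff ∧ evalChar χ g ≠ 0 ∧ evalChar χ h = v * evalChar χ g

theorem coeff_fun_injective {A : Type*} : Function.Injective
    (fun h : AddMonoidAlgebra ℂ A => (⇑h.coeff : A → ℂ)) := by
  intro x y hxy
  have : x.coeff = y.coeff := DFunLike.coe_injective hxy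
  exact AddMonoidAlgebra.coeff_injective this

/-- Both `g' * k` and `g * k'` have the coefficients of `g * g'` convolved with `a`, so they agree;
evaluation at `χ` then compares the two fractions. -/
theorem IsReg.unique {χ : Multiplicative A →* ℂ} {a : A → ℂ} {v v' : ℂ}
    (h : IsReg χ a v) (h' : IsReg χ a v') : v = v' := by
  obtain ⟨g, k, h1, h2, h3⟩ := h
  obtain ⟨g', k', h1', h2', h3'⟩ := h'
  have e : g' * k = g * k' := by
    apply coeff_fun_injective
    change ⇑(g' * k).coeff = ⇑(g * k').coeff
    rw [← convAct_coeff, ← convAct_coeff, ← h1, ← h1', ← Module.End.mul_apply,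
      ← Module.End.mul_apply, ← map_mul, ← map_mul, mul_comm]
  have e2 := congrArg (evalChar χ) e
  rw [map_mul, map_mul, h3, h3'] at e2
  have h4 : evalChar χ g * evalChar χ g' ≠ 0 := mul_ne_zero h2 h2'
  apply mul_right_cancel₀ h4
  linear_combination e2

theorem IsReg.zero (χ : Multiplicative A →* ℂ) : IsReg χ 0 0 :=
  ⟨1, 0, by simp, by simp, by simp⟩

theorem IsReg.add {χ : Multiplicative A →* ℂ} {a a' : A → ℂ} {v v' : ℂ}
    (h : IsReg χ a v) (h' : IsReg χ a' v') : IsReg χ (a + a') (v + v') := by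
  obtain ⟨g, k, h1, h2, h3⟩ := h
  obtain ⟨g', k', h1', h2', h3'⟩ := h'
  refine ⟨g * g', g' * k + g * k', ?_, ?_, ?_⟩
  · rw [map_add, AddMonoidAlgebra.coeff_add, Finsupp.coe_add, ← convAct_coeff, ← convAct_coeff,
      ← h1, ← h1', map_mul]
    congr 1
    rw [← map_mul, mul_comm, map_mul]
    rfl
  · rw [map_mul]
    exact mul_ne_zero h2 h2'
  · rw [map_add, map_mul, map_mul, map_mul, h3, h3']
    ring

theorem IsReg.smul {χ : Multiplicative A →* ℂ} {a : A → ℂ} {v : ℂ} (c : ℂ)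
    (h : IsReg χ a v) : IsReg χ (c • a) (c * v) := by
  obtain ⟨g, k, h1, h2, h3⟩ := h
  refine ⟨g, c • k, ?_, h2, ?_⟩
  · rw [map_smul, h1, AddMonoidAlgebra.coeff_smul, Finsupp.coe_smul]
  · rw [map_smul, h3, smul_eq_mul, mul_assoc]

theorem IsReg.sum {ι : Type*} {χ : Multiplicative A →* ℂ} (s : Finset ι) {a : ι → A → ℂ}
    {v : ι → ℂ} (h : ∀ i ∈ s, IsReg χ (a i) (v i)) :
    IsReg χ (∑ i ∈ s, a i) (∑ i ∈ s, v i) := by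
  classical
  induction s using Finset.induction_on with
  | empty => simpa using IsReg.zero χ
  | insert i s hi ih =>
    rw [Finset.sum_insert hi, Finset.sum_insert hi]
    exact (h i (Finset.mem_insert_self i s)).add
      (ih fun j hj => h j (Finset.mem_insert_of_mem hj))

/-- Convolution multiplies the sum of an absolutely convergent series. -/
theorem hasSum_convAct {χ : Multiplicative A →* ℂ} {a : A → ℂ} {S : ℂ}
    (hS : HasSum (fun n => a n * χ (Multiplicative.ofAdd n)) S) (g : AddMonoidAlgebra ℂ A) :
    HasSum (fun n => convAct g a n * χ (Multiplicative.ofAdd n)) (evalChar χ g * S) := by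
  induction g using AddMonoidAlgebra.induction_linear with
  | zero => simp
  | add f g hf hg =>
    simp only [map_add, add_mul, LinearMap.add_apply, Pi.add_apply]
    exact hf.add hg
  | single n c =>
    have h1 := ((Equiv.subRight n).hasSum_iff.mpr hS).mul_left (c * χ (Multiplicative.ofAdd n))
    rw [evalChar_single]
    refine h1.congr_fun ?_
    intro k
    rw [convAct_single]
    simp only [Function.comp, Equiv.subRight_apply]
    have : χ (Multiplicative.ofAdd k) =
        χ (Multiplicative.ofAdd n) * χ (Multiplicative.ofAdd (k - n)) := by
      rw [← map_mul, ← ofAdd_add]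
      congr 2
      abel
    rw [this]
    ring

/-- This is where the algebraic value meets the analytic one: convolution multiplies a convergent
sum by `evalChar χ g`, and the convolved series is finite. It does not require `evalChar χ g ≠ 0`.
-/
theorem evalChar_eq_of_hasSum {χ : Multiplicative A →* ℂ} {a : A → ℂ} {S : ℂ}
    (hS : HasSum (fun n => a n * χ (Multiplicative.ofAdd n)) S) {g h : AddMonoidAlgebra ℂ A}
    (hg : convAct g a = ⇑h.coeff) : evalChar χ h = evalChar χ g * S := by
  have h1 := hasSum_convAct hS g
  rw [hg] at h1
  refine HasSum.unique ?_ h1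
  rw [evalChar_eq_sum]
  exact hasSum_sum_of_ne_finset_zero (by simp +contextual)

/-- The pair `(g, k)` is transported by the algebra map [n] ↦ [φ n], which is compatible with
convolution and extension by zero. With φ multiplication by p, a series evaluated at pτ becomes a
series supported on pN evaluated at τ. -/
theorem IsReg.map {φ : A →+ A} (hφ : Function.Injective φ) {χ : Multiplicative A →* ℂ}
    {a : A → ℂ} {v : ℂ} (h : IsReg (χ.comp (AddMonoidHom.toMultiplicative φ)) a v) :
    IsReg χ (Function.extend φ a 0) v := by
  obtain ⟨g, k, h1, h2, h3⟩ := h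
  let T : AddMonoidAlgebra ℂ A →ₐ[ℂ] AddMonoidAlgebra ℂ A :=
    AddMonoidAlgebra.lift ℂ (AddMonoidAlgebra ℂ A) A
      { toFun := fun n => AddMonoidAlgebra.single (φ n.toAdd) 1
        map_one' := by simp [AddMonoidAlgebra.one_def]
        map_mul' := by intro x y; simp [AddMonoidAlgebra.single_mul_single] }
  have hT : ∀ n c, T (AddMonoidAlgebra.single n c) = AddMonoidAlgebra.single (φ n) c := by
    intro n c
    simp [T, AddMonoidAlgebra.lift_single]
  have hev : ∀ f, evalChar χ (T f) =
      evalChar (χ.comp (AddMonoidHom.toMultiplicative φ)) f := by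
    intro f
    induction f using AddMonoidAlgebra.induction_linear with
    | zero => simp
    | add f g hf hg => simp [hf, hg]
    | single n c => rw [hT, evalChar_single, evalChar_single]; rfl
  have hadd : ∀ b b' : A → ℂ, Function.extend φ (b + b') 0 =
      Function.extend φ b 0 + Function.extend φ b' 0 := by
    intro b b'
    have := Function.extend_add φ b b' 0 0
    simpa using this
  have hco : ∀ f : AddMonoidAlgebra ℂ A, ⇑(T f).coeff = Function.extend φ (⇑f.coeff) 0 := by
    intro f
    induction f using AddMonoidAlgebra.induction_linear with
    | zero =>
      ext k
      by_cases hk : ∃ j, φ j = k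
      · obtain ⟨j, rfl⟩ := hk; simp [hφ.extend_apply]
      · simp [Function.extend_apply' _ _ _ hk]
    | add f g hf hg =>
      rw [map_add, AddMonoidAlgebra.coeff_add, Finsupp.coe_add, hf, hg, ← hadd]
      rfl
    | single n c =>
      classical
      ext k
      rw [hT]
      by_cases hk : ∃ j, φ j = k
      · obtain ⟨j, rfl⟩ := hk
        simp [hφ.extend_apply, Finsupp.single_apply, hφ.eq_iff]
      · have : φ n ≠ k := fun h => hk ⟨n, h⟩
        simp [Function.extend_apply' _ _ _ hk, this]
  have hact : ∀ (f : AddMonoidAlgebra ℂ A) (b : A → ℂ),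
      convAct (T f) (Function.extend φ b 0) = Function.extend φ (convAct f b) 0 := by
    intro f b
    induction f using AddMonoidAlgebra.induction_linear with
    | zero =>
      ext k
      by_cases hk : ∃ j, φ j = k
      · obtain ⟨j, rfl⟩ := hk; simp [hφ.extend_apply]
      · simp [Function.extend_apply' _ _ _ hk]
    | add f g hf hg =>
      rw [map_add, map_add, LinearMap.add_apply, hf, hg, map_add, LinearMap.add_apply, hadd]
    | single n c =>
      ext k
      rw [hT, convAct_single]
      by_cases hk : ∃ j, φ j = k
      · obtain ⟨j, rfl⟩ := hk
        rw [hφ.extend_apply, ← map_sub, hφ.extend_apply, convAct_single]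
      · have hk' : ¬ ∃ j, φ j = k - φ n := by
          rintro ⟨j, hj⟩
          exact hk ⟨j + n, by rw [map_add, hj]; abel⟩
        rw [Function.extend_apply' _ _ _ hk, Function.extend_apply' _ _ _ hk']
        simp
  exact ⟨T g, T k, by rw [hact, h1, hco], by rwa [hev], by rw [hev, hev, h3]⟩

end Regularization

/-! ### Half-open simplicial cones and their generating functions. -/

section Simplicial

variable {E : Type*} [NormedAddCommGroup E] {ι : Type*}

section RayPoly

variable {N : Submodule ℤ E}

/-- The denominator `∏ (1 - w(d) [d])` attached to the vectors `d i`, `i ∈ B`. -/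
def rayPoly (d : ι → N) (w : N → ℂ) (B : Finset ι) : AddMonoidAlgebra ℂ N :=
  ∏ i ∈ B, (1 - AddMonoidAlgebra.single (d i) (w (d i)))

theorem evalChar_rayPoly (χ : Multiplicative N →* ℂ) (d : ι → N) (w : N → ℂ) (B : Finset ι) :
    evalChar χ (rayPoly d w B) = ∏ i ∈ B, (1 - w (d i) * χ (Multiplicative.ofAdd (d i))) := by
  simp [rayPoly, map_prod, evalChar_single]

end RayPoly

variable [NormedSpace ℝ E]

-- Independence is placed inside the existential so that `coord` is a total function without a proof
-- argument; nothing is asserted about it for dependent families.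
open Classical in
theorem exists_coord (v : ι → E) (B : Finset ι) :
    ∃ c : ι → E →ₗ[ℝ] ℝ, LinearIndepOn ℝ v (B : Set ι) →
      ∀ i ∈ B, ∀ j ∈ B, c i (v j) = if i = j then 1 else 0 := by
  by_cases hB : LinearIndepOn ℝ v (B : Set ι)
  · have key : ∀ i : ι, ∃ c : E →ₗ[ℝ] ℝ, i ∈ B → ∀ j ∈ B, c (v j) = if i = j then 1 else 0 := by
      intro i
      by_cases hi : i ∈ B
      · have hli : LinearIndependent ℝ (fun j : (B : Set ι) => v j) := hB
        obtain ⟨c, hc⟩ := LinearMap.exists_extend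
          ((Finsupp.lapply (R := ℝ) (⟨i, hi⟩ : (B : Set ι))).comp hli.repr)
        refine ⟨c, fun _ j hj => ?_⟩
        have hmem : v j ∈ Submodule.span ℝ (Set.range (fun j : (B : Set ι) => v j)) :=
          Submodule.subset_span ⟨⟨j, hj⟩, rfl⟩
        have h1 := LinearMap.congr_fun hc ⟨v j, hmem⟩
        have h2 := hli.repr_eq_single ⟨j, hj⟩ ⟨v j, hmem⟩ rfl
        simp only [LinearMap.comp_apply, Submodule.subtype_apply, h2, Finsupp.lapply_apply,
          Finsupp.single_apply, Subtype.mk.injEq] at h1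
        rw [h1]
        simp [eq_comm]
      · exact ⟨0, fun h => absurd h hi⟩
    choose c hc using key
    exact ⟨c, fun _ i hi => hc i hi⟩
  · exact ⟨0, fun h => absurd h hB⟩

/-- Coordinate functionals for the linearly independent vectors `v i`, `i ∈ B`. -/
def coord (v : ι → E) (B : Finset ι) : ι → E →ₗ[ℝ] ℝ := (exists_coord v B).choose

open Classical in
theorem coord_apply {v : ι → E} {B : Finset ι} (hB : LinearIndepOn ℝ v (B : Set ι)) {i j : ι}
    (hi : i ∈ B) (hj : j ∈ B) : coord v B i (v j) = if i = j then 1 else 0 :=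
  (exists_coord v B).choose_spec hB i hi j hj

theorem coord_sum {v : ι → E} {B : Finset ι} (hB : LinearIndepOn ℝ v (B : Set ι)) (c : ι → ℝ)
    {i : ι} (hi : i ∈ B) : coord v B i (∑ j ∈ B, c j • v j) = c i := by
  classical
  rw [map_sum, Finset.sum_eq_single_of_mem i hi]
  · simp [coord_apply hB hi hi]
  · intro j hj hji
    simp [coord_apply hB hi hj, hji.symm]

theorem sum_coord_smul {v : ι → E} {B : Finset ι} (hB : LinearIndepOn ℝ v (B : Set ι)) {x : E}
    (hx : x ∈ Submodule.span ℝ (v '' (B : Set ι))) : ∑ i ∈ B, coord v B i x • v i = x := by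
  induction hx using Submodule.span_induction with
  | mem x hx =>
    obtain ⟨j, hj, rfl⟩ := hx
    classical
    rw [Finset.sum_eq_single_of_mem j hj]
    · simp [coord_apply hB hj hj]
    · intro i hi hij
      simp [coord_apply hB hi hj, hij]
  | zero => simp
  | add x y _ _ hx hy =>
    simp only [map_add, add_smul, Finset.sum_add_distrib, hx, hy]
  | smul t x _ hx =>
    simp only [map_smul, smul_eq_mul, mul_smul, ← Finset.smul_sum, hx]

/-- The points of the span of the `v i`, `i ∈ B`, whose coordinates are nonnegative, and positive
for `i ∈ J`; for `i ∈ I` the coordinate is moreover confined to `[0, 1)`, or to `(0, 1]` when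
`i ∈ J`. -/
def conePart (v : ι → E) (B J I : Finset ι) : Set E :=
  {x | x ∈ Submodule.span ℝ (v '' (B : Set ι)) ∧ ∀ i ∈ B, 0 ≤ coord v B i x ∧
    (i ∈ J → 0 < coord v B i x) ∧
    (i ∈ I → coord v B i x ≤ 1 ∧ (i ∉ J → coord v B i x < 1))}

theorem conePart_subset (v : ι → E) (B J I : Finset ι) : conePart v B J I ⊆ conePart v B ∅ ∅ := by
  intro x hx
  exact ⟨hx.1, fun i hi => ⟨(hx.2 i hi).1, by simp, by simp⟩⟩

theorem mem_conePart_self {v : ι → E} {B : Finset ι} (hB : LinearIndepOn ℝ v (B : Set ι)) {i : ι}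
    (hi : i ∈ B) : v i ∈ conePart v B ∅ ∅ := by
  classical
  refine ⟨Submodule.subset_span ⟨i, hi, rfl⟩, fun j hj => ⟨?_, by simp, by simp⟩⟩
  rw [coord_apply hB hj hi]
  split_ifs <;> norm_num

theorem add_mem_conePart {v : ι → E} {B J I : Finset ι} (hB : LinearIndepOn ℝ v (B : Set ι))
    {j : ι} (hj : j ∈ B) (hjI : j ∉ I) {x : E} (hx : x ∈ conePart v B J I) :
    x + v j ∈ conePart v B J I := by
  classical
  refine ⟨Submodule.add_mem _ hx.1 (Submodule.subset_span ⟨j, hj, rfl⟩), fun i hi => ?_⟩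
  have h := hx.2 i hi
  rw [map_add, coord_apply hB hi hj]
  split_ifs with hij
  · subst hij
    exact ⟨by linarith [h.1], fun hJ => by linarith [h.2.1 hJ], fun hI => absurd hI hjI⟩
  · simpa using h

-- Removing the translate by `v j` truncates the j-th coordinate to a unit interval: [0,∞) minus
-- [1,∞) leaves [0,1), and for `j ∈ J`, (0,∞) minus (1,∞) leaves (0,1].
open Classical in
theorem mem_conePart_insert {v : ι → E} {B J I : Finset ι}
    (hB : LinearIndepOn ℝ v (B : Set ι)) {j : ι} (hj : j ∈ B) (hjI : j ∉ I) (x : E) :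
    x ∈ conePart v B J (insert j I) ↔ x ∈ conePart v B J I ∧ x - v j ∉ conePart v B J I := by
  constructor
  · intro h
    refine ⟨⟨h.1, fun i hi => ⟨(h.2 i hi).1, (h.2 i hi).2.1, fun hI =>
      (h.2 i hi).2.2 (Finset.mem_insert_of_mem hI)⟩⟩, fun h' => ?_⟩
    have h1 := h'.2 j hj
    rw [map_sub, coord_apply hB hj hj, if_pos rfl] at h1
    have h2 := (h.2 j hj).2.2 (Finset.mem_insert_self j I)
    by_cases hJ : j ∈ J
    · linarith [h1.2.1 hJ, h2.1]
    · linarith [h1.1, h2.2 hJ]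
  · rintro ⟨h, h'⟩
    refine ⟨h.1, fun i hi => ⟨(h.2 i hi).1, (h.2 i hi).2.1, fun hI => ?_⟩⟩
    rcases Finset.mem_insert.mp hI with rfl | hI
    · by_contra hcon
      apply h'
      refine ⟨Submodule.sub_mem _ h.1 (Submodule.subset_span ⟨i, hj, rfl⟩), fun k hk => ?_⟩
      rw [map_sub, coord_apply hB hk hj]
      split_ifs with hki
      · subst hki
        by_cases hJ : k ∈ J
        · have : 1 < coord v B k x := by
            by_contra hle
            exact hcon ⟨not_lt.mp hle, fun hn => absurd hJ hn⟩
          exact ⟨by linarith, fun _ => by linarith, fun h => absurd h hjI⟩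
        · have : 1 ≤ coord v B k x := by
            by_contra hle
            exact hcon ⟨(not_le.mp hle).le, fun _ => not_le.mp hle⟩
          exact ⟨by linarith, fun h => absurd h hJ, fun h => absurd h hjI⟩
      · simpa using h.2 k hk
    · exact (h.2 i hi).2.2 hI

variable {N : Submodule ℤ E}

/-- A geometric series in several directions: `w` is multiplicative on the closed cone, so the
factor 1 - w(d_j)[d_j] cancels the translate by d_j. Induction on `I ⊆ B` truncates one coordinate
at a time. -/
theorem convAct_rayPoly_conePart {d : ι → N} {B : Finset ι} (J : Finset ι)
    (hB : LinearIndepOn ℝ (fun i => (d i : E)) (B : Set ι)) (w : N → ℂ)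
    (Λ : Multiplicative N →* ℂ)
    (hw : ∀ n : N, (n : E) ∈ conePart (fun i => (d i : E)) B ∅ ∅ → w n = Λ (Multiplicative.ofAdd n)) :
    convAct (rayPoly d w B)
        (Set.indicator {n : N | (n : E) ∈ conePart (fun i => (d i : E)) B J ∅} w) =
      Set.indicator {n : N | (n : E) ∈ conePart (fun i => (d i : E)) B J B} w := by
  classical
  have key : ∀ I : Finset ι, I ⊆ B → convAct (rayPoly d w I)
        (Set.indicator {n : N | (n : E) ∈ conePart (fun i => (d i : E)) B J ∅} w) =
      Set.indicator {n : N | (n : E) ∈ conePart (fun i => (d i : E)) B J I} w := by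
    intro I
    induction I using Finset.induction_on with
    | empty => intro _; simp [rayPoly]
    | insert j I hjI ih =>
      intro hI
      have hj : j ∈ B := hI (Finset.mem_insert_self j I)
      rw [rayPoly, Finset.prod_insert hjI, map_mul, Module.End.mul_apply,
        ← rayPoly, ih ((Finset.subset_insert j I).trans hI)]
      ext n
      rw [map_sub, map_one, LinearMap.sub_apply, Pi.sub_apply, Module.End.one_apply, convAct_single]
      have hmem := mem_conePart_insert (J := J) hB hj hjI (n : E)
      have hadd : (n : E) - d j ∈ conePart (fun i => (d i : E)) B J I →
          (n : E) ∈ conePart (fun i => (d i : E)) B J I := by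
        intro h
        simpa using add_mem_conePart hB hj hjI h
      have hmul : (n : E) - d j ∈ conePart (fun i => (d i : E)) B J I →
          w (d j) * w (n - d j) = w n := by
        intro h
        rw [hw _ (mem_conePart_self hB hj), hw n (conePart_subset _ _ _ _ (hadd h)),
          hw (n - d j) (conePart_subset _ _ _ _ (by simpa using h)), ← map_mul, ← ofAdd_add]
        congr 2
        abel
      simp only [Set.indicator_apply, Set.mem_ofPred_eq, Submodule.coe_sub, hmem]
      by_cases h1 : (n : E) - d j ∈ conePart (fun i => (d i : E)) B J I
      · simp [h1, hadd h1, hmul h1]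
      · simp [h1]
  exact key B (Finset.Subset.refl B)

theorem finite_lattice_norm_le [FiniteDimensional ℝ E] (N : Submodule ℤ E) [DiscreteTopology N]
    (R : ℝ) : {n : N | ‖(n : E)‖ ≤ R}.Finite := by
  have : ProperSpace E := FiniteDimensional.proper ℝ E
  have hcl : IsClosed (N : Set E) :=
    @AddSubgroup.isClosed_of_discrete _ _ _ _ _ N.toAddSubgroup
      (inferInstanceAs (DiscreteTopology N))
  have hf := Metric.finite_isBounded_inter_isClosed (K := Metric.closedBall (0 : E) R)
    (s := (N : Set E)) DiscreteTopology.isDiscrete Metric.isBounded_closedBall hcl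
  refine Set.Finite.of_finite_image (f := Subtype.val) (hf.subset ?_)
    Subtype.val_injective.injOn
  rintro _ ⟨n, hn, rfl⟩
  exact ⟨mem_closedBall_zero_iff.mpr hn, n.2⟩

/-- All coordinates are at most 1, so the box is bounded and meets the discrete lattice in a finite
set. -/
theorem finite_box [FiniteDimensional ℝ E] [DiscreteTopology N] (d : ι → N) {B : Finset ι}
    (J : Finset ι) (hB : LinearIndepOn ℝ (fun i => (d i : E)) (B : Set ι)) :
    {n : N | (n : E) ∈ conePart (fun i => (d i : E)) B J B}.Finite := by
  refine (finite_lattice_norm_le N (∑ i ∈ B, ‖(d i : E)‖)).subset fun n hn => ?_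
  rw [Set.mem_ofPred_eq, ← sum_coord_smul hB hn.1]
  refine norm_sum_le_of_le _ fun i hi => ?_
  have h := hn.2 i hi
  rw [norm_smul, Real.norm_eq_abs, abs_of_nonneg h.1]
  exact mul_le_of_le_one_left (norm_nonneg _) (h.2.2 hi).1

/-- The group algebra element with prescribed finitely many coefficients. -/
def ofFiniteIndicator {A : Type*} {S : Set A} (hS : S.Finite) (w : A → ℂ) :
    AddMonoidAlgebra ℂ A :=
  AddMonoidAlgebra.ofCoeff (Finsupp.ofSupportFinite (S.indicator w)
    (hS.subset Set.support_indicator_subset))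

theorem coeff_ofFiniteIndicator {A : Type*} {S : Set A} (hS : S.Finite) (w : A → ℂ) :
    ⇑(ofFiniteIndicator hS w).coeff = S.indicator w := rfl

theorem evalChar_ofFiniteIndicator {A : Type*} [AddCommGroup A] {S : Set A} (hS : S.Finite)
    (w : A → ℂ) (χ : Multiplicative A →* ℂ) :
    evalChar χ (ofFiniteIndicator hS w) =
      ∑ s ∈ hS.toFinset, w s * χ (Multiplicative.ofAdd s) := by
  rw [evalChar_eq_sum, coeff_ofFiniteIndicator]
  refine (Finset.sum_subset ?_ ?_).trans (Finset.sum_congr rfl ?_)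
  · intro s hs
    rw [Finsupp.mem_support_iff, coeff_ofFiniteIndicator] at hs
    exact hS.mem_toFinset.mpr (Set.mem_of_indicator_ne_zero hs)
  · intro s _ hs
    rw [Finsupp.notMem_support_iff, coeff_ofFiniteIndicator] at hs
    rw [hs, zero_mul]
  · intro s hs
    rw [Set.indicator_of_mem (hS.mem_toFinset.mp hs)]

/-- The regularised series over a half-open simplicial cone is an explicit rational function. -/
theorem isReg_conePart [FiniteDimensional ℝ E] [DiscreteTopology N] {d : ι → N} {B : Finset ι}
    (J : Finset ι) (hB : LinearIndepOn ℝ (fun i => (d i : E)) (B : Set ι)) (w : N → ℂ)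
    (Λ : Multiplicative N →* ℂ)
    (hw : ∀ n : N, (n : E) ∈ conePart (fun i => (d i : E)) B ∅ ∅ → w n = Λ (Multiplicative.ofAdd n))
    (χ : Multiplicative N →* ℂ) (hχ : ∀ i ∈ B, w (d i) * χ (Multiplicative.ofAdd (d i)) ≠ 1) :
    IsReg χ (Set.indicator {n : N | (n : E) ∈ conePart (fun i => (d i : E)) B J ∅} w)
      ((∑ s ∈ (finite_box d J hB).toFinset, w s * χ (Multiplicative.ofAdd s)) /
        ∏ i ∈ B, (1 - w (d i) * χ (Multiplicative.ofAdd (d i)))) := by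
  have h0 : ∏ i ∈ B, (1 - w (d i) * χ (Multiplicative.ofAdd (d i))) ≠ 0 :=
    Finset.prod_ne_zero_iff.mpr fun i hi => sub_ne_zero.mpr (hχ i hi).symm
  refine ⟨rayPoly d w B, ofFiniteIndicator (finite_box d J hB) w, ?_, ?_, ?_⟩
  · rw [coeff_ofFiniteIndicator, convAct_rayPoly_conePart J hB w Λ hw]
  · rwa [evalChar_rayPoly]
  · rw [evalChar_rayPoly, evalChar_ofFiniteIndicator, div_mul_cancel₀ _ h0]

/-- Multiplying by further denominators, the indicator of a half-open simplicial cone still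
becomes finitely supported. -/
theorem exists_convAct_rayPoly_univ [Fintype ι] [FiniteDimensional ℝ E] [DiscreteTopology N]
    {d : ι → N} {B : Finset ι}
    (J : Finset ι) (hB : LinearIndepOn ℝ (fun i => (d i : E)) (B : Set ι)) (w : N → ℂ)
    (Λ : Multiplicative N →* ℂ)
    (hw : ∀ n : N, (n : E) ∈ conePart (fun i => (d i : E)) B ∅ ∅ → w n = Λ (Multiplicative.ofAdd n)) :
    ∃ h : AddMonoidAlgebra ℂ N, convAct (rayPoly d w Finset.univ)
      (Set.indicator {n : N | (n : E) ∈ conePart (fun i => (d i : E)) B J ∅} w) = ⇑h.coeff := by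
  classical
  have h1 : rayPoly d w Finset.univ = rayPoly d w (Finset.univ \ B) * rayPoly d w B :=
    (Finset.prod_sdiff (Finset.subset_univ B)).symm
  refine ⟨rayPoly d w (Finset.univ \ B) * ofFiniteIndicator (finite_box d J hB) w, ?_⟩
  rw [h1, map_mul, Module.End.mul_apply, convAct_rayPoly_conePart J hB w Λ hw, ← convAct_coeff,
    coeff_ofFiniteIndicator]

end Simplicial

/-! ### Regular triangulations of finitely generated cones. -/

section Triangulation

open Filter Topology

variable {E : Type*} [NormedAddCommGroup E] [NormedSpace ℝ E] {ι : Type*}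

/-- The line through x in direction ξ meets S at most once, for two points would put a nonzero
multiple of ξ in S. -/
theorem eventually_add_smul_notMem (S : Submodule ℝ E) {ξ : E} (hξ : ξ ∉ S) (x : E) :
    ∀ᶠ ε : ℝ in 𝓝[>] 0, x + ε • ξ ∉ S := by
  have hsub : {ε : ℝ | x + ε • ξ ∈ S}.Subsingleton := by
    intro a ha b hb
    by_contra hab
    apply hξ
    have h1 : (a - b) • ξ ∈ S := by
      have := S.sub_mem ha hb
      rwa [add_sub_add_left_eq_sub, ← sub_smul] at this
    exact (S.smul_mem_iff (sub_ne_zero.mpr hab)).mp h1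
  exact (nhdsGT_le_nhdsNE (0 : ℝ)).trans (nhdsNE_le_cofinite 0) hsub.finite.compl_mem_cofinite

/-- A real vector space is not a finite union of proper subspaces; a small multiple of a vector
outside all of them perturbs `u` within `U`. -/
theorem exists_mem_open_notMem {κ : Type*} [Finite κ] (S : κ → Submodule ℝ E)
    (hS : ∀ k, S k ≠ ⊤) {U : Set E} (hU : IsOpen U) {u : E} (hu : u ∈ U) :
    ∃ x ∈ U, ∀ k, x ∉ S k := by
  classical
  have := Fintype.ofFinite κ
  obtain ⟨y, hy⟩ : ∃ y, ∀ k, y ∉ S k := by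
    have h := Subspace.biUnion_ne_univ_of_top_notMem (k := ℝ) (E := E)
      (s := Finset.univ.image S) (by simpa using hS)
    obtain ⟨y, hy⟩ := (Set.ne_univ_iff_exists_notMem _).mp h
    exact ⟨y, fun k hk => hy (by simpa using ⟨k, hk⟩)⟩
  have h1 : ∀ᶠ ε : ℝ in 𝓝[>] 0, ∀ k, u + ε • y ∉ S k :=
    eventually_all.mpr fun k => eventually_add_smul_notMem (S k) (hy k) u
  have h2 : ∀ᶠ ε : ℝ in 𝓝[>] 0, u + ε • y ∈ U := by
    apply nhdsWithin_le_nhds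
    have hc : Continuous fun ε : ℝ => u + ε • y := by fun_prop
    exact hc.continuousAt.eventually_mem (hU.mem_nhds (by simpa using hu))
  obtain ⟨ε, h3, h4⟩ := (h1.and h2).exists
  exact ⟨_, h4, h3⟩

/-- `x` lies in no proper subspace of the span of the `v i` spanned by some of them. -/
def IsGeneric (v : ι → E) (x : E) : Prop :=
  ∀ B : Finset ι, Submodule.span ℝ (v '' (B : Set ι)) ≠ Submodule.span ℝ (Set.range v) →
    x ∉ Submodule.span ℝ (v '' (B : Set ι))

theorem IsGeneric.eventually [Finite ι] {v : ι → E} {ξ : E} (hξ : IsGeneric v ξ) (x : E) :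
    ∀ᶠ ε : ℝ in 𝓝[>] 0, IsGeneric v (x + ε • ξ) := by
  have := Fintype.ofFinite ι
  refine eventually_all.mpr fun B => ?_
  by_cases h : Submodule.span ℝ (v '' (B : Set ι)) = Submodule.span ℝ (Set.range v)
  · exact Eventually.of_forall fun ε hne => absurd h hne
  · exact (eventually_add_smul_notMem _ (hξ B h) x).mono fun ε he _ => he

/-- The cone generated by a finite family. -/
def coneHull [Fintype ι] (v : ι → E) : Set E :=
  {x | ∃ c : ι → ℝ, (∀ i, 0 ≤ c i) ∧ ∑ i, c i • v i = x}

/-- The relatively open cone generated by a linearly independent subfamily. -/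
def openPart (v : ι → E) (B : Finset ι) : Set E :=
  {x | x ∈ Submodule.span ℝ (v '' (B : Set ι)) ∧ ∀ i ∈ B, 0 < coord v B i x}

theorem conePart_subset_coneHull [Fintype ι] {v : ι → E} {B : Finset ι} (J : Finset ι)
    (hB : LinearIndepOn ℝ v (B : Set ι)) : conePart v B J ∅ ⊆ coneHull v := by
  classical
  intro x hx
  refine ⟨fun i => if i ∈ B then coord v B i x else 0, fun i => ?_, ?_⟩
  · dsimp only
    split_ifs with hi
    · exact (hx.2 i hi).1
    · exact le_rfl
  · simp only [ite_smul, zero_smul, Finset.sum_ite_mem, Finset.univ_inter]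
    exact sum_coord_smul hB hx.1

theorem openPart_subset_coneHull [Fintype ι] {v : ι → E} {B : Finset ι}
    (hB : LinearIndepOn ℝ v (B : Set ι)) : openPart v B ⊆ coneHull v := fun x hx =>
  conePart_subset_coneHull ∅ hB ⟨hx.1, fun i hi => ⟨(hx.2 i hi).le, by simp, by simp⟩⟩

open Classical in
/-- The indices at which the coordinate of `ξ` is negative. -/
def negSet (v : ι → E) (B : Finset ι) (ξ : E) : Finset ι := B.filter fun i => coord v B i ξ < 0

/-- A zero coordinate would place ξ in the span of the other basis vectors, a proper subspace since
it misses `v i`. -/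
theorem coord_ne_zero_of_isGeneric {v : ι → E} {B : Finset ι}
    (hB : LinearIndepOn ℝ v (B : Set ι))
    (hspan : Submodule.span ℝ (v '' (B : Set ι)) = Submodule.span ℝ (Set.range v))
    {ξ : E} (hξ : IsGeneric v ξ) (hξW : ξ ∈ Submodule.span ℝ (Set.range v)) {i : ι} (hi : i ∈ B) :
    coord v B i ξ ≠ 0 := by
  classical
  intro h0
  have hmem : ξ ∈ Submodule.span ℝ (v '' ((B.erase i : Finset ι) : Set ι)) := by
    have e := sum_coord_smul hB (x := ξ) (hspan ▸ hξW)
    rw [← Finset.add_sum_erase B _ hi, h0, zero_smul, zero_add] at e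
    rw [← e]
    exact Submodule.sum_mem _ fun j hj =>
      Submodule.smul_mem _ _ (Submodule.subset_span ⟨j, hj, rfl⟩)
  refine hξ (B.erase i) (fun hs => ?_) hmem
  have hvi : v i ∈ Submodule.span ℝ (v '' ((B.erase i : Finset ι) : Set ι)) := by
    rw [hs]
    exact Submodule.subset_span ⟨i, rfl⟩
  have hz : ∀ y ∈ Submodule.span ℝ (v '' ((B.erase i : Finset ι) : Set ι)),
      coord v B i y = 0 := by
    intro y hy
    induction hy using Submodule.span_induction with
    | mem y hy =>
      obtain ⟨j, hj, rfl⟩ := hy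
      have hj' : j ≠ i ∧ j ∈ B := by simpa [and_comm] using hj
      rw [coord_apply hB hi hj'.2, if_neg hj'.1.symm]
    | zero => simp
    | add x y _ _ hx hy => rw [map_add, hx, hy, add_zero]
    | smul t x _ hx => rw [map_smul, hx, smul_zero]
  have := hz _ hvi
  rw [coord_apply hB hi hi, if_pos rfl] at this
  exact one_ne_zero this

theorem eventually_pos_add_mul_iff (s : ℝ) {t : ℝ} (ht : t ≠ 0) :
    ∀ᶠ ε : ℝ in 𝓝[>] 0, (0 < s + ε * t ↔ 0 ≤ s ∧ (t < 0 → 0 < s)) := by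
  have hc : Tendsto (fun ε : ℝ => s + ε * t) (𝓝[>] 0) (𝓝 s) := by
    have : Continuous fun ε : ℝ => s + ε * t := by fun_prop
    have h := this.tendsto 0
    simp only [zero_mul, add_zero] at h
    exact h.mono_left nhdsWithin_le_nhds
  rcases lt_trichotomy s 0 with hs | rfl | hs
  · filter_upwards [hc.eventually_lt_const hs] with ε hε
    exact ⟨fun h => absurd h (not_lt.mpr hε.le), fun h => absurd h.1 (not_le.mpr hs)⟩
  · filter_upwards [self_mem_nhdsWithin] with ε hε
    have hε : 0 < ε := hε
    rw [zero_add, mul_pos_iff_of_pos_left hε]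
    constructor
    · exact fun h => ⟨le_rfl, fun h' => absurd h (not_lt.mpr h'.le)⟩
    · rintro ⟨-, h⟩
      rcases lt_or_gt_of_ne ht with h' | h'
      · exact absurd (h h') (lt_irrefl _)
      · exact h'
  · filter_upwards [hc.eventually_const_lt hs] with ε hε
    exact ⟨fun _ => ⟨hs.le, fun _ => hs⟩, fun _ => hε⟩

/-- An infinitesimal shift along ξ decides the zero coordinates of x: they become positive or
negative with the sign of the corresponding coordinate of ξ. Hence exactly the facets in `negSet`
are removed. -/
theorem eventually_mem_openPart_iff {v : ι → E} {B : Finset ι}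
    (hB : LinearIndepOn ℝ v (B : Set ι))
    (hspan : Submodule.span ℝ (v '' (B : Set ι)) = Submodule.span ℝ (Set.range v))
    {ξ : E} (hξ : IsGeneric v ξ) (hξW : ξ ∈ Submodule.span ℝ (Set.range v)) (x : E) :
    ∀ᶠ ε : ℝ in 𝓝[>] 0, (x + ε • ξ ∈ openPart v B ↔ x ∈ conePart v B (negSet v B ξ) ∅) := by
  have h : ∀ᶠ ε : ℝ in 𝓝[>] 0, ∀ i ∈ B, (0 < coord v B i (x + ε • ξ) ↔
      0 ≤ coord v B i x ∧ (coord v B i ξ < 0 → 0 < coord v B i x)) := by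
    refine (Finset.eventually_all B).mpr fun i hi => ?_
    have := eventually_pos_add_mul_iff (coord v B i x)
      (coord_ne_zero_of_isGeneric hB hspan hξ hξW hi)
    simpa using this
  filter_upwards [h] with ε hε
  refine and_congr (Submodule.add_mem_iff_left _ (Submodule.smul_mem _ _ (hspan ▸ hξW))) ?_
  refine forall₂_congr fun i hi => ?_
  rw [hε i hi]
  simp [negSet, hi]

/-- For dependent `B`, the height vectors that a linear functional can match on `B` form a proper
subspace of ℝ^ι; a positive vector avoids these finitely many subspaces. Such heights define the
regular triangulation below. -/
theorem exists_heights [Fintype ι] (v : ι → E) :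
    ∃ h : ι → ℝ, (∀ i, 0 < h i) ∧ ∀ B : Finset ι, (∃ φ : E →ₗ[ℝ] ℝ, ∀ i ∈ B, φ (v i) = h i) →
      LinearIndepOn ℝ v (B : Set ι) := by
  let S : Finset ι → Submodule ℝ (ι → ℝ) := fun B =>
    { carrier := {h | ∃ φ : E →ₗ[ℝ] ℝ, ∀ i ∈ B, φ (v i) = h i}
      zero_mem' := ⟨0, by simp⟩
      add_mem' := by
        rintro a b ⟨φ, hφ⟩ ⟨ψ, hψ⟩
        exact ⟨φ + ψ, fun i hi => by simp [hφ i hi, hψ i hi]⟩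
      smul_mem' := by
        rintro t a ⟨φ, hφ⟩
        exact ⟨t • φ, fun i hi => by simp [hφ i hi]⟩ }
  have hS : ∀ B, S B = ⊤ → LinearIndepOn ℝ v (B : Set ι) := by
    intro B hB
    rw [linearIndepOn_finset_iff]
    intro f hf i hi
    -- The coefficients of a relation are themselves used as heights; applying the functional to the
    -- relation gives ∑ (f i)² = 0.
    have hfS : f ∈ S B := hB ▸ Submodule.mem_top
    obtain ⟨φ, hφ⟩ := hfS
    have h1 := congrArg φ hf
    rw [map_sum, map_zero] at h1
    have h2 : ∑ i ∈ B, f i * f i = 0 := by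
      rw [← h1]
      exact Finset.sum_congr rfl fun j hj => by rw [map_smul, hφ j hj, smul_eq_mul]
    have h3 := (Finset.sum_eq_zero_iff_of_nonneg fun j _ => mul_self_nonneg (f j)).mp h2 i hi
    exact mul_self_eq_zero.mp h3
  have hopen : IsOpen {h : ι → ℝ | ∀ i, 0 < h i} := by
    simp only [Set.ofPred_forall]
    exact isOpen_iInter_of_finite fun i => isOpen_lt continuous_const (continuous_apply i)
  obtain ⟨h, h1, h2⟩ := exists_mem_open_notMem (κ := {B : Finset ι // S B ≠ ⊤})
    (fun B => S B.1) (fun B => B.2) hopen (u := fun _ => 1) (fun _ => one_pos)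
  refine ⟨h, h1, fun B hB => ?_⟩
  by_contra hcon
  exact h2 ⟨B, fun ht => hcon (hS B ht)⟩ hB

/-- A cost-minimal representation of `x` as a nonnegative combination of the `v i`. -/
theorem exists_minimal_combination [Fintype ι] {v : ι → E} {h : ι → ℝ} (hpos : ∀ i, 0 < h i)
    {x : E} (hx : x ∈ coneHull v) :
    ∃ c : ι → ℝ, (∀ i, 0 ≤ c i) ∧ ∑ i, c i • v i = x ∧
      ∀ t : ι → ℝ, ∑ i, t i • v i = 0 → (∀ i, c i = 0 → 0 ≤ t i) → 0 ≤ ∑ i, t i * h i := by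
  obtain ⟨c₀, hc₀, hc₀x⟩ := hx
  let K : Set (ι → ℝ) := {c | (∀ i, 0 ≤ c i) ∧ ∑ i, c i • v i = x ∧
    ∑ i, c i * h i ≤ ∑ i, c₀ i * h i}
  have hKc : IsClosed K := by
    refine IsClosed.inter (s₁ := {c : ι → ℝ | ∀ i, 0 ≤ c i}) ?_
      (IsClosed.inter (s₁ := {c : ι → ℝ | ∑ i, c i • v i = x})
        (s₂ := {c : ι → ℝ | ∑ i, c i * h i ≤ ∑ i, c₀ i * h i}) ?_ ?_)
    · simp only [Set.ofPred_forall]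
      exact isClosed_iInter fun i => isClosed_le continuous_const (continuous_apply i)
    · exact isClosed_eq (by fun_prop) continuous_const
    · exact isClosed_le (by fun_prop) continuous_const
  -- Positive heights bound each coefficient by the total cost, which makes the sublevel set
  -- compact.
  have hKb : K ⊆ Set.Icc 0 (fun i => (∑ i, c₀ i * h i) / h i) := by
    intro c hc
    refine ⟨hc.1, fun i => ?_⟩
    rw [le_div_iff₀ (hpos i)]
    exact (Finset.single_le_sum (f := fun i => c i * h i)
      (fun j _ => mul_nonneg (hc.1 j) (hpos j).le) (Finset.mem_univ i)).trans hc.2.2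
  have hK : IsCompact K := isCompact_Icc.of_isClosed_subset hKc hKb
  obtain ⟨c, hcK, hmin⟩ := hK.exists_isMinOn ⟨c₀, hc₀, hc₀x, le_rfl⟩
    (f := fun c : ι → ℝ => ∑ i, c i * h i) (by fun_prop)
  refine ⟨c, hcK.1, hcK.2.1, fun t ht htn => ?_⟩
  by_contra hneg
  have hneg : ∑ i, t i * h i < 0 := not_le.mp hneg
  have hev : ∀ᶠ ε : ℝ in 𝓝[>] 0, ∀ i, 0 ≤ c i + ε * t i := by
    refine eventually_all.mpr fun i => ?_
    rcases (hcK.1 i).eq_or_lt with h0 | h0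
    · filter_upwards [self_mem_nhdsWithin] with ε hε
      rw [← h0, zero_add]
      exact mul_nonneg (le_of_lt hε) (htn i h0.symm)
    · have hcont : Continuous fun ε : ℝ => c i + ε * t i := by fun_prop
      have h1 := hcont.tendsto 0
      simp only [zero_mul, add_zero] at h1
      filter_upwards [(h1.mono_left nhdsWithin_le_nhds).eventually_const_lt h0] with ε hε
      exact hε.le
  obtain ⟨ε, hε, hε0⟩ := (hev.and self_mem_nhdsWithin).exists
  have hε0 : 0 < ε := hε0
  have hcost : ∑ i, (c i + ε * t i) * h i = ∑ i, c i * h i + ε * ∑ i, t i * h i := by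
    rw [Finset.mul_sum, ← Finset.sum_add_distrib]
    exact Finset.sum_congr rfl fun i _ => by ring
  have hlt : ∑ i, (c i + ε * t i) * h i < ∑ i, c i * h i := by
    rw [hcost]
    linarith [mul_neg_of_pos_of_neg hε0 hneg]
  have hmem : (fun i => c i + ε * t i) ∈ K := by
    refine ⟨hε, ?_, hlt.le.trans hcK.2.2⟩
    simp only [add_smul, mul_smul, Finset.sum_add_distrib, ← Finset.smul_sum, ht, smul_zero,
      add_zero, hcK.2.1]
  exact absurd (hmin hmem) (not_le.mpr hlt)

/-- The range of a transpose is the annihilator of the kernel: heights that vanish on every relation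
come from a functional. -/
theorem exists_dual_of_relations {v : ι → E} {h : ι → ℝ} {B : Finset ι}
    (hrel : ∀ t : ι → ℝ, ∑ i ∈ B, t i • v i = 0 → ∑ i ∈ B, t i * h i = 0) :
    ∃ φ : E →ₗ[ℝ] ℝ, ∀ i ∈ B, φ (v i) = h i := by
  classical
  let A : (B → ℝ) →ₗ[ℝ] E := Fintype.linearCombination ℝ fun i : B => v i
  let H : Module.Dual ℝ (B → ℝ) := Fintype.linearCombination ℝ fun i : B => h i
  have hH : H ∈ LinearMap.range A.dualMap := by
    rw [LinearMap.range_dualMap_eq_dualAnnihilator_ker, Submodule.mem_dualAnnihilator]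
    intro t ht
    rw [LinearMap.mem_ker, Fintype.linearCombination_apply] at ht
    rw [Fintype.linearCombination_apply]
    have h1 := hrel (fun i => if hi : i ∈ B then t ⟨i, hi⟩ else 0)
    rw [← Finset.sum_coe_sort B, ← Finset.sum_coe_sort B] at h1
    simpa using h1 (by simpa using ht)
  obtain ⟨φ, hφ⟩ := hH
  refine ⟨φ, fun i hi => ?_⟩
  have h1 := LinearMap.congr_fun hφ (Pi.single (⟨i, hi⟩ : B) 1)
  simpa [A, H, Fintype.linearCombination_apply, Pi.single_apply, ite_smul] using h1

/-- Every finitely generated cone has a triangulation without new rays; it is stated for the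
generic points of the cone. -/
theorem exists_triangulation [Fintype ι] (v : ι → E) :
    ∃ T : Finset (Finset ι), (∀ B ∈ T, LinearIndepOn ℝ v (B : Set ι) ∧
        Submodule.span ℝ (v '' (B : Set ι)) = Submodule.span ℝ (Set.range v)) ∧
      ∀ x, IsGeneric v x → (x ∈ coneHull v ↔ ∃ B ∈ T, x ∈ openPart v B) ∧
        ∀ B ∈ T, ∀ B' ∈ T, x ∈ openPart v B → x ∈ openPart v B' → B = B' := by
  classical
  obtain ⟨h, hpos, hgen⟩ := exists_heights v
  -- These are the lower facets of the cone over the lifted vectors (v i, h i), with φ as supporting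
  -- functional.
  let T : Finset (Finset ι) := Finset.univ.filter fun B =>
    (LinearIndepOn ℝ v (B : Set ι) ∧
      Submodule.span ℝ (v '' (B : Set ι)) = Submodule.span ℝ (Set.range v)) ∧
      ∃ φ : E →ₗ[ℝ] ℝ, (∀ i ∈ B, φ (v i) = h i) ∧ ∀ i, φ (v i) ≤ h i
  have hT : ∀ B, B ∈ T ↔ (LinearIndepOn ℝ v (B : Set ι) ∧
      Submodule.span ℝ (v '' (B : Set ι)) = Submodule.span ℝ (Set.range v)) ∧
      ∃ φ : E →ₗ[ℝ] ℝ, (∀ i ∈ B, φ (v i) = h i) ∧ ∀ i, φ (v i) ≤ h i := by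
    intro B; simp [T]
  refine ⟨T, fun B hB => ((hT B).mp hB).1, fun x hx => ⟨⟨fun hxC => ?_, ?_⟩, ?_⟩⟩
  -- The simplex is the support of a cost-minimal combination. Relations inside the support are
  -- admissible in both directions, so they cost nothing and some φ equals h there; the heights then
  -- give independence, and genericity of x gives the full span.
  · obtain ⟨c, hc0, hcx, hcmin⟩ := exists_minimal_combination hpos hxC
    let B : Finset ι := Finset.univ.filter fun i => c i ≠ 0
    have hBc : ∀ i, i ∉ B → c i = 0 := by intro i hi; simpa [B] using hi
    have hsumB : ∀ t : ι → ℝ, ∀ F : ι → E,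
        ∑ i, (if i ∈ B then t i else 0) • F i = ∑ i ∈ B, t i • F i := by
      intro t F
      simp only [ite_smul, zero_smul, Finset.sum_ite_mem, Finset.univ_inter]
    have hsumB' : ∀ t : ι → ℝ,
        ∑ i, (if i ∈ B then t i else 0) * h i = ∑ i ∈ B, t i * h i := by
      intro t
      simp only [ite_mul, zero_mul, Finset.sum_ite_mem, Finset.univ_inter]
    have hnn : ∀ t : ι → ℝ, ∑ i ∈ B, t i • v i = 0 → 0 ≤ ∑ i ∈ B, t i * h i := by
      intro t ht
      have := hcmin (fun i => if i ∈ B then t i else 0) (by rw [hsumB, ht])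
        (fun i hi => by simp [B, hi])
      rwa [hsumB'] at this
    obtain ⟨φ, hφ⟩ := exists_dual_of_relations (v := v) (h := h) (B := B) (by
      intro t ht
      refine le_antisymm ?_ (hnn t ht)
      have := hnn (fun i => - t i) (by simp [ht])
      simpa using this)
    have hind := hgen B ⟨φ, hφ⟩
    have hxB : x = ∑ i ∈ B, c i • v i := by
      rw [← hcx]
      refine (Finset.sum_subset (Finset.subset_univ B) fun i _ hi => ?_).symm
      rw [hBc i hi, zero_smul]
    have hxs : x ∈ Submodule.span ℝ (v '' (B : Set ι)) := by
      rw [hxB]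
      exact Submodule.sum_mem _ fun i hi =>
        Submodule.smul_mem _ _ (Submodule.subset_span ⟨i, hi, rfl⟩)
    have hspan : Submodule.span ℝ (v '' (B : Set ι)) = Submodule.span ℝ (Set.range v) := by
      by_contra hne
      exact hx B hne hxs
    refine ⟨B, (hT B).mpr ⟨⟨hind, hspan⟩, φ, hφ, fun j => ?_⟩, hxs, fun i hi => ?_⟩
    · have hj : v j ∈ Submodule.span ℝ (v '' (B : Set ι)) := by
        rw [hspan]
        exact Submodule.subset_span ⟨j, rfl⟩
      have hrep := sum_coord_smul hind hj
      by_cases hjB : j ∈ B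
      · exact (hφ j hjB).le
      -- Trading the expansion of `v j` in `B` for `v j` itself is admissible, so by minimality it
      -- cannot lower the cost: φ(v j) ≤ h j.
      have h1 := hcmin (fun i => (if i = j then 1 else 0) - if i ∈ B then coord v B i (v j) else 0)
        (by simp only [sub_smul, Finset.sum_sub_distrib, hsumB, hrep]; simp)
        (by
          intro i hi
          have : i ∉ B := by simp [B, hi]
          simp only [this, if_false, sub_zero]
          split_ifs <;> norm_num)
      simp only [sub_mul, Finset.sum_sub_distrib, hsumB'] at h1
      have h2 : φ (v j) = ∑ i ∈ B, coord v B i (v j) * h i := by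
        conv_lhs => rw [← hrep]
        rw [map_sum]
        exact Finset.sum_congr rfl fun i hi => by rw [map_smul, hφ i hi, smul_eq_mul]
      rw [h2]
      simpa using h1
    · rw [hxB, coord_sum hind c hi]
      exact lt_of_le_of_ne (hc0 i) (by simpa [B, eq_comm] using hi)
  · rintro ⟨B, hB, hxB⟩
    exact openPart_subset_coneHull ((hT B).mp hB).1.1 hxB
  -- Comparing the two supporting functionals gives φ x = φ' x, which forces φ = h on `B'` too. Then
  -- `B ∪ B'` is independent by the choice of heights; as `B` already spans, `B'` adds nothing.
  · have hsub : ∀ B ∈ T, ∀ B' ∈ T, x ∈ openPart v B → x ∈ openPart v B' → B' ⊆ B := by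
      intro B hB B' hB' hxB hxB'
      obtain ⟨⟨hi, hs⟩, φ, hφ, hφle⟩ := (hT B).mp hB
      obtain ⟨⟨hi', hs'⟩, φ', hφ', hφle'⟩ := (hT B').mp hB'
      have e1 : φ x = ∑ i ∈ B, coord v B i x * h i := by
        conv_lhs => rw [← sum_coord_smul hi hxB.1]
        rw [map_sum]
        exact Finset.sum_congr rfl fun i hi => by rw [map_smul, hφ i hi, smul_eq_mul]
      have e1' : φ' x = ∑ i ∈ B', coord v B' i x * h i := by
        conv_lhs => rw [← sum_coord_smul hi' hxB'.1]
        rw [map_sum]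
        exact Finset.sum_congr rfl fun i hi => by rw [map_smul, hφ' i hi, smul_eq_mul]
      have e2 : φ' x = ∑ i ∈ B, coord v B i x * φ' (v i) := by
        conv_lhs => rw [← sum_coord_smul hi hxB.1]
        rw [map_sum]
        exact Finset.sum_congr rfl fun i hi => by rw [map_smul, smul_eq_mul]
      have e2' : φ x = ∑ i ∈ B', coord v B' i x * φ (v i) := by
        conv_lhs => rw [← sum_coord_smul hi' hxB'.1]
        rw [map_sum]
        exact Finset.sum_congr rfl fun i hi => by rw [map_smul, smul_eq_mul]
      have l1 : ∀ i ∈ B', coord v B' i x * φ (v i) ≤ coord v B' i x * h i := fun i hi =>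
        mul_le_mul_of_nonneg_left (hφle i) (hxB'.2 i hi).le
      have l2 : ∀ i ∈ B, coord v B i x * φ' (v i) ≤ coord v B i x * h i := fun i hi =>
        mul_le_mul_of_nonneg_left (hφle' i) (hxB.2 i hi).le
      have l3 : φ x = φ' x := by
        refine le_antisymm ?_ ?_
        · rw [e2', e1']
          exact Finset.sum_le_sum l1
        · rw [e2, e1]
          exact Finset.sum_le_sum l2
      have l4 : ∀ i ∈ B', φ (v i) = h i := by
        intro i hi
        have := (Finset.sum_eq_sum_iff_of_le l1).mp (by rw [← e2', ← e1', l3]) i hi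
        exact mul_left_cancel₀ (hxB'.2 i hi).ne' this
      have hun : LinearIndepOn ℝ v ((B ∪ B' : Finset ι) : Set ι) := by
        refine hgen _ ⟨φ, fun i hi => ?_⟩
        rcases Finset.mem_union.mp hi with hi | hi
        · exact hφ i hi
        · exact l4 i hi
      intro j hj
      by_contra hjB
      have hvj : v j ∈ Submodule.span ℝ (v '' (B : Set ι)) := by
        rw [hs]
        exact Submodule.subset_span ⟨j, rfl⟩
      have hrep := sum_coord_smul hi hvj
      have h0 := linearIndepOn_finset_iff.mp hun
        (fun i => (if i = j then 1 else 0) - if i ∈ B then coord v B i (v j) else 0) (by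
          simp only [sub_smul, Finset.sum_sub_distrib, ite_smul, zero_smul, one_smul,
            Finset.sum_ite_mem, Finset.union_inter_cancel_left, hrep]
          rw [Finset.sum_ite_eq' , if_pos (Finset.mem_union_right B hj), sub_self])
        j (Finset.mem_union_right B hj)
      simp [hjB] at h0
    intro B hB B' hB' h1 h2
    exact Finset.Subset.antisymm (hsub B' hB' B hB h2 h1) (hsub B hB B' hB' h1 h2)

/-- Proper spans pull back to proper subspaces of the coefficient space ℝ^ι, which a positive
coefficient vector can avoid. -/
theorem exists_generic_interior [Fintype ι] (v : ι → E) :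
    ∃ ξ, IsGeneric v ξ ∧ ∃ c : ι → ℝ, (∀ i, 0 ≤ c i) ∧ ∑ i, c i • v i = ξ := by
  have hopen : IsOpen {h : ι → ℝ | ∀ i, 0 < h i} := by
    simp only [Set.ofPred_forall]
    exact isOpen_iInter_of_finite fun i => isOpen_lt continuous_const (continuous_apply i)
  let S : Finset ι → Submodule ℝ (ι → ℝ) := fun B =>
    (Submodule.span ℝ (v '' (B : Set ι))).comap (Fintype.linearCombination ℝ v)
  have hS : ∀ B, S B = ⊤ →
      Submodule.span ℝ (v '' (B : Set ι)) = Submodule.span ℝ (Set.range v) := by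
    classical
    intro B hB
    refine le_antisymm (Submodule.span_mono (Set.image_subset_range _ _)) ?_
    rw [Submodule.span_le]
    rintro _ ⟨i, rfl⟩
    have : Pi.single i (1 : ℝ) ∈ S B := hB ▸ Submodule.mem_top
    simpa [S, Fintype.linearCombination_apply, Pi.single_apply, ite_smul] using this
  obtain ⟨c, h1, h2⟩ := exists_mem_open_notMem (κ := {B : Finset ι // S B ≠ ⊤})
    (fun B => S B.1) (fun B => B.2) hopen (u := fun _ => 1) (fun _ => one_pos)
  refine ⟨_, fun B hB => ?_, c, fun i => (h1 i).le, rfl⟩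
  exact h2 ⟨B, fun ht => hB (hS B ht)⟩

/-- A triangulation of a finitely generated cone into half-open simplicial cones, for each generic
direction `ξ`. -/
theorem triangulation_perturb [Fintype ι] {v : ι → E} {T : Finset (Finset ι)}
    (hT : ∀ B ∈ T, LinearIndepOn ℝ v (B : Set ι) ∧
        Submodule.span ℝ (v '' (B : Set ι)) = Submodule.span ℝ (Set.range v))
    (hT' : ∀ x, IsGeneric v x → (x ∈ coneHull v ↔ ∃ B ∈ T, x ∈ openPart v B) ∧
        ∀ B ∈ T, ∀ B' ∈ T, x ∈ openPart v B → x ∈ openPart v B' → B = B')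
    {ξ : E} (hξ : IsGeneric v ξ) (hξW : ξ ∈ Submodule.span ℝ (Set.range v)) (x : E) :
    (∀ᶠ ε : ℝ in 𝓝[>] 0, (x + ε • ξ ∈ coneHull v ↔
      ∃ B ∈ T, x ∈ conePart v B (negSet v B ξ) ∅)) ∧
    ∀ B ∈ T, ∀ B' ∈ T, x ∈ conePart v B (negSet v B ξ) ∅ →
      x ∈ conePart v B' (negSet v B' ξ) ∅ → B = B' := by
  have h1 : ∀ᶠ ε : ℝ in 𝓝[>] 0, ∀ B ∈ T,
      (x + ε • ξ ∈ openPart v B ↔ x ∈ conePart v B (negSet v B ξ) ∅) :=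
    (Finset.eventually_all T).mpr fun B hB =>
      eventually_mem_openPart_iff (hT B hB).1 (hT B hB).2 hξ hξW x
  have h2 := hξ.eventually x
  refine ⟨?_, ?_⟩
  · filter_upwards [h1, h2] with ε h1 h2
    rw [(hT' _ h2).1]
    exact exists_congr fun B => and_congr_right fun hB => h1 B hB
  · obtain ⟨ε, h1, h2⟩ := (h1.and h2).exists
    intro B hB B' hB' hx hx'
    exact (hT' _ h2).2 B hB B' hB' ((h1 B hB).mpr hx) ((h1 B' hB').mpr hx')

end Triangulation

/-! ### Cones of a rational fan are generated by their lattice rays. -/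

section Rays

open Filter Topology

variable {r : ℕ} {N : Submodule ℤ (RealSpace r)} (Fan : CompleteFan N)

namespace CompleteFan

variable {Fan}

theorem zero_mem {C : Set (RealSpace r)} (hC : C ∈ Fan.cones) : (0 : RealSpace r) ∈ C := by
  obtain ⟨⟨S, -, rfl⟩, -⟩ := Fan.rational C hC
  intro m _
  simp

theorem add_mem {C : Set (RealSpace r)} (hC : C ∈ Fan.cones) {x y : RealSpace r} (hx : x ∈ C)
    (hy : y ∈ C) : x + y ∈ C := by
  obtain ⟨⟨S, -, rfl⟩, -⟩ := Fan.rational C hC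
  intro m hm
  rw [map_add]
  exact add_nonneg (hx m hm) (hy m hm)

theorem smul_mem {C : Set (RealSpace r)} (hC : C ∈ Fan.cones) {x : RealSpace r} (hx : x ∈ C)
    {t : ℝ} (ht : 0 ≤ t) : t • x ∈ C := by
  obtain ⟨⟨S, -, rfl⟩, -⟩ := Fan.rational C hC
  intro m hm
  rw [map_smul, smul_eq_mul]
  exact mul_nonneg ht (hx m hm)

theorem inter_mem {C D : Set (RealSpace r)} (hC : C ∈ Fan.cones) (hD : D ∈ Fan.cones) :
    C ∩ D ∈ Fan.cones :=
  Fan.face_mem C hC _ (Fan.inter_face C hC D hD).1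

/-- Moving from `x` in the direction `-z` one leaves the cone through a face not containing `z`. -/
theorem exists_exit {C : Set (RealSpace r)} (hC : C ∈ Fan.cones) {x z : RealSpace r} (hx : x ∈ C)
    (hz : z ∈ C) (hz0 : z ≠ 0) :
    ∃ t : ℝ, 0 ≤ t ∧ ∃ F ∈ Fan.cones, F ⊆ C ∧ x - t • z ∈ F ∧ z ∉ F := by
  classical
  obtain ⟨⟨S, hS, hCS⟩, hp⟩ := Fan.rational C hC
  have hzS : ∀ m ∈ S, 0 ≤ m z := by rw [hCS] at hz; exact hz
  have hxS : ∀ m ∈ S, 0 ≤ m x := by rw [hCS] at hx; exact hx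
  have hne : (S.filter fun m => 0 < m z).Nonempty := by
    by_contra hcon
    rw [Finset.not_nonempty_iff_eq_empty, Finset.filter_eq_empty_iff] at hcon
    apply hz0
    apply hp z hz
    rw [hCS]
    intro m hm
    rw [map_neg]
    linarith [not_lt.mp (hcon hm)]
  obtain ⟨m, hm, hmin⟩ := Finset.exists_min_image _ (fun m => m x / m z) hne
  rw [Finset.mem_filter] at hm
  refine ⟨m x / m z, div_nonneg (hxS m hm.1) hm.2.le, {y ∈ C | m y = 0},
    Fan.face_mem C hC _ ⟨m, hS m hm.1, ?_, rfl⟩, Set.sep_subset _ _, ⟨?_, ?_⟩, ?_⟩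
  · intro y hy
    rw [hCS] at hy
    exact hy m hm.1
  · rw [hCS]
    intro m' hm'
    rw [map_sub, map_smul, smul_eq_mul, sub_nonneg]
    rcases (hzS m' hm').eq_or_lt with h0 | h0
    · rw [← h0, mul_zero]
      exact hxS m' hm'
    · have := hmin m' (Finset.mem_filter.mpr ⟨hm', h0⟩)
      exact (le_div_iff₀ h0).mp this
  · rw [map_sub, map_smul, smul_eq_mul, div_mul_cancel₀ _ hm.2.ne', sub_self]
  · exact fun h => hm.2.ne' h.2

/-- Take F minimal among the nonzero cones of the fan inside C. Leaving F in the direction -z leads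
to a cone avoiding z, hence strictly smaller, hence {0}; so each point of F is a multiple of z. -/
theorem exists_minimal_ray {C : Set (RealSpace r)} (hC : C ∈ Fan.cones) (hC0 : C ≠ {0}) :
    ∃ F ∈ Fan.cones, F ⊆ C ∧ ∃ z ∈ F, z ≠ 0 ∧ ∀ x ∈ F, ∃ t : ℝ, 0 ≤ t ∧ x = t • z := by
  classical
  obtain ⟨F, hF⟩ := Finset.exists_minimal (s := Fan.cones.filter fun F => F ⊆ C ∧ F ≠ {0})
    ⟨C, Finset.mem_filter.mpr ⟨hC, subset_rfl, hC0⟩⟩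
  have hF1 := Finset.mem_filter.mp hF.1
  obtain ⟨z, hz, hz0⟩ : ∃ z ∈ F, z ≠ 0 := by
    by_contra hcon
    push Not at hcon
    exact hF1.2.2 (Set.eq_singleton_iff_unique_mem.mpr ⟨zero_mem hF1.1, hcon⟩)
  refine ⟨F, hF1.1, hF1.2.1, z, hz, hz0, fun x hx => ?_⟩
  obtain ⟨t, ht, G, hG, hGF, hxG, hzG⟩ := exists_exit hF1.1 hx hz hz0
  have hG0 : G = {0} := by
    by_contra hne
    have h1 := hF.2 (Finset.mem_filter.mpr ⟨hG, hGF.trans hF1.2.1, hne⟩) hGF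
    exact hzG (h1 hz)
  rw [hG0, Set.mem_singleton_iff, sub_eq_zero] at hxG
  exact ⟨t, ht, hxG⟩

variable [DiscreteTopology N] [IsZLattice ℝ N]

/-- A pigeonhole argument. The line through z is cut out by the integral forms vanishing at z. The
lattice points obtained by rounding the multiples k z stay near that line, so these forms take
finitely many values on them, although the points are unbounded. Two with equal values differ by a
nonzero lattice vector on the line. -/
theorem exists_lattice_point_of_ray {F : Set (RealSpace r)} (hF : F ∈ Fan.cones)
    {z : RealSpace r} (hz : z ∈ F) (hz0 : z ≠ 0)
    (hray : ∀ x ∈ F, ∃ t : ℝ, 0 ≤ t ∧ x = t • z) : ∃ s : ℝ, 0 < s ∧ s • z ∈ N := by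
  classical
  obtain ⟨⟨S, hS, hFS⟩, -⟩ := Fan.rational F hF
  have hzS : ∀ m ∈ S, 0 ≤ m z := by rw [hFS] at hz; exact hz
  -- The other forms are positive at z, so z + ε y stays in F for small ε, and F is a ray.
  have hline : ∀ y : RealSpace r, (∀ m ∈ S, m z = 0 → m y = 0) → ∃ s : ℝ, y = s • z := by
    intro y hy
    have hev : ∀ᶠ ε : ℝ in 𝓝[>] 0, ∀ m ∈ S, 0 ≤ m z + ε * m y := by
      refine (Finset.eventually_all S).mpr fun m hm => ?_
      rcases (hzS m hm).eq_or_lt with h0 | h0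
      · exact Eventually.of_forall fun ε => by rw [hy m hm h0.symm, ← h0]; simp
      · have hcont : Continuous fun ε : ℝ => m z + ε * m y := by fun_prop
        have h1 := hcont.tendsto 0
        simp only [zero_mul, add_zero] at h1
        filter_upwards [(h1.mono_left nhdsWithin_le_nhds).eventually_const_lt h0] with ε hε
        exact hε.le
    obtain ⟨ε, hε, hε0⟩ := (hev.and self_mem_nhdsWithin).exists
    have hε0 : 0 < ε := hε0
    have hmem : z + ε • y ∈ F := by
      rw [hFS]
      intro m hm
      rw [map_add, map_smul, smul_eq_mul]
      exact hε m hm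
    obtain ⟨t, -, ht⟩ := hray _ hmem
    refine ⟨ε⁻¹ * (t - 1), ?_⟩
    rw [mul_smul, sub_smul, one_smul, ← ht, add_sub_cancel_left, inv_smul_smul₀ hε0.ne']
  have : Module.Free ℤ N := ZLattice.module_free ℝ N
  have : Module.Finite ℤ N := ZLattice.module_finite ℝ N
  let b := (Module.Free.chooseBasis ℤ N).ofZLatticeBasis ℝ N
  have hbN : Submodule.span ℤ (Set.range b) = N := Module.Basis.ofZLatticeBasis_span ℝ N _
  have hfl : ∀ x : RealSpace r, ((ZSpan.floor b x : Submodule.span ℤ (Set.range b)) :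
      RealSpace r) ∈ N := fun x => hbN.le (ZSpan.floor b x).2
  let f : ℕ → N := fun k => ⟨ZSpan.floor b ((k : ℝ) • z), hfl _⟩
  have hf : ∀ k : ℕ, ‖(f k : RealSpace r) - (k : ℝ) • z‖ ≤ ∑ i, ‖b i‖ := by
    intro k
    have := ZSpan.norm_fract_le b ((k : ℝ) • z)
    rw [ZSpan.fract_apply] at this
    rwa [norm_sub_rev]
  set R := ∑ i, ‖b i‖ with hR
  have key : ∃ n : N, (n : RealSpace r) ≠ 0 ∧ ∀ m ∈ S, m z = 0 → m n = 0 := by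
    by_contra hcon
    push Not at hcon
    let S₀ := S.filter fun m => m z = 0
    let Φ : N → (S₀ → ℝ) := fun n m => m.1 n
    have hinj : Function.Injective Φ := by
      intro n n' hnn
      by_contra hne
      have h1 : ((n - n' : N) : RealSpace r) ≠ 0 := by
        simpa [sub_eq_zero] using hne
      obtain ⟨m, hm, hmz, hmn⟩ := hcon _ h1
      apply hmn
      have h2 := congrFun hnn ⟨m, Finset.mem_filter.mpr ⟨hm, hmz⟩⟩
      simp only [Φ] at h2
      rw [Submodule.coe_sub, map_sub, h2, sub_self]
    have hfin : (Set.range f).Finite := by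
      refine Set.Finite.of_finite_image (f := Φ) ?_ hinj.injOn
      have hK : (Set.univ.pi fun m : S₀ => (fun k : ℤ => (k : ℝ)) ''
          Set.Icc ⌊-(‖m.1‖ * R)⌋ ⌈‖m.1‖ * R⌉).Finite :=
        Set.Finite.pi fun m => (Set.finite_Icc _ _).image _
      refine hK.subset ?_
      rintro _ ⟨_, ⟨k, rfl⟩, rfl⟩ m -
      have hm := Finset.mem_filter.mp m.2
      obtain ⟨j, hj⟩ := hS m.1 hm.1 (f k) (f k).2
      have h3 : |m.1 (f k)| ≤ ‖m.1‖ * R := by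
        have h4 : m.1 (f k) = m.1 ((f k : RealSpace r) - (k : ℝ) • z) := by
          rw [map_sub, map_smul, hm.2, smul_zero, sub_zero]
        rw [h4, ← Real.norm_eq_abs]
        exact (m.1.le_opNorm _).trans (mul_le_mul_of_nonneg_left (hf k) (norm_nonneg _))
      rw [hj, abs_le] at h3
      refine ⟨j, ⟨Int.floor_le_iff.mpr ?_, Int.le_ceil_iff.mpr ?_⟩, hj.symm⟩
      · linarith [h3.1]
      · linarith [h3.2]
    obtain ⟨Q, hQ⟩ := (hfin.image fun n : N => ‖(n : RealSpace r)‖).bddAbove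
    obtain ⟨k, hk⟩ := exists_nat_gt ((Q + R) / ‖z‖)
    rw [div_lt_iff₀ (norm_pos_iff.mpr hz0)] at hk
    have h5 : ‖(f k : RealSpace r)‖ ≤ Q := hQ ⟨f k, ⟨k, rfl⟩, rfl⟩
    have h6 : ‖(k : ℝ) • z‖ ≤ ‖(f k : RealSpace r)‖ + ‖(f k : RealSpace r) - (k : ℝ) • z‖ := by
      have := norm_sub_le (f k : RealSpace r) ((f k : RealSpace r) - (k : ℝ) • z)
      simpa using this
    rw [norm_smul, Real.norm_natCast] at h6
    linarith [hf k]
  obtain ⟨n, hn0, hn⟩ := key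
  obtain ⟨s, hs⟩ := hline n hn
  rcases lt_trichotomy s 0 with h | h | h
  · refine ⟨-s, neg_pos.mpr h, ?_⟩
    rw [neg_smul, ← hs]
    exact N.neg_mem n.2
  · exact absurd (by rw [hs, h, zero_smul]) hn0
  · exact ⟨s, h, hs ▸ n.2⟩

/-- The t with t z in N form a nonzero discrete subgroup of ℝ, hence a cyclic one; its least
positive element yields the generator. -/
theorem exists_rayGenerator {F : Set (RealSpace r)} (hF : F ∈ Fan.cones)
    {z : RealSpace r} (hz : z ∈ F) (hz0 : z ≠ 0)
    (hray : ∀ x ∈ F, ∃ t : ℝ, 0 ≤ t ∧ x = t • z) :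
    ∃ d : N, IsRayGenerator N F d ∧ (d : RealSpace r) ∈ F ∧ (d : RealSpace r) ≠ 0 := by
  obtain ⟨s, hs, hsN⟩ := exists_lattice_point_of_ray hF hz hz0 hray
  let H : AddSubgroup ℝ :=
    { carrier := {t | t • z ∈ N}
      zero_mem' := by simp
      add_mem' := fun {a b} ha hb => by
        change (a + b) • z ∈ N
        rw [add_smul]
        exact N.add_mem ha hb
      neg_mem' := fun {a} ha => by
        change (-a) • z ∈ N
        rw [neg_smul]
        exact N.neg_mem ha }
  have hH : ∀ t, t ∈ H ↔ t • z ∈ N := fun t => Iff.rfl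
  have hbot : H ≠ ⊥ := by
    intro h
    have : s ∈ H := hsN
    rw [h, AddSubgroup.mem_bot] at this
    exact hs.ne' this
  obtain ⟨δ, hδ, hball⟩ : ∃ δ > 0, ∀ n : N, ‖(n : RealSpace r)‖ < δ → n = 0 := by
    have h1 : ({0} : Set N) ∈ 𝓝 (0 : N) := (isOpen_discrete _).mem_nhds rfl
    obtain ⟨δ, hδ, h2⟩ := Metric.mem_nhds_iff.mp h1
    exact ⟨δ, hδ, fun n hn => h2 (by simpa [dist_eq_norm] using hn)⟩
  have hzn := norm_pos_iff.mpr hz0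
  obtain ⟨t, ht⟩ := AddSubgroup.exists_isLeast_pos hbot (div_pos hδ hzn) (by
    rw [Set.disjoint_left]
    rintro t ht ⟨h0, h1⟩
    rw [lt_div_iff₀ hzn] at h1
    have := hball ⟨t • z, ht⟩ (by rw [norm_smul, Real.norm_eq_abs, abs_of_pos h0]; exact h1)
    have : t • z = 0 := congrArg Subtype.val this
    rcases smul_eq_zero.mp this with h | h
    · exact h0.ne' h
    · exact hz0 h)
  have hcyc := AddSubgroup.cyclic_of_min ht
  have htN : t • z ∈ N := ht.1.1
  have ht0 : 0 < t := ht.1.2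
  refine ⟨⟨t • z, htN⟩, ⟨?_, fun n => ?_⟩, smul_mem hF hz ht0.le, smul_ne_zero ht0.ne' hz0⟩
  · have hspan : Submodule.span ℝ F = Submodule.span ℝ {z} := by
      refine le_antisymm (Submodule.span_le.mpr fun x hx => ?_)
        (Submodule.span_mono (Set.singleton_subset_iff.mpr hz))
      obtain ⟨t, -, rfl⟩ := hray x hx
      exact Submodule.smul_mem _ _ (Submodule.mem_span_singleton_self z)
    rw [coneDim, hspan, finrank_span_singleton hz0]
  · constructor
    · intro hn
      obtain ⟨a, ha, hna⟩ := hray _ hn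
      have haH : a ∈ H := by
        rw [hH, ← hna]
        exact n.2
      rw [hcyc, AddSubgroup.mem_closure_singleton] at haH
      obtain ⟨k, rfl⟩ := haH
      have hk : 0 ≤ k := by
        rw [zsmul_eq_mul] at ha
        have := nonneg_of_mul_nonneg_left ha ht0
        exact_mod_cast this
      obtain ⟨j, rfl⟩ := Int.eq_ofNat_of_zero_le hk
      refine ⟨j, Subtype.ext ?_⟩
      rw [hna]
      simp [mul_smul, ← Nat.cast_smul_eq_nsmul ℝ]
    · rintro ⟨k, rfl⟩
      have : ((k • (⟨t • z, htN⟩ : N) : N) : RealSpace r) = (k : ℝ) • t • z := by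
        simp [← Nat.cast_smul_eq_nsmul ℝ]
      rw [this]
      exact smul_mem hF (smul_mem hF hz ht0.le) (Nat.cast_nonneg k)

end CompleteFan

/-- The generators of the rays of the fan lying in `C`. -/
def coneRays (C : Set (RealSpace r)) : Set N :=
  {d | ∃ F ∈ Fan.cones, F ⊆ C ∧ IsRayGenerator N F d}

theorem IsRayGenerator.unique {F : Set (RealSpace r)} {d d' : N} (h : IsRayGenerator N F d)
    (h' : IsRayGenerator N F d') : d = d' := by
  obtain ⟨k, hk⟩ := (h'.2 d).mp ((h.2 d).mpr ⟨1, (one_smul _ _).symm⟩)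
  obtain ⟨j, hj⟩ := (h.2 d').mp ((h'.2 d').mpr ⟨1, (one_smul _ _).symm⟩)
  by_cases hd : d = 0
  · rw [hj, hd, smul_zero]
  · have h1 : (k * j) • d = (1 : ℕ) • d := by
      rw [mul_smul, ← hj, ← hk, one_smul]
    have h2 : ((k * j : ℕ) : ℝ) • (d : RealSpace r) = (1 : ℝ) • (d : RealSpace r) := by
      have := congrArg (Subtype.val) h1
      rw [Submodule.coe_smul_of_tower, Submodule.coe_smul_of_tower,
        ← Nat.cast_smul_eq_nsmul ℝ, one_smul] at this
      rw [this, one_smul]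
    have h3 : ((k * j : ℕ) : ℝ) = 1 := smul_left_injective ℝ (by simpa using hd) h2
    have h4 : k * j = 1 := by exact_mod_cast h3
    rw [hj, Nat.eq_one_of_mul_eq_one_left h4, one_smul]

instance finite_coneRays (C : Set (RealSpace r)) : Finite (coneRays Fan C) := by
  have h : coneRays Fan C ⊆ ⋃ F ∈ Fan.cones, {d : N | IsRayGenerator N F d} := by
    rintro d ⟨F, hF, -, hd⟩
    simp only [Set.mem_iUnion]
    exact ⟨F, hF, hd⟩
  refine Set.Finite.subset (Set.Finite.biUnion Fan.cones.finite_toSet fun F _ => ?_) h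
  exact Set.Subsingleton.finite fun d hd d' hd' => hd.unique hd'

instance fintypeConeRays (C : Set (RealSpace r)) : Fintype (coneRays Fan C) := Fintype.ofFinite _

/-- The family of ray generators of `C`. -/
def rayVec (C : Set (RealSpace r)) : coneRays Fan C → RealSpace r := fun i => (i.1 : RealSpace r)

theorem rayVec_mem {C : Set (RealSpace r)} (i : coneRays Fan C) : rayVec Fan C i ∈ C := by
  obtain ⟨F, -, hFC, hd⟩ := i.2
  exact hFC ((hd.2 i.1).mpr ⟨1, (one_smul _ _).symm⟩)

variable [DiscreteTopology N] [IsZLattice ℝ N]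

/-- Induction on the number of cones strictly inside C: subtract from x a multiple of one ray
generator until a face without that generator is reached. -/
theorem mem_span_coneRays {C : Set (RealSpace r)} (hC : C ∈ Fan.cones) :
    ∀ x ∈ C, x ∈ Submodule.span NNReal (Subtype.val '' coneRays Fan C) := by
  classical
  have key : ∀ n : ℕ, ∀ C ∈ Fan.cones, (Fan.cones.filter fun F => F ⊂ C).card = n →
      ∀ x ∈ C, x ∈ Submodule.span NNReal (Subtype.val '' coneRays Fan C) := by
    intro n
    induction n using Nat.strong_induction_on with
    | _ n ih =>
      intro C hC hn x hx
      by_cases hC0 : C = {0}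
      · rw [hC0, Set.mem_singleton_iff] at hx
        rw [hx]
        exact Submodule.zero_mem _
      · obtain ⟨F, hF, hFC, z, hz, hz0, hray⟩ := CompleteFan.exists_minimal_ray hC hC0
        obtain ⟨d, hd, hdF, hd0⟩ := CompleteFan.exists_rayGenerator hF hz hz0 hray
        obtain ⟨t, ht, G, hG, hGC, hxG, hdG⟩ := CompleteFan.exists_exit hC hx (hFC hdF) hd0
        have hlt : (Fan.cones.filter fun F => F ⊂ G).card < n := by
          rw [← hn]
          refine Finset.card_lt_card (Finset.ssubset_iff_subset_ne.mpr ⟨?_, ?_⟩)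
          · intro K hK
            rw [Finset.mem_filter] at hK ⊢
            exact ⟨hK.1, hK.2.trans_subset hGC⟩
          · intro heq
            have : G ∈ Fan.cones.filter fun F => F ⊂ C :=
              Finset.mem_filter.mpr ⟨hG, hGC, fun h => hdG (h (hFC hdF))⟩
            rw [← heq, Finset.mem_filter] at this
            exact this.2.2 subset_rfl
        have h1 := ih _ hlt G hG rfl _ hxG
        have h2 : x - t • (d : RealSpace r) ∈
            Submodule.span NNReal (Subtype.val '' coneRays Fan C) := by
          refine Submodule.span_mono (Set.image_mono ?_) h1
          rintro e ⟨K, hK, hKG, he⟩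
          exact ⟨K, hK, hKG.trans hGC, he⟩
        have h3 : (d : RealSpace r) ∈ Submodule.span NNReal (Subtype.val '' coneRays Fan C) :=
          Submodule.subset_span ⟨d, ⟨F, hF, hFC, hd⟩, rfl⟩
        have h4 := Submodule.add_mem _ h2 (Submodule.smul_mem _ t.toNNReal h3)
        have h5 : t.toNNReal • (d : RealSpace r) = t • (d : RealSpace r) := by
          rw [NNReal.smul_def, Real.coe_toNNReal _ ht]
        rwa [h5, sub_add_cancel] at h4
  exact key _ C hC rfl

/-- A cone of the fan is generated by its rays. -/
theorem coneHull_rayVec {C : Set (RealSpace r)} (hC : C ∈ Fan.cones) :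
    coneHull (rayVec Fan C) = C := by
  ext x
  constructor
  · rintro ⟨c, hc, rfl⟩
    refine Finset.sum_induction _ (· ∈ C) (fun _ _ => CompleteFan.add_mem hC)
      (CompleteFan.zero_mem hC) fun i _ => ?_
    exact CompleteFan.smul_mem hC (rayVec_mem Fan i) (hc i)
  · intro hx
    have h := mem_span_coneRays Fan hC x hx
    have he : Subtype.val '' coneRays Fan C = Set.range (rayVec Fan C) := by
      rw [Set.image_eq_range]
      rfl
    rw [he, Submodule.mem_span_range_iff_exists_fun] at h
    obtain ⟨c, hc⟩ := h
    exact ⟨fun i => c i, fun i => (c i).2, hc⟩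

theorem span_rayVec {C : Set (RealSpace r)} (hC : C ∈ Fan.cones) :
    Submodule.span ℝ (Set.range (rayVec Fan C)) = Submodule.span ℝ C := by
  refine le_antisymm (Submodule.span_mono ?_) (Submodule.span_le.mpr fun x hx => ?_)
  · rintro _ ⟨i, rfl⟩
    exact rayVec_mem Fan i
  · rw [← coneHull_rayVec Fan hC] at hx
    obtain ⟨c, -, rfl⟩ := hx
    exact Submodule.sum_mem _ fun i _ =>
      Submodule.smul_mem _ _ (Submodule.subset_span ⟨i, rfl⟩)

end Rays

/-! ### Euler characteristics of relatively open cones and the alternating sum over the fan. -/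

section Euler

open Filter Topology

section RelOpen

variable {E : Type*} [NormedAddCommGroup E] [NormedSpace ℝ E]

/-- A convex cone that is open in its linear span. -/
def IsRelOpenCone (K : Set E) : Prop :=
  (∀ u ∈ K, ∀ v ∈ K, u + v ∈ K) ∧ (∀ t : ℝ, 0 < t → ∀ v ∈ K, t • v ∈ K) ∧
    ∀ v ∈ K, ∀ u ∈ Submodule.span ℝ K, ∀ᶠ ε : ℝ in 𝓝[>] 0, v + ε • u ∈ K

theorem eventually_pos_add_mul {s : ℝ} (hs : 0 < s) (t : ℝ) :
    ∀ᶠ ε : ℝ in 𝓝[>] 0, 0 < s + ε * t := by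
  have hcont : Continuous fun ε : ℝ => s + ε * t := by fun_prop
  have h1 := hcont.tendsto 0
  simp only [zero_mul, add_zero] at h1
  exact (h1.mono_left nhdsWithin_le_nhds).eventually_const_lt hs

theorem isRelOpenCone_polyhedral (P Q : Finset (E →L[ℝ] ℝ)) :
    IsRelOpenCone {v : E | (∀ m ∈ P, m v = 0) ∧ ∀ m ∈ Q, 0 < m v} := by
  refine ⟨fun u hu v hv => ⟨fun m hm => ?_, fun m hm => ?_⟩,
    fun t ht v hv => ⟨fun m hm => ?_, fun m hm => ?_⟩, fun v hv u hu => ?_⟩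
  · rw [map_add, hu.1 m hm, hv.1 m hm, add_zero]
  · rw [map_add]
    exact add_pos (hu.2 m hm) (hv.2 m hm)
  · rw [map_smul, hv.1 m hm, smul_zero]
  · rw [map_smul]
    exact mul_pos ht (hv.2 m hm)
  · have h0 : ∀ m ∈ P, m u = 0 := by
      intro m hm
      induction hu using Submodule.span_induction with
      | mem x hx => exact hx.1 m hm
      | zero => exact map_zero m
      | add x y _ _ hx hy => rw [map_add, hx, hy, add_zero]
      | smul t x _ hx => rw [map_smul, hx, smul_zero]
    have h1 : ∀ᶠ ε : ℝ in 𝓝[>] 0, ∀ m ∈ Q, 0 < m v + ε * m u :=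
      (Finset.eventually_all Q).mpr fun m hm => eventually_pos_add_mul (hv.2 m hm) _
    filter_upwards [h1] with ε hε
    refine ⟨fun m hm => ?_, fun m hm => ?_⟩
    · rw [map_add, map_smul, hv.1 m hm, h0 m hm, smul_zero, add_zero]
    · rw [map_add, map_smul]
      exact hε m hm

theorem isRelOpenCone_univ : IsRelOpenCone (Set.univ : Set E) := by
  simpa using isRelOpenCone_polyhedral (E := E) ∅ ∅

theorem IsRelOpenCone.inter {K L : Set E} (hK : IsRelOpenCone K) (hL : IsRelOpenCone L) :
    IsRelOpenCone (K ∩ L) := by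
  refine ⟨fun u hu v hv => ⟨hK.1 u hu.1 v hv.1, hL.1 u hu.2 v hv.2⟩,
    fun t ht v hv => ⟨hK.2.1 t ht v hv.1, hL.2.1 t ht v hv.2⟩, fun v hv u hu => ?_⟩
  exact (hK.2.2 v hv.1 u (Submodule.span_mono Set.inter_subset_left hu)).and
    (hL.2.2 v hv.2 u (Submodule.span_mono Set.inter_subset_right hu))

theorem isRelOpenCone_pos (m : E →L[ℝ] ℝ) : IsRelOpenCone {v : E | 0 < m v} := by
  simpa using isRelOpenCone_polyhedral ∅ {m}

theorem isRelOpenCone_neg (m : E →L[ℝ] ℝ) : IsRelOpenCone {v : E | m v < 0} := by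
  simpa using isRelOpenCone_pos (-m)

theorem isRelOpenCone_zero (m : E →L[ℝ] ℝ) : IsRelOpenCone {v : E | m v = 0} := by
  simpa using isRelOpenCone_polyhedral {m} ∅

open Classical in
/-- The Euler characteristic with compact support of a relatively open cone. -/
def eulerSign (K : Set E) : ℤ :=
  if K.Nonempty then (-1) ^ Module.finrank ℝ (Submodule.span ℝ K) else 0

theorem eulerSign_empty : eulerSign (∅ : Set E) = 0 := by simp [eulerSign]

theorem eulerSign_of_nonempty {K : Set E} (h : K.Nonempty) :
    eulerSign K = (-1) ^ Module.finrank ℝ (Submodule.span ℝ K) := if_pos h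

theorem IsRelOpenCone.exists_neg {K : Set E} (hK : IsRelOpenCone K) {m : E →L[ℝ] ℝ} {a v : E}
    (ha : a ∈ K) (hma : m a ≤ 0) (hv : v ∈ K) (hmv : 0 < m v) : ∃ u ∈ K, m u < 0 := by
  obtain ⟨ε, hε, hε0⟩ := ((hK.2.2 a ha (-v)
    (Submodule.neg_mem _ (Submodule.subset_span hv))).and self_mem_nhdsWithin).exists
  have hε0 : 0 < ε := hε0
  refine ⟨_, hε, ?_⟩
  rw [map_add, map_smul, map_neg, smul_eq_mul]
  nlinarith [mul_pos hε0 hmv]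

/-- Adding a large multiple of p brings any point of K into the half-space, so K lies in the span of
the part cut off. -/
theorem IsRelOpenCone.span_inter_pos {K : Set E} (hK : IsRelOpenCone K) {m : E →L[ℝ] ℝ} {p : E}
    (hp : p ∈ K) (hmp : 0 < m p) :
    Submodule.span ℝ (K ∩ {v | 0 < m v}) = Submodule.span ℝ K := by
  refine le_antisymm (Submodule.span_mono Set.inter_subset_left)
    (Submodule.span_le.mpr fun u hu => ?_)
  have ht : 0 < (|m u| + 1) / m p := by positivity
  have h1 : u + ((|m u| + 1) / m p) • p ∈ K ∩ {v | 0 < m v} := by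
    refine ⟨hK.1 _ hu _ (hK.2.1 _ ht _ hp), ?_⟩
    change 0 < m (u + ((|m u| + 1) / m p) • p)
    rw [map_add, map_smul, smul_eq_mul, div_mul_cancel₀ _ hmp.ne']
    linarith [neg_abs_le (m u)]
  have h2 := Submodule.sub_mem _ (Submodule.subset_span h1)
    (Submodule.smul_mem _ ((|m u| + 1) / m p) (Submodule.subset_span (R := ℝ) ⟨hp, hmp⟩))
  rwa [add_sub_cancel_right] at h2

theorem IsRelOpenCone.span_inter_neg {K : Set E} (hK : IsRelOpenCone K) {m : E →L[ℝ] ℝ} {p : E}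
    (hp : p ∈ K) (hmp : m p < 0) :
    Submodule.span ℝ (K ∩ {v | m v < 0}) = Submodule.span ℝ K := by
  have := hK.span_inter_pos (m := -m) hp (by simpa using hmp)
  simpa using this

/-- The slice spans the whole kernel of m on the span of K, because K is open in its span around v₀.
-/
theorem IsRelOpenCone.finrank_span_inter_zero [FiniteDimensional ℝ E] {K : Set E}
    (hK : IsRelOpenCone K) {m : E →L[ℝ] ℝ} {v₀ p : E} (hv₀ : v₀ ∈ K) (hmv₀ : m v₀ = 0)
    (hp : p ∈ K) (hmp : m p ≠ 0) :
    Module.finrank ℝ (Submodule.span ℝ (K ∩ {v | m v = 0})) + 1 =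
      Module.finrank ℝ (Submodule.span ℝ K) := by
  set W := Submodule.span ℝ K with hW
  have h1 : Submodule.span ℝ (K ∩ {v | m v = 0}) =
      (LinearMap.ker ((m : E →ₗ[ℝ] ℝ).comp W.subtype)).map W.subtype := by
    refine le_antisymm (Submodule.span_le.mpr fun u hu => ?_) ?_
    · exact ⟨⟨u, Submodule.subset_span hu.1⟩, hu.2, rfl⟩
    · rintro _ ⟨u, hu, rfl⟩
      have hu : m u = 0 := hu
      obtain ⟨ε, hε, hε0⟩ := ((hK.2.2 v₀ hv₀ u u.2).and self_mem_nhdsWithin).exists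
      have hε0 : 0 < ε := hε0
      have h2 : v₀ + ε • (u : E) ∈ K ∩ {v | m v = 0} := by
        refine ⟨hε, ?_⟩
        change m (v₀ + ε • (u : E)) = 0
        rw [map_add, map_smul, hmv₀, hu, smul_zero, add_zero]
      have h3 := Submodule.smul_mem _ ε⁻¹ (Submodule.sub_mem _ (Submodule.subset_span (R := ℝ) h2)
        (Submodule.subset_span ⟨hv₀, hmv₀⟩))
      rwa [add_sub_cancel_left, inv_smul_smul₀ hε0.ne'] at h3
  rw [h1, Submodule.finrank_map_subtype_eq]
  refine Module.Dual.finrank_ker_add_one_of_ne_zero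
    (f := (m : E →ₗ[ℝ] ℝ).comp W.subtype) fun h => hmp ?_
  exact LinearMap.congr_fun h ⟨p, Submodule.subset_span hp⟩

/-- Additivity of the Euler characteristic when a cone is cut by a hyperplane. -/
theorem IsRelOpenCone.eulerSign_cut [FiniteDimensional ℝ E] {K : Set E} (hK : IsRelOpenCone K)
    (m : E →L[ℝ] ℝ) : eulerSign (K ∩ {v | m v < 0}) + eulerSign (K ∩ {v | m v = 0}) +
      eulerSign (K ∩ {v | 0 < m v}) = eulerSign K := by
  by_cases h0 : ∀ v ∈ K, m v = 0
  · have e1 : K ∩ {v | m v < 0} = ∅ :=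
      Set.eq_empty_of_forall_notMem fun v hv => hv.2.ne (h0 v hv.1)
    have e2 : K ∩ {v | m v = 0} = K := Set.inter_eq_left.mpr h0
    have e3 : K ∩ {v | 0 < m v} = ∅ :=
      Set.eq_empty_of_forall_notMem fun v hv => hv.2.ne' (h0 v hv.1)
    rw [e1, e2, e3, eulerSign_empty]
    ring
  by_cases hpos : ∀ v ∈ K, 0 < m v
  · have e1 : K ∩ {v | m v < 0} = ∅ :=
      Set.eq_empty_of_forall_notMem fun v hv => lt_asymm hv.2 (hpos v hv.1)
    have e2 : K ∩ {v | m v = 0} = ∅ :=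
      Set.eq_empty_of_forall_notMem fun v hv => (hpos v hv.1).ne' hv.2
    have e3 : K ∩ {v | 0 < m v} = K := Set.inter_eq_left.mpr hpos
    rw [e1, e2, e3, eulerSign_empty]
    ring
  by_cases hneg : ∀ v ∈ K, m v < 0
  · have e1 : K ∩ {v | 0 < m v} = ∅ :=
      Set.eq_empty_of_forall_notMem fun v hv => lt_asymm hv.2 (hneg v hv.1)
    have e2 : K ∩ {v | m v = 0} = ∅ :=
      Set.eq_empty_of_forall_notMem fun v hv => (hneg v hv.1).ne hv.2
    have e3 : K ∩ {v | m v < 0} = K := Set.inter_eq_left.mpr hneg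
    rw [e1, e2, e3, eulerSign_empty]
    ring
  -- What remains is the case in which m takes both signs on K: the three pieces then have
  -- dimensions d, d - 1, d, and their signs add up to (-1)^d.
  push Not at h0 hpos hneg
  obtain ⟨v, hv, hmv⟩ := h0
  obtain ⟨a, ha, hma⟩ := hpos
  obtain ⟨b, hb, hmb⟩ := hneg
  obtain ⟨p, hp, hmp, n, hn, hmn⟩ : ∃ p ∈ K, 0 < m p ∧ ∃ n ∈ K, m n < 0 := by
    rcases lt_or_gt_of_ne hmv with h | h
    · obtain ⟨u, hu, hmu⟩ := hK.exists_neg (m := -m) hb (by simpa using hmb) hv (by simpa using h)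
      exact ⟨u, hu, by simpa using hmu, v, hv, h⟩
    · obtain ⟨u, hu, hmu⟩ := hK.exists_neg ha hma hv h
      exact ⟨v, hv, h, u, hu, hmu⟩
  have hz : (-m n) • p + m p • n ∈ K :=
    hK.1 _ (hK.2.1 _ (neg_pos.mpr hmn) _ hp) _ (hK.2.1 _ hmp _ hn)
  have hmz : m ((-m n) • p + m p • n) = 0 := by
    rw [map_add, map_smul, map_smul, smul_eq_mul, smul_eq_mul]
    ring
  have n1 : (K ∩ {v | m v < 0}).Nonempty := ⟨n, hn, hmn⟩
  have n2 : (K ∩ {v | m v = 0}).Nonempty := ⟨_, hz, hmz⟩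
  have n3 : (K ∩ {v | 0 < m v}).Nonempty := ⟨p, hp, hmp⟩
  rw [eulerSign_of_nonempty n1, eulerSign_of_nonempty n2, eulerSign_of_nonempty n3,
    eulerSign_of_nonempty ⟨p, hp⟩,
    hK.span_inter_pos hp hmp, hK.span_inter_neg hn hmn,
    ← hK.finrank_span_inter_zero hz hmz hp hmp.ne', pow_succ]
  ring

/-- The cells of a finite hyperplane arrangement: the Euler characteristic of a relatively open
cone is the sum of those of its intersections with the cells. -/
theorem exists_cells [FiniteDimensional ℝ E] (H : Finset (E →L[ℝ] ℝ)) :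
    ∃ (κ : Type) (_ : Fintype κ) (R : κ → Set E),
      (∀ k, ∀ v ∈ R k, ∀ v' ∈ R k, ∀ m ∈ H, (m v = 0 ↔ m v' = 0) ∧ (0 < m v ↔ 0 < m v')) ∧
      ∀ K : Set E, IsRelOpenCone K → (∀ k, IsRelOpenCone (K ∩ R k)) ∧
        ∑ k, eulerSign (K ∩ R k) = eulerSign K := by
  classical
  induction H using Finset.induction_on with
  | empty =>
    exact ⟨Unit, inferInstance, fun _ => Set.univ, by simp, fun K hK => by simpa using hK⟩
  | insert m H hm ih =>
    obtain ⟨κ, _, R, h1, h2⟩ := ih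
    let Z : Fin 3 → Set E := ![{v | m v < 0}, {v | m v = 0}, {v | 0 < m v}]
    have hZ : ∀ s, IsRelOpenCone (Z s) := by
      intro s
      fin_cases s
      · exact isRelOpenCone_neg m
      · exact isRelOpenCone_zero m
      · exact isRelOpenCone_pos m
    refine ⟨κ × Fin 3, inferInstance, fun k => R k.1 ∩ Z k.2, ?_, fun K hK => ⟨?_, ?_⟩⟩
    · rintro ⟨k, s⟩ v hv v' hv' n hn
      rcases Finset.mem_insert.mp hn with rfl | hn
      · have hv := hv.2
        have hv' := hv'.2
        fin_cases s
        · have hv : n v < 0 := hv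
          have hv' : n v' < 0 := hv'
          exact ⟨by simp [hv.ne, hv'.ne], by simp [not_lt.mpr hv.le, not_lt.mpr hv'.le]⟩
        · have hv : n v = 0 := hv
          have hv' : n v' = 0 := hv'
          simp [hv, hv']
        · have hv : 0 < n v := hv
          have hv' : 0 < n v' := hv'
          simp [hv.ne', hv'.ne', hv, hv']
      · exact h1 k v hv.1 v' hv'.1 n hn
    · rintro ⟨k, s⟩
      have := ((h2 K hK).1 k).inter (hZ s)
      rwa [Set.inter_assoc] at this
    · rw [Fintype.sum_prod_type, ← (h2 K hK).2]
      refine Finset.sum_congr rfl fun k _ => ?_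
      rw [Fin.sum_univ_three, ← ((h2 K hK).1 k).eulerSign_cut m]
      simp [Z, Set.inter_assoc]

end RelOpen

variable {r : ℕ} {N : Submodule ℤ (RealSpace r)} (Fan : CompleteFan N)

/-- The points of `C` lying in no smaller cone of the fan. -/
def relInt (C : Set (RealSpace r)) : Set (RealSpace r) :=
  {y ∈ C | ∀ F ∈ Fan.cones, F ⊆ C → y ∈ F → F = C}

/-- The cone is a minimal one through y. Its intersection with a competitor is again a cone of the
fan through y, so it equals both. -/
theorem existsUnique_relInt (y : RealSpace r) : ∃! C, C ∈ Fan.cones ∧ y ∈ relInt Fan C := by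
  classical
  obtain ⟨C₀, hC₀, hy₀⟩ := Fan.complete y
  obtain ⟨C, hC⟩ := Finset.exists_minimal (s := Fan.cones.filter fun C => y ∈ C)
    ⟨C₀, Finset.mem_filter.mpr ⟨hC₀, hy₀⟩⟩
  have hC1 := Finset.mem_filter.mp hC.1
  refine ⟨C, ⟨hC1.1, hC1.2, fun F hF hFC hyF => ?_⟩, ?_⟩
  · exact Set.Subset.antisymm hFC (hC.2 (Finset.mem_filter.mpr ⟨hF, hyF⟩) hFC)
  · rintro D ⟨hD, hyD, hDm⟩
    have hCD := CompleteFan.inter_mem hC1.1 hD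
    have e1 := hDm _ hCD Set.inter_subset_right ⟨hC1.2, hyD⟩
    have e2 := hC.2 (Finset.mem_filter.mpr ⟨hCD, hC1.2, hyD⟩) Set.inter_subset_left
    refine Set.Subset.antisymm ?_ ?_
    · rw [← e1]
      exact Set.inter_subset_left
    · intro z hz
      exact (e2 hz).2

/-- Inequalities defining the cone `C` of the fan. -/
def facetForms (C : Set (RealSpace r)) : Finset (RealSpace r →L[ℝ] ℝ) :=
  open Classical in if h : C ∈ Fan.cones then (Fan.rational C h).1.choose else ∅

variable {Fan}

theorem facetForms_mem {C : Set (RealSpace r)} (hC : C ∈ Fan.cones) {m : RealSpace r →L[ℝ] ℝ}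
    (hm : m ∈ facetForms Fan C) : m ∈ dualLattice N := by
  rw [facetForms, dif_pos hC] at hm
  exact (Fan.rational C hC).1.choose_spec.1 m hm

theorem mem_cone_iff {C : Set (RealSpace r)} (hC : C ∈ Fan.cones) (x : RealSpace r) :
    x ∈ C ↔ ∀ m ∈ facetForms Fan C, 0 ≤ m x := by
  rw [facetForms, dif_pos hC]
  exact Set.ext_iff.mp (Fan.rational C hC).1.choose_spec.2 x

/-- A form not vanishing on C but zero at y would cut out a proper face through y. Conversely, if
all such forms are positive at y, one can move from y slightly along -z for each z in C, which
forces a face through y to contain z. -/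
theorem mem_relInt_iff {C : Set (RealSpace r)} (hC : C ∈ Fan.cones) (y : RealSpace r) :
    y ∈ relInt Fan C ↔ ∀ m ∈ facetForms Fan C,
      ((∀ z ∈ C, m z = 0) → m y = 0) ∧ (¬ (∀ z ∈ C, m z = 0) → 0 < m y) := by
  constructor
  · rintro ⟨hy, hmin⟩ m hm
    refine ⟨fun h => h y hy, fun h => ?_⟩
    refine lt_of_le_of_ne ((mem_cone_iff hC y).mp hy m hm) fun h0 => h ?_
    have := hmin {x ∈ C | m x = 0} (Fan.face_mem C hC _ ⟨m, facetForms_mem hC hm,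
      fun x hx => (mem_cone_iff hC x).mp hx m hm, rfl⟩) (Set.sep_subset _ _) ⟨hy, h0.symm⟩
    intro z hz
    rw [← this] at hz
    exact hz.2
  · intro h
    have hy : y ∈ C := by
      rw [mem_cone_iff hC]
      intro m hm
      by_cases hz : ∀ z ∈ C, m z = 0
      · exact ((h m hm).1 hz).ge
      · exact ((h m hm).2 hz).le
    refine ⟨hy, fun F hF hFC hyF => Set.Subset.antisymm hFC fun z hz => ?_⟩
    obtain ⟨u, -, hu, hFu⟩ := (Fan.inter_face C hC F hF).1
    rw [Set.inter_eq_self_of_subset_right hFC] at hFu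
    have hyu : u y = 0 := by
      rw [hFu] at hyF
      exact hyF.2
    have hev : ∀ᶠ ε : ℝ in 𝓝[>] 0, ∀ m ∈ facetForms Fan C, 0 ≤ m y + ε * m (-z) := by
      refine (Finset.eventually_all _).mpr fun m hm => ?_
      by_cases hm0 : ∀ z ∈ C, m z = 0
      · exact Eventually.of_forall fun ε => by rw [map_neg, hm0 z hz, hm0 y hy]; simp
      · exact (eventually_pos_add_mul ((h m hm).2 hm0) _).mono fun ε hε => hε.le
    obtain ⟨ε, hε, hε0⟩ := (hev.and self_mem_nhdsWithin).exists
    have hε0 : 0 < ε := hε0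
    have h1 : y + ε • (-z) ∈ C := by
      rw [mem_cone_iff hC]
      intro m hm
      rw [map_add, map_smul]
      exact hε m hm
    have h2 := hu _ h1
    rw [map_add, map_smul, map_neg, hyu, smul_eq_mul] at h2
    rw [hFu]
    refine ⟨hz, le_antisymm ?_ (hu z hz)⟩
    by_contra hcon
    nlinarith [mul_pos hε0 (not_le.mp hcon)]

theorem relInt_nonempty {C : Set (RealSpace r)} (hC : C ∈ Fan.cones) :
    (relInt Fan C).Nonempty := by
  classical
  have hch : ∀ m : RealSpace r →L[ℝ] ℝ, ∃ z ∈ C, m ∈ facetForms Fan C →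
      ¬ (∀ z ∈ C, m z = 0) → 0 < m z := by
    intro m
    by_cases h : m ∈ facetForms Fan C ∧ ¬ (∀ z ∈ C, m z = 0)
    · have h2 := h.2
      push Not at h2
      obtain ⟨z, hz, hmz⟩ := h2
      exact ⟨z, hz, fun hm _ => lt_of_le_of_ne ((mem_cone_iff hC z).mp hz m hm) hmz.symm⟩
    · exact ⟨0, CompleteFan.zero_mem hC, fun h1 h2 => absurd ⟨h1, h2⟩ h⟩
  choose z hz hzm using hch
  have hsum : ∑ m ∈ facetForms Fan C, z m ∈ C :=
    Finset.sum_induction _ (· ∈ C) (fun _ _ => CompleteFan.add_mem hC)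
      (CompleteFan.zero_mem hC) fun m _ => hz m
  refine ⟨∑ m ∈ facetForms Fan C, z m, (mem_relInt_iff hC _).mpr fun m hm =>
    ⟨fun h => h _ hsum, fun h => ?_⟩⟩
  rw [map_sum]
  exact Finset.sum_pos' (fun m' _ => (mem_cone_iff hC _).mp (hz m') m hm) ⟨m, hm, hzm m hm h⟩

variable (Fan) in
/-- The directions in which one moves from `x` into the relative interior of `C`. -/
def tangentPart (C : Set (RealSpace r)) (x : RealSpace r) : Set (RealSpace r) :=
  {v | ∀ m ∈ facetForms Fan C, ((∀ z ∈ C, m z = 0) → m v = 0) ∧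
    (¬ (∀ z ∈ C, m z = 0) → m x = 0 → 0 < m v)}

theorem eventually_mem_relInt_iff {C : Set (RealSpace r)} (hC : C ∈ Fan.cones) {x : RealSpace r}
    (hx : x ∈ C) (v : RealSpace r) :
    ∀ᶠ ε : ℝ in 𝓝[>] 0, (x + ε • v ∈ relInt Fan C ↔ v ∈ tangentPart Fan C x) := by
  have h : ∀ᶠ ε : ℝ in 𝓝[>] 0, ∀ m ∈ facetForms Fan C,
      (((∀ z ∈ C, m z = 0) → m (x + ε • v) = 0) ∧ (¬ (∀ z ∈ C, m z = 0) → 0 < m (x + ε • v)) ↔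
      ((∀ z ∈ C, m z = 0) → m v = 0) ∧ (¬ (∀ z ∈ C, m z = 0) → m x = 0 → 0 < m v)) := by
    refine (Finset.eventually_all _).mpr fun m hm => ?_
    by_cases h0 : ∀ z ∈ C, m z = 0
    · filter_upwards [self_mem_nhdsWithin] with ε hε
      have hε : ε ≠ 0 := ne_of_gt hε
      simp only [map_add, h0 x hx, map_smul, zero_add, smul_eq_mul, mul_eq_zero, hε, false_or]
      tauto
    · rcases ((mem_cone_iff hC x).mp hx m hm).eq_or_lt with h1 | h1
      · filter_upwards [self_mem_nhdsWithin] with ε hε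
        have hε : 0 < ε := hε
        rw [map_add, map_smul, ← h1, smul_eq_mul, zero_add, mul_pos_iff_of_pos_left hε]
        tauto
      · filter_upwards [eventually_pos_add_mul h1 (m v)] with ε hε
        rw [map_add, map_smul, smul_eq_mul]
        have := h1.ne'
        tauto
  filter_upwards [h] with ε hε
  rw [mem_relInt_iff hC]
  exact forall₂_congr hε

/-- For small ε every cone through x + εv also contains x, and x + εv is in exactly one relative
interior. Thus the tangent parts of the cones through x partition the space. -/
theorem existsUnique_tangentPart (x v : RealSpace r) :
    ∃! C, (C ∈ Fan.cones ∧ x ∈ C) ∧ v ∈ tangentPart Fan C x := by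
  classical
  have h1 : ∀ᶠ ε : ℝ in 𝓝[>] 0, ∀ C ∈ Fan.cones, x + ε • v ∈ C → x ∈ C := by
    refine (Finset.eventually_all _).mpr fun C hC => ?_
    by_cases hx : x ∈ C
    · exact Eventually.of_forall fun _ _ => hx
    · rw [mem_cone_iff hC] at hx
      push Not at hx
      obtain ⟨m, hm, hmx⟩ := hx
      filter_upwards [eventually_pos_add_mul (neg_pos.mpr hmx) (-m v)] with ε hε hmem
      have := (mem_cone_iff hC _).mp hmem m hm
      rw [map_add, map_smul, smul_eq_mul] at this
      linarith
  have h2 : ∀ᶠ ε : ℝ in 𝓝[>] 0, ∀ C ∈ Fan.cones.filter fun C => x ∈ C,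
      (x + ε • v ∈ relInt Fan C ↔ v ∈ tangentPart Fan C x) :=
    (Finset.eventually_all _).mpr fun C hC =>
      eventually_mem_relInt_iff (Finset.mem_filter.mp hC).1 (Finset.mem_filter.mp hC).2 v
  obtain ⟨ε, h1, h2⟩ := (h1.and h2).exists
  obtain ⟨C, ⟨hC, hyC⟩, huniq⟩ := existsUnique_relInt Fan (x + ε • v)
  have hxC := h1 C hC hyC.1
  refine ⟨C, ⟨⟨hC, hxC⟩, (h2 C (Finset.mem_filter.mpr ⟨hC, hxC⟩)).mp hyC⟩, ?_⟩
  rintro D ⟨⟨hD, hxD⟩, hvD⟩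
  exact huniq D ⟨hD, (h2 D (Finset.mem_filter.mpr ⟨hD, hxD⟩)).mpr hvD⟩

theorem isRelOpenCone_tangentPart (C : Set (RealSpace r)) (x : RealSpace r) :
    IsRelOpenCone (tangentPart Fan C x) := by
  classical
  have h := isRelOpenCone_polyhedral
    ((facetForms Fan C).filter fun m => ∀ z ∈ C, m z = 0)
    ((facetForms Fan C).filter fun m => ¬ (∀ z ∈ C, m z = 0) ∧ m x = 0)
  convert h using 1
  ext v
  simp only [tangentPart, Finset.mem_filter, Set.mem_ofPred_eq]
  constructor
  · exact fun hv => ⟨fun m hm => (hv m hm.1).1 hm.2, fun m hm => (hv m hm.1).2 hm.2.1 hm.2.2⟩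
  · exact fun hv m hm => ⟨fun h => hv.1 m ⟨hm, h⟩, fun h h' => hv.2 m ⟨hm, h, h'⟩⟩

theorem relInt_subset_tangentPart {C : Set (RealSpace r)} (hC : C ∈ Fan.cones)
    (x : RealSpace r) : relInt Fan C ⊆ tangentPart Fan C x := fun _ hz m hm =>
  ⟨((mem_relInt_iff hC _).mp hz m hm).1, fun h _ => ((mem_relInt_iff hC _).mp hz m hm).2 h⟩

theorem span_tangentPart {C : Set (RealSpace r)} (hC : C ∈ Fan.cones) (x : RealSpace r) : Submodule.span ℝ (tangentPart Fan C x) = Submodule.span ℝ C := by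
  obtain ⟨z, hz⟩ := relInt_nonempty hC
  have hz' := (mem_relInt_iff hC z).mp hz
  refine le_antisymm (Submodule.span_le.mpr fun v hv => ?_) (Submodule.span_le.mpr fun y hy => ?_)
  · have hev : ∀ᶠ ε : ℝ in 𝓝[>] 0, ∀ m ∈ facetForms Fan C, 0 ≤ m z + ε * m v := by
      refine (Finset.eventually_all _).mpr fun m hm => ?_
      by_cases h0 : ∀ z ∈ C, m z = 0
      · exact Eventually.of_forall fun ε => by rw [(hv m hm).1 h0, h0 z hz.1]; simp
      · exact (eventually_pos_add_mul ((hz' m hm).2 h0) _).mono fun ε hε => hε.le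
    obtain ⟨ε, hε, hε0⟩ := (hev.and self_mem_nhdsWithin).exists
    have hε0 : 0 < ε := hε0
    have h1 : z + ε • v ∈ C := by
      rw [mem_cone_iff hC]
      intro m hm
      rw [map_add, map_smul]
      exact hε m hm
    have h2 := Submodule.smul_mem _ ε⁻¹ (Submodule.sub_mem _ (Submodule.subset_span (R := ℝ) h1)
      (Submodule.subset_span hz.1))
    rwa [add_sub_cancel_left, inv_smul_smul₀ hε0.ne'] at h2
  · have h1 : y + z ∈ relInt Fan C := by
      rw [mem_relInt_iff hC]
      intro m hm
      refine ⟨fun h => h _ (CompleteFan.add_mem hC hy hz.1), fun h => ?_⟩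
      rw [map_add]
      exact add_pos_of_nonneg_of_pos ((mem_cone_iff hC y).mp hy m hm) ((hz' m hm).2 h)
    have h2 := Submodule.sub_mem _
      (Submodule.subset_span (R := ℝ) (relInt_subset_tangentPart hC x h1))
      (Submodule.subset_span (relInt_subset_tangentPart hC x hz))
    rwa [add_sub_cancel_right] at h2

theorem coneDim_le (C : Set (RealSpace r)) : coneDim C ≤ r := by
  have := Submodule.finrank_le (Submodule.span ℝ C)
  simpa [coneDim] using this

open Classical in
/-- The alternating number of cones of a complete fan through a given point. -/
theorem sum_sign_cones_containing (x : RealSpace r) :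
    ∑ C ∈ Fan.cones.filter (fun C => x ∈ C), (-1 : ℂ) ^ (r - coneDim C) = 1 := by
  obtain ⟨κ, _, R, hR, hsum⟩ := exists_cells (Fan.cones.biUnion fun C => facetForms Fan C)
  -- Each tangent part is a union of cells of the arrangement of all defining forms, and the tangent
  -- parts at x partition the space. Additivity over cells therefore compares their signs with that
  -- of the whole space.
  have h1 : ∑ C ∈ Fan.cones.filter (fun C => x ∈ C), eulerSign (tangentPart Fan C x) =
      eulerSign (Set.univ : Set (RealSpace r)) := by
    rw [← (hsum _ isRelOpenCone_univ).2]
    rw [Finset.sum_congr rfl fun C _ => (hsum _ (isRelOpenCone_tangentPart C x)).2.symm,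
      Finset.sum_comm]
    refine Finset.sum_congr rfl fun k _ => ?_
    rw [Set.univ_inter]
    rcases (R k).eq_empty_or_nonempty with he | ⟨v, hv⟩
    · simp [he, eulerSign_empty]
    · obtain ⟨C, ⟨hC, hvC⟩, huniq⟩ := existsUnique_tangentPart (Fan := Fan) x v
      have hsub : ∀ D ∈ Fan.cones, ∀ v' ∈ R k, v' ∈ tangentPart Fan D x →
          R k ⊆ tangentPart Fan D x := by
        intro D hD v' hv' hvD u hu m hm
        have hs := hR k v' hv' u hu m (Finset.mem_biUnion.mpr ⟨D, hD, hm⟩)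
        exact ⟨fun h => hs.1.mp ((hvD m hm).1 h), fun h h' => hs.2.mp ((hvD m hm).2 h h')⟩
      rw [Finset.sum_eq_single_of_mem C (Finset.mem_filter.mpr hC)]
      · rw [Set.inter_eq_self_of_subset_right (hsub C hC.1 v hv hvC)]
      · intro D hD hDC
        have : tangentPart Fan D x ∩ R k = ∅ := by
          refine Set.eq_empty_of_forall_notMem fun u hu => hDC ?_
          have hD := Finset.mem_filter.mp hD
          exact huniq D ⟨hD, hsub D hD.1 u hu.2 hu.1 hv⟩
        rw [this, eulerSign_empty]
  have h2 : ∑ C ∈ Fan.cones.filter (fun C => x ∈ C), (-1 : ℤ) ^ coneDim C = (-1) ^ r := by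
    have e : eulerSign (Set.univ : Set (RealSpace r)) = (-1) ^ r := by
      rw [eulerSign_of_nonempty Set.univ_nonempty, Submodule.span_univ, finrank_top]
      simp
    rw [← e, ← h1]
    refine Finset.sum_congr rfl fun C hC => ?_
    have hC := Finset.mem_filter.mp hC
    rw [eulerSign_of_nonempty ((relInt_nonempty hC.1).mono (relInt_subset_tangentPart hC.1 x)),
      span_tangentPart hC.1 x, coneDim]
  have h3 : ∀ C : Set (RealSpace r), (-1 : ℂ) ^ (r - coneDim C) =
      (-1) ^ r * (((-1 : ℤ) ^ coneDim C : ℤ) : ℂ) := by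
    intro C
    have h4 : (-1 : ℂ) ^ r = (-1) ^ (r - coneDim C) * (-1) ^ coneDim C := by
      rw [← pow_add, Nat.sub_add_cancel (coneDim_le C)]
    push_cast
    rw [h4, mul_assoc, ← mul_pow]
    simp
  rw [Finset.sum_congr rfl fun C _ => h3 C, ← Finset.mul_sum, ← Int.cast_sum, h2]
  push_cast
  rw [← mul_pow]
  simp

end Euler

/-! ### Decompositions of the weighted lattice into cones. -/

section FanSeries

open Filter Topology

variable {r : ℕ} {N : Submodule ℤ (RealSpace r)}

/-- The weight `e^{2πi deg(n)}`. -/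
def weight (deg : N → ℂ) (n : N) : ℂ := Complex.exp (2 * Real.pi * Complex.I * deg n)

/-- The character `n ↦ q^{m·n}`. -/
def latticeChar (τ : ℂ) (m : ComplexDual r) : Multiplicative N →* ℂ where
  toFun n := Complex.exp (2 * Real.pi * Complex.I * (τ * m (n.toAdd : N)))
  map_one' := by simp
  map_mul' x y := by
    rw [← Complex.exp_add]
    congr 1
    simp only [toAdd_mul, Submodule.coe_add, map_add]
    ring

theorem latticeChar_apply (τ : ℂ) (m : ComplexDual r) (n : N) :
    latticeChar τ m (Multiplicative.ofAdd n) =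
      Complex.exp (2 * Real.pi * Complex.I * (τ * m n)) := rfl

theorem coneSummand_eq (deg : N → ℂ) (τ : ℂ) (m : ComplexDual r) (n : N) :
    coneSummand deg τ m n = weight deg n * latticeChar τ m (Multiplicative.ofAdd n) := by
  rw [coneSummand, latticeChar_apply, weight, mul_comm]

/-- The weights of the lattice points of `C`, extended by zero. -/
def coneWeight (deg : N → ℂ) (C : Set (RealSpace r)) : N → ℂ :=
  Set.indicator {n : N | (n : RealSpace r) ∈ C} (weight deg)

variable {Fan : CompleteFan N}

theorem IsDegreeFunction.exists_character {deg : N → ℂ} (h : IsDegreeFunction Fan deg)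
    {C : Set (RealSpace r)} (hC : C ∈ Fan.cones) :
    ∃ Λ : Multiplicative N →* ℂ, ∀ n : N, (n : RealSpace r) ∈ C →
      weight deg n = Λ (Multiplicative.ofAdd n) := by
  obtain ⟨L, hL⟩ := h C hC
  refine ⟨latticeChar 1 L, fun n hn => ?_⟩
  rw [weight, latticeChar_apply, hL n hn, one_mul]

variable (Fan) in
/-- The inclusion of the ray generators of `C` in the lattice. -/
def rayGen (C : Set (RealSpace r)) : coneRays Fan C → N := fun i => i.1

variable (Fan) in
/-- A triangulation of `C` without new rays. -/
def triangulation (C : Set (RealSpace r)) : Finset (Finset (coneRays Fan C)) :=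
  (exists_triangulation (rayVec Fan C)).choose

theorem triangulation_spec {C : Set (RealSpace r)} :
    (∀ B ∈ triangulation Fan C, LinearIndepOn ℝ (rayVec Fan C) (B : Set (coneRays Fan C)) ∧
        Submodule.span ℝ (rayVec Fan C '' (B : Set (coneRays Fan C))) =
          Submodule.span ℝ (Set.range (rayVec Fan C))) ∧
      ∀ x, IsGeneric (rayVec Fan C) x →
        (x ∈ coneHull (rayVec Fan C) ↔ ∃ B ∈ triangulation Fan C, x ∈ openPart (rayVec Fan C) B) ∧
        ∀ B ∈ triangulation Fan C, ∀ B' ∈ triangulation Fan C,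
          x ∈ openPart (rayVec Fan C) B → x ∈ openPart (rayVec Fan C) B' → B = B' :=
  (exists_triangulation (rayVec Fan C)).choose_spec

variable (Fan) in
/-- The half-open simplicial cone spanned by `B`, with faces removed according to `ξ`. -/
def simplexPart (C : Set (RealSpace r)) (ξ : RealSpace r) (B : Finset (coneRays Fan C)) :
    Set (RealSpace r) :=
  conePart (rayVec Fan C) B (negSet (rayVec Fan C) B ξ) ∅

open Classical in
variable (Fan) in
/-- The full-dimensional cones of the fan. -/
def topCones : Finset (Set (RealSpace r)) :=
  Fan.cones.filter fun C => Submodule.span ℝ C = ⊤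

theorem mem_topCones {C : Set (RealSpace r)} :
    C ∈ topCones Fan ↔ C ∈ Fan.cones ∧ Submodule.span ℝ C = ⊤ := by
  simp [topCones]

variable (Fan) in
/-- `ξ` lies in no proper subspace spanned by rays of a cone of the fan. -/
def IsFanGeneric (ξ : RealSpace r) : Prop :=
  ∀ C ∈ Fan.cones, ∀ B : Finset (coneRays Fan C),
    Submodule.span ℝ (rayVec Fan C '' (B : Set (coneRays Fan C))) ≠ ⊤ →
      ξ ∉ Submodule.span ℝ (rayVec Fan C '' (B : Set (coneRays Fan C)))

theorem exists_isFanGeneric {U : Set (RealSpace r)} (hU : IsOpen U) {u : RealSpace r}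
    (hu : u ∈ U) : ∃ ξ ∈ U, IsFanGeneric Fan ξ := by
  obtain ⟨ξ, h1, h2⟩ := exists_mem_open_notMem
    (κ := {p : Σ C : Fan.cones, Finset (coneRays Fan C.1) //
      Submodule.span ℝ (rayVec Fan p.1.1 '' (p.2 : Set (coneRays Fan p.1.1))) ≠ ⊤})
    (fun p => Submodule.span ℝ (rayVec Fan p.1.1.1 '' (p.1.2 : Set (coneRays Fan p.1.1.1))))
    (fun p => p.2) hU hu
  exact ⟨ξ, h1, fun C hC B hB => h2 ⟨⟨⟨C, hC⟩, B⟩, hB⟩⟩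

-- By the Euler relation each lattice point is counted once in total, whatever the number of cones
-- through it.
open Classical in
theorem sum_sign_smul_coneWeight (deg : N → ℂ) :
    ∑ C ∈ Fan.cones, (-1 : ℂ) ^ (r - coneDim C) • coneWeight deg C = weight deg := by
  ext n
  have h := sum_sign_cones_containing (Fan := Fan) (n : RealSpace r)
  rw [Finset.sum_filter] at h
  simp only [Finset.sum_apply, Pi.smul_apply, coneWeight, Set.indicator_apply,
    Set.mem_ofPred_eq, smul_eq_mul]
  refine (Finset.sum_congr rfl fun C _ => ?_).trans
    ((Finset.sum_mul _ _ (weight deg n)).symm.trans (by rw [h, one_mul]))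
  split_ifs <;> simp

open Classical in
theorem sum_unique_indicator {κ : Type*} (T : Finset κ) (P : κ → Prop)
    (huniq : ∀ B ∈ T, ∀ B' ∈ T, P B → P B' → B = B') (c : ℂ) :
    ∑ B ∈ T, (if P B then c else 0) = if ∃ B ∈ T, P B then c else 0 := by
  split_ifs with h
  · obtain ⟨B, hB, hP⟩ := h
    rw [Finset.sum_eq_single_of_mem B hB, if_pos hP]
    intro B' hB' hne
    rw [if_neg fun hP' => hne (huniq B' hB' B hB hP' hP)]
  · refine Finset.sum_eq_zero fun B hB => if_neg fun hP => h ⟨B, hB, hP⟩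

variable [DiscreteTopology N] [IsZLattice ℝ N]

theorem conePart_subset_cone {C : Set (RealSpace r)} (hC : C ∈ Fan.cones)
    {B : Finset (coneRays Fan C)} (hB : B ∈ triangulation Fan C) (J : Finset (coneRays Fan C)) :
    conePart (rayVec Fan C) B J ∅ ⊆ C := by
  have := conePart_subset_coneHull J (triangulation_spec.1 B hB).1
  rwa [coneHull_rayVec Fan hC] at this

/-- The direction ξ is chosen inside C, so n + εξ stays in C for every n in C and the half-open
pieces lose no point of C, boundary included. -/
theorem exists_coneWeight_eq_sum {C : Set (RealSpace r)} (hC : C ∈ Fan.cones) (deg : N → ℂ) :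
    ∃ ξ, coneWeight deg C =
      ∑ B ∈ triangulation Fan C, coneWeight deg (simplexPart Fan C ξ B) := by
  classical
  obtain ⟨ξ, hξ, c, hc, hcξ⟩ := exists_generic_interior (rayVec Fan C)
  have hξC : ξ ∈ C := by
    rw [← coneHull_rayVec Fan hC]
    exact ⟨c, hc, hcξ⟩
  have hξW : ξ ∈ Submodule.span ℝ (Set.range (rayVec Fan C)) := by
    rw [span_rayVec Fan hC]
    exact Submodule.subset_span hξC
  refine ⟨ξ, ?_⟩
  ext n
  obtain ⟨h1, h2⟩ := triangulation_perturb triangulation_spec.1 triangulation_spec.2 hξ hξW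
    (n : RealSpace r)
  have hiff : (n : RealSpace r) ∈ C ↔
      ∃ B ∈ triangulation Fan C, (n : RealSpace r) ∈ simplexPart Fan C ξ B := by
    constructor
    · intro hn
      obtain ⟨ε, hε, hε0⟩ := (h1.and self_mem_nhdsWithin).exists
      refine hε.mp ?_
      rw [coneHull_rayVec Fan hC]
      exact CompleteFan.add_mem hC hn (CompleteFan.smul_mem hC hξC (le_of_lt hε0))
    · rintro ⟨B, hB, hn⟩
      exact conePart_subset_cone hC hB _ hn
  simp only [Finset.sum_apply, coneWeight, Set.indicator_apply, Set.mem_ofPred_eq]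
  rw [sum_unique_indicator _ (fun B => (n : RealSpace r) ∈ simplexPart Fan C ξ B) h2]
  exact if_congr hiff rfl rfl

/-- The triangulation has no new rays, so the product over the rays of C is a common denominator of
all simplices. Hence poles are controlled by deg on the rays alone. -/
theorem exists_convAct_coneWeight {deg : N → ℂ} (hdeg : IsDegreeFunction Fan deg)
    {C : Set (RealSpace r)} (hC : C ∈ Fan.cones) :
    ∃ h : AddMonoidAlgebra ℂ N,
      convAct (rayPoly (rayGen Fan C) (weight deg) Finset.univ) (coneWeight deg C) = ⇑h.coeff := by
  obtain ⟨ξ, hξ⟩ := exists_coneWeight_eq_sum hC deg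
  obtain ⟨Λ, hΛ⟩ := hdeg.exists_character hC
  have key : ∀ B ∈ triangulation Fan C, ∃ h : AddMonoidAlgebra ℂ N,
      convAct (rayPoly (rayGen Fan C) (weight deg) Finset.univ)
        (coneWeight deg (simplexPart Fan C ξ B)) = ⇑h.coeff := fun B hB =>
    exists_convAct_rayPoly_univ (d := rayGen Fan C) _ (triangulation_spec.1 B hB).1 _ Λ
      fun n hn => hΛ n (conePart_subset_cone hC hB _ hn)
  choose! h hh using key
  refine ⟨∑ B ∈ triangulation Fan C, h B, ?_⟩
  rw [hξ, map_sum, Finset.sum_congr rfl hh, AddMonoidAlgebra.coeff_sum, Finsupp.coe_finsetSum]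

theorem exists_isReg_coneWeight {deg : N → ℂ} (hdeg : IsDegreeFunction Fan deg)
    {C : Set (RealSpace r)} (hC : C ∈ Fan.cones) {χ : Multiplicative N →* ℂ}
    (hχ : ∀ i, weight deg (rayGen Fan C i) * χ (Multiplicative.ofAdd (rayGen Fan C i)) ≠ 1) :
    ∃ v, IsReg χ (coneWeight deg C) v := by
  obtain ⟨h, hh⟩ := exists_convAct_coneWeight hdeg hC
  have h0 : evalChar χ (rayPoly (rayGen Fan C) (weight deg) Finset.univ) ≠ 0 := by
    rw [evalChar_rayPoly]
    exact Finset.prod_ne_zero_iff.mpr fun i _ => sub_ne_zero.mpr (hχ i).symm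
  exact ⟨_, _, h, hh, h0, (div_mul_cancel₀ _ h0).symm⟩

theorem IsFanGeneric.notMem {ξ : RealSpace r} (hξ : IsFanGeneric Fan ξ) {C : Set (RealSpace r)}
    (hC : C ∈ Fan.cones) (hspan : Submodule.span ℝ C ≠ ⊤) : ξ ∉ Submodule.span ℝ C := by
  have h := hξ C hC Finset.univ
  rw [Finset.coe_univ, Set.image_univ, span_rayVec Fan hC] at h
  exact h hspan

theorem IsFanGeneric.isGeneric {ξ : RealSpace r} (hξ : IsFanGeneric Fan ξ)
    {C : Set (RealSpace r)} (hC : C ∈ Fan.cones) (hspan : Submodule.span ℝ C = ⊤) :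
    IsGeneric (rayVec Fan C) ξ := by
  intro B hB
  rw [span_rayVec Fan hC, hspan] at hB
  exact hξ C hC B hB

/-- The shifted point avoids the spans of all lower-dimensional cones. If two cones contain it,
their intersection is full-dimensional, so the form cutting it out as a face is zero and the cones
coincide. -/
theorem eventually_existsUnique_topCone {ξ : RealSpace r} (hξ : IsFanGeneric Fan ξ)
    (x : RealSpace r) : ∀ᶠ ε : ℝ in 𝓝[>] 0, ∃! C, C ∈ topCones Fan ∧ x + ε • ξ ∈ C := by
  have h : ∀ᶠ ε : ℝ in 𝓝[>] 0, ∀ C ∈ Fan.cones, Submodule.span ℝ C ≠ ⊤ →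
      x + ε • ξ ∉ Submodule.span ℝ C := by
    refine (Finset.eventually_all _).mpr fun C hC => ?_
    by_cases hs : Submodule.span ℝ C = ⊤
    · exact Eventually.of_forall fun ε h => absurd hs h
    · exact (eventually_add_smul_notMem _ (hξ.notMem hC hs) x).mono fun ε h _ => h
  filter_upwards [h] with ε hε
  have htop : ∀ C ∈ Fan.cones, x + ε • ξ ∈ C → Submodule.span ℝ C = ⊤ := by
    intro C hC hx
    by_contra hs
    exact hε C hC hs (Submodule.subset_span hx)
  obtain ⟨C, hC, hxC⟩ := Fan.complete (x + ε • ξ)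
  refine ⟨C, ⟨mem_topCones.mpr ⟨hC, htop C hC hxC⟩, hxC⟩, ?_⟩
  rintro D ⟨hD, hxD⟩
  have hD := (mem_topCones.mp hD).1
  have hsub : ∀ C ∈ Fan.cones, ∀ D ∈ Fan.cones, x + ε • ξ ∈ C → x + ε • ξ ∈ D → C ⊆ D := by
    intro C hC D hD hxC hxD
    have hs := htop _ (CompleteFan.inter_mem hC hD) ⟨hxC, hxD⟩
    obtain ⟨u, -, -, hu⟩ := (Fan.inter_face C hC D hD).1
    have hu0 : ∀ z : RealSpace r, u z = 0 := by
      intro z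
      have hz : z ∈ Submodule.span ℝ (C ∩ D) := hs ▸ Submodule.mem_top
      induction hz using Submodule.span_induction with
      | mem z hz =>
        rw [hu] at hz
        exact hz.2
      | zero => exact map_zero u
      | add x y _ _ hx hy => rw [map_add, hx, hy, add_zero]
      | smul t x _ hx => rw [map_smul, hx, smul_zero]
    intro z hz
    have : z ∈ C ∩ D := by
      rw [hu]
      exact ⟨hz, hu0 z⟩
    exact this.2
  exact Set.Subset.antisymm (hsub D hD C hC hxD hxC) (hsub C hC D hD hxC hxD)

/-- The half-open simplicial cones of the triangulated full-dimensional cones partition the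
lattice. -/
theorem weight_eq_sum_simplexPart {ξ : RealSpace r} (hξ : IsFanGeneric Fan ξ) (deg : N → ℂ) :
    weight deg = ∑ C ∈ topCones Fan, ∑ B ∈ triangulation Fan C,
      coneWeight deg (simplexPart Fan C ξ B) := by
  classical
  ext n
  have hC : ∀ C ∈ topCones Fan, IsGeneric (rayVec Fan C) ξ ∧
      ξ ∈ Submodule.span ℝ (Set.range (rayVec Fan C)) := by
    intro C hC
    have hC := mem_topCones.mp hC
    refine ⟨hξ.isGeneric hC.1 hC.2, ?_⟩
    rw [span_rayVec Fan hC.1, hC.2]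
    exact Submodule.mem_top
  have hT := fun C hC' => triangulation_perturb triangulation_spec.1 triangulation_spec.2
    (hC C hC').1 (hC C hC').2 (n : RealSpace r)
  have h1 : ∀ᶠ ε : ℝ in 𝓝[>] 0, ∀ C ∈ topCones Fan, ((n : RealSpace r) + ε • ξ ∈ C ↔
      ∃ B ∈ triangulation Fan C, (n : RealSpace r) ∈ simplexPart Fan C ξ B) := by
    refine (Finset.eventually_all _).mpr fun C hC' => ?_
    have := (hT C hC').1
    rwa [coneHull_rayVec Fan (mem_topCones.mp hC').1] at this
  obtain ⟨ε, h1, C, ⟨hCt, hnC⟩, huniq⟩ :=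
    (h1.and (eventually_existsUnique_topCone hξ (n : RealSpace r))).exists
  have h2 : ∀ D ∈ topCones Fan, ∑ B ∈ triangulation Fan D,
      coneWeight deg (simplexPart Fan D ξ B) n =
        if (n : RealSpace r) + ε • ξ ∈ D then weight deg n else 0 := by
    intro D hD
    simp only [coneWeight, Set.indicator_apply, Set.mem_ofPred_eq]
    rw [sum_unique_indicator _ (fun B => (n : RealSpace r) ∈ simplexPart Fan D ξ B) (hT D hD).2]
    exact if_congr (h1 D hD).symm rfl rfl
  simp only [Finset.sum_apply]
  rw [Finset.sum_congr rfl h2, Finset.sum_eq_single_of_mem C hCt, if_pos hnC]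
  intro D hD hne
  rw [if_neg fun h => hne (huniq D ⟨hD, h⟩)]

end FanSeries

/-! ### Analytic continuation of the cone sums. -/

section Continuation

open Filter Topology

theorem summable_exp_neg_norm {E : Type*} [NormedAddCommGroup E] [NormedSpace ℝ E]
    [FiniteDimensional ℝ E] (N : Submodule ℤ E) [DiscreteTopology N] {ε : ℝ} (hε : 0 < ε) :
    Summable fun n : N => Real.exp (-(ε * ‖(n : E)‖)) := by
  set k := Module.finrank ℤ N + 1 with hk
  have hs := (ZLattice.summable_norm_pow_inv N k (Nat.lt_succ_self _)).mul_left
    ((k.factorial : ℝ) / ε ^ k)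
  refine Summable.of_norm_bounded_eventually hs ?_
  have h0 : ∀ᶠ n : N in cofinite, n ≠ 0 := (Set.finite_singleton (0 : N)).compl_mem_cofinite
  filter_upwards [h0] with n hn
  have hn' : 0 < ‖n‖ := norm_pos_iff.mpr hn
  have h1 := Real.pow_div_factorial_le_exp (ε * ‖n‖) (by positivity) k
  rw [Real.norm_eq_abs, Real.abs_exp, Real.exp_neg]
  change (Real.exp (ε * ‖n‖))⁻¹ ≤ _
  have h2 : 0 < (ε * ‖n‖) ^ k / k.factorial := by positivity
  refine (inv_anti₀ h2 h1).trans (le_of_eq ?_)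
  rw [mul_pow, inv_div, inv_pow, div_mul_eq_div_div, div_eq_mul_inv (_ / _)]

variable {r : ℕ} {N : Submodule ℤ (RealSpace r)} {Fan : CompleteFan N}

/-- Evaluation at a point, as a complex-linear functional on `ℂ × M_ℂ`. -/
def evalDual (x : RealSpace r) : ComplexDual r →L[ℂ] ℂ :=
  LinearMap.mkContinuous
    { toFun := fun m => m x
      map_add' := fun _ _ => rfl
      map_smul' := fun _ _ => rfl } ‖x‖
    fun m => by
      rw [mul_comm]
      exact m.le_opNorm x

theorem analyticAt_pairing (x : RealSpace r) (z : ℂ × ComplexDual r) :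
    AnalyticAt ℂ (fun z : ℂ × ComplexDual r => z.1 * z.2 x) z :=
  analyticAt_fst.mul ((evalDual x).analyticAt z.2 |>.comp analyticAt_snd)

theorem continuous_pairing (x : RealSpace r) :
    Continuous (fun z : ℂ × ComplexDual r => z.1 * z.2 x) :=
  continuous_fst.mul ((evalDual x).continuous.comp continuous_snd)

theorem analyticAt_latticeChar (n : N) (z : ℂ × ComplexDual r) :
    AnalyticAt ℂ (fun z : ℂ × ComplexDual r =>
      latticeChar z.1 z.2 (Multiplicative.ofAdd n)) z := by
  simp only [latticeChar_apply]
  exact (analyticAt_const.mul (analyticAt_pairing _ z)).cexp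

theorem analyticAt_evalChar (h : AddMonoidAlgebra ℂ N) (z : ℂ × ComplexDual r) :
    AnalyticAt ℂ (fun z : ℂ × ComplexDual r => evalChar (latticeChar z.1 z.2) h) z := by
  simp only [evalChar_eq_sum]
  have := Finset.analyticAt_fun_sum (𝕜 := ℂ) h.coeff.support
    (f := fun n (z : ℂ × ComplexDual r) =>
      h.coeff n * latticeChar z.1 z.2 (Multiplicative.ofAdd n)) (c := z)
    fun n _ => analyticAt_const.mul (analyticAt_latticeChar n z)
  exact this

theorem norm_exp_two_pi_I_mul (z : ℂ) :
    ‖Complex.exp (2 * Real.pi * Complex.I * z)‖ = Real.exp (-(2 * Real.pi * z.im)) := by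
  rw [Complex.norm_exp]
  congr 1
  simp [Complex.mul_re, Complex.mul_im]

theorem norm_latticeChar (τ : ℂ) (m : ComplexDual r) (n : N) :
    ‖latticeChar τ m (Multiplicative.ofAdd n)‖ =
      Real.exp (-(2 * Real.pi * (τ * m n).im)) := by
  rw [latticeChar_apply, norm_exp_two_pi_I_mul]

theorem norm_weight {deg : N → ℂ} (hreal : ∀ n, (deg n).im = 0) (n : N) : ‖weight deg n‖ = 1 := by
  rw [weight, norm_exp_two_pi_I_mul, hreal]
  simp

theorem exists_pos_mul_le {ι : Type*} [Fintype ι] (a b : ι → ℝ) (ha : ∀ i, 0 < a i)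
    (hb : ∀ i, 0 ≤ b i) : ∃ ε : ℝ, 0 < ε ∧ ∀ i, ε * b i ≤ a i := by
  have hpos : 0 < ∑ i, b i / a i + 1 := by
    have := Finset.sum_nonneg fun i (_ : i ∈ Finset.univ) => div_nonneg (hb i) (ha i).le
    linarith
  refine ⟨(∑ i, b i / a i + 1)⁻¹, inv_pos.mpr hpos, fun i => ?_⟩
  rw [inv_mul_le_iff₀ hpos]
  have h1 : b i / a i ≤ ∑ i, b i / a i + 1 := by
    have := Finset.single_le_sum (f := fun i => b i / a i)
      (fun j _ => div_nonneg (hb j) (ha j).le) (Finset.mem_univ i)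
    linarith
  exact (div_le_iff₀ (ha i)).mp h1

variable (Fan) in
/-- A region of absolute convergence of the series attached to `C`. -/
def convRegion (C : Set (RealSpace r)) : Set (ℂ × ComplexDual r) :=
  {z | ∀ i : coneRays Fan C, 0 < (z.1 * z.2 (rayVec Fan C i)).im}

theorem isOpen_convRegion (C : Set (RealSpace r)) : IsOpen (convRegion Fan C) := by
  simp only [convRegion, Set.ofPred_forall]
  exact isOpen_iInter_of_finite fun i =>
    isOpen_lt continuous_const (Complex.continuous_im.comp (continuous_pairing _))

variable (Fan) in
/-- The points at which the denominators of the cone sum attached to `C` do not vanish. -/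
def regularRegion (deg : N → ℂ) (C : Set (RealSpace r)) : Set (ℂ × ComplexDual r) :=
  {z | 0 < z.1.im ∧ ∀ i : coneRays Fan C, weight deg (rayGen Fan C i) *
    latticeChar z.1 z.2 (Multiplicative.ofAdd (rayGen Fan C i)) ≠ 1}

theorem isOpen_regularRegion (deg : N → ℂ) (C : Set (RealSpace r)) :
    IsOpen (regularRegion Fan deg C) := by
  simp only [regularRegion, Set.ofPred_and, Set.ofPred_forall]
  refine (isOpen_lt continuous_const (Complex.continuous_im.comp continuous_fst)).inter
    (isOpen_iInter_of_finite fun i => isOpen_ne_fun ?_ continuous_const)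
  refine continuous_const.mul (continuous_iff_continuousAt.mpr fun z => ?_)
  exact (analyticAt_latticeChar _ z).continuousAt

theorem evalChar_rayPoly_ne_zero {deg : N → ℂ} {C : Set (RealSpace r)} {z : ℂ × ComplexDual r}
    (hz : z ∈ regularRegion Fan deg C) :
    evalChar (latticeChar z.1 z.2) (rayPoly (rayGen Fan C) (weight deg) Finset.univ) ≠ 0 := by
  rw [evalChar_rayPoly]
  exact Finset.prod_ne_zero_iff.mpr fun i _ => sub_ne_zero.mpr (hz.2 i).symm

theorem mem_regularRegion_of_convRegion {deg : N → ℂ} (hreal : ∀ n, (deg n).im = 0)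
    {C : Set (RealSpace r)} {z : ℂ × ComplexDual r} (hz : z ∈ convRegion Fan C)
    (hτ : 0 < z.1.im) : z ∈ regularRegion Fan deg C := by
  refine ⟨hτ, fun i h => ?_⟩
  have h1 := congrArg norm h
  rw [norm_mul, norm_weight hreal, one_mul, norm_latticeChar, norm_one, Real.exp_eq_one_iff] at h1
  have h2 : 0 < (z.1 * z.2 (rayVec Fan C i)).im := hz i
  have h3 : rayVec Fan C i = (rayGen Fan C i : RealSpace r) := rfl
  rw [h3] at h2
  have := Real.pi_pos
  nlinarith

theorem hasSum_coneSummand_iff (deg : N → ℂ) (C : Set (RealSpace r)) (τ : ℂ) (m : ComplexDual r)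
    (S : ℂ) : HasSum (fun n : {n : N // (n : RealSpace r) ∈ C} => coneSummand deg τ m n.1) S ↔
      HasSum (fun n : N => coneWeight deg C n * latticeChar τ m (Multiplicative.ofAdd n)) S := by
  have h := hasSum_subtype_iff_indicator (f := coneSummand deg τ m) (a := S)
    (s := {n : N | (n : RealSpace r) ∈ C})
  refine h.trans ?_
  have e : {n : N | (n : RealSpace r) ∈ C}.indicator (coneSummand deg τ m) =
      fun n : N => coneWeight deg C n * latticeChar τ m (Multiplicative.ofAdd n) := by
    ext n
    by_cases hn : n ∈ {n : N | (n : RealSpace r) ∈ C}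
    · rw [Set.indicator_of_mem hn, coneWeight, Set.indicator_of_mem hn, coneSummand_eq]
    · rw [Set.indicator_of_notMem hn, coneWeight, Set.indicator_of_notMem hn, zero_mul]
  rw [e]

variable [DiscreteTopology N] [IsZLattice ℝ N]

/-- Writing n as a nonnegative combination of the rays gives Im(τ m·n) ≥ ε‖n‖ on C with one ε for
all n, while the weights have norm 1 because deg is real. -/
theorem summable_coneWeight {deg : N → ℂ} (hreal : ∀ n, (deg n).im = 0)
    {C : Set (RealSpace r)} (hC : C ∈ Fan.cones) {z : ℂ × ComplexDual r}
    (hz : z ∈ convRegion Fan C) :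
    Summable fun n : N => coneWeight deg C n *
      latticeChar z.1 z.2 (Multiplicative.ofAdd n) := by
  obtain ⟨ε, hε, hle⟩ := exists_pos_mul_le (fun i => (z.1 * z.2 (rayVec Fan C i)).im)
    (fun i => ‖rayVec Fan C i‖) hz fun i => norm_nonneg _
  refine Summable.of_norm_bounded
    (summable_exp_neg_norm N (ε := 2 * Real.pi * ε) (by positivity)) fun n => ?_
  by_cases hn : (n : RealSpace r) ∈ C
  · rw [norm_mul, coneWeight, Set.indicator_of_mem (by exact hn), norm_weight hreal, one_mul,
      norm_latticeChar, Real.exp_le_exp, neg_le_neg_iff, mul_assoc]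
    refine mul_le_mul_of_nonneg_left ?_ (by positivity)
    have hn' := hn
    rw [← coneHull_rayVec Fan hC] at hn'
    obtain ⟨c, hc, hcn⟩ := hn'
    rw [← hcn]
    have e1 : (z.1 * z.2 (∑ i, c i • rayVec Fan C i)).im =
        ∑ i, c i * (z.1 * z.2 (rayVec Fan C i)).im := by
      rw [map_sum, Finset.mul_sum, Complex.im_sum]
      refine Finset.sum_congr rfl fun i _ => ?_
      rw [map_smul, mul_smul_comm, Complex.smul_im, smul_eq_mul]
    rw [e1]
    refine (mul_le_mul_of_nonneg_left (norm_sum_le _ _) hε.le).trans ?_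
    rw [Finset.mul_sum]
    refine Finset.sum_le_sum fun i _ => ?_
    rw [norm_smul, Real.norm_eq_abs, abs_of_nonneg (hc i), mul_left_comm]
    exact mul_le_mul_of_nonneg_left (hle i) (hc i)
  · rw [coneWeight, Set.indicator_of_notMem (by exact hn), zero_mul, norm_zero]
    positivity

/-- `IsRayGenerator` does not demand a nonzero vector. However, a one-dimensional cone has a nonzero
lattice point, which cannot be a multiple of 0. -/
theorem rayVec_ne_zero {C : Set (RealSpace r)} (i : coneRays Fan C) : rayVec Fan C i ≠ 0 := by
  obtain ⟨F, hF, hFC, hd⟩ := i.2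
  intro h0
  have hF0 : F ≠ {0} := by
    rintro rfl
    have := hd.1
    rw [coneDim, Submodule.span_zero_singleton, finrank_bot] at this
    exact zero_ne_one this
  obtain ⟨G, hG, hGF, z, hz, hz0, hray⟩ := CompleteFan.exists_minimal_ray hF hF0
  obtain ⟨d, -, hdG, hd0⟩ := CompleteFan.exists_rayGenerator hG hz hz0 hray
  obtain ⟨k, hk⟩ := (hd.2 d).mp (hGF hdG)
  have hi : i.1 = 0 := Subtype.ext h0
  rw [hi, smul_zero] at hk
  exact hd0 (by rw [hk]; rfl)

/-- A functional that is positive on the rays of `C`. -/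
theorem exists_pos_functional {C : Set (RealSpace r)} (hC : C ∈ Fan.cones) :
    ∃ u : RealSpace r →L[ℝ] ℝ, ∀ i : coneRays Fan C, 0 < u (rayVec Fan C i) := by
  refine ⟨∑ m ∈ facetForms Fan C, m, fun i => ?_⟩
  have hmem := rayVec_mem Fan i
  rw [sum_apply]
  have hnn := (mem_cone_iff hC _).mp hmem
  by_contra hcon
  have h0 : ∑ m ∈ facetForms Fan C, m (rayVec Fan C i) = 0 :=
    le_antisymm (not_lt.mp hcon) (Finset.sum_nonneg hnn)
  have h1 := (Finset.sum_eq_zero_iff_of_nonneg hnn).mp h0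
  refine rayVec_ne_zero i ((Fan.rational C hC).2 _ hmem ((mem_cone_iff hC _).mpr fun m hm => ?_))
  rw [map_neg, h1 m hm, neg_zero]

/-- Every regular point is joined to the region of convergence within the regular region. -/
theorem exists_connected_to_convRegion {deg : N → ℂ} (hreal : ∀ n, (deg n).im = 0)
    {C : Set (RealSpace r)} (hC : C ∈ Fan.cones) {z : ℂ × ComplexDual r}
    (hz : z ∈ regularRegion Fan deg C) :
    ((connectedComponentIn (regularRegion Fan deg C) z) ∩ convRegion Fan C).Nonempty := by
  obtain ⟨u, hu⟩ := exists_pos_functional hC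
  have hτ0 : z.1 ≠ 0 := by
    intro h
    have := hz.1
    rw [h] at this
    simp at this
  -- A complex line through z with τ fixed. Its non-regular parameters are the countable set `Z`, so
  -- the regular ones are path connected, and the parameter `I * δ⁻¹ / τ` reaches the region of
  -- convergence.
  let f : ℂ → ℂ × ComplexDual r := fun t => (z.1, z.2 + t • toComplexDual u)
  have hf : Continuous f := by fun_prop
  have hfx : ∀ t (i : coneRays Fan C), (f t).1 * (f t).2 (rayVec Fan C i) =
      z.1 * z.2 (rayVec Fan C i) + z.1 * (t * (u (rayVec Fan C i) : ℂ)) := by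
    intro t i
    simp only [f, add_apply, mul_add]
    rfl
  let Z : Set ℂ := ⋃ i : coneRays Fan C, Set.range fun k : ℤ =>
    (k - deg (rayGen Fan C i) - z.1 * z.2 (rayVec Fan C i)) / (z.1 * (u (rayVec Fan C i) : ℂ))
  have hZc : Z.Countable := Set.countable_iUnion fun i => Set.countable_range _
  have hmem : ∀ t, t ∉ Z → f t ∈ regularRegion Fan deg C := by
    intro t ht
    refine ⟨hz.1, fun i h => ht (Set.mem_iUnion.mpr ⟨i, ?_⟩)⟩
    rw [weight, latticeChar_apply, ← Complex.exp_add, Complex.exp_eq_one_iff] at h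
    obtain ⟨k, hk⟩ := h
    have e : ((rayGen Fan C i : N) : RealSpace r) = rayVec Fan C i := rfl
    rw [e, hfx, ← mul_add, mul_comm] at hk
    have h2 := mul_right_cancel₀ Complex.two_pi_I_ne_zero hk
    refine ⟨k, ?_⟩
    have hu0 : (u (rayVec Fan C i) : ℂ) ≠ 0 := by exact_mod_cast (hu i).ne'
    rw [div_eq_iff (mul_ne_zero hτ0 hu0)]
    linear_combination -h2
  have hbad : ∀ t ∈ Z, f t ∉ regularRegion Fan deg C := by
    intro t h hreg
    obtain ⟨i, k, hk⟩ := Set.mem_iUnion.mp h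
    refine hreg.2 i ?_
    have hu0 : (u (rayVec Fan C i) : ℂ) ≠ 0 := by exact_mod_cast (hu i).ne'
    rw [div_eq_iff (mul_ne_zero hτ0 hu0)] at hk
    rw [weight, latticeChar_apply, ← Complex.exp_add, Complex.exp_eq_one_iff]
    refine ⟨k, ?_⟩
    have e : ((rayGen Fan C i : N) : RealSpace r) = rayVec Fan C i := rfl
    rw [e, hfx]
    linear_combination -(2 * Real.pi * Complex.I) * hk
  have hf0 : f 0 = z := Prod.ext rfl (ContinuousLinearMap.ext fun x => by
    change z.2 x + (0 : ℂ) * (u x : ℂ) = z.2 x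
    rw [zero_mul, add_zero])
  obtain ⟨δ, hδ, hle⟩ := exists_pos_mul_le (fun i => u (rayVec Fan C i))
    (fun i => |(z.1 * z.2 (rayVec Fan C i)).im| + 1) hu fun i => by positivity
  have hconv : f (Complex.I * (δ⁻¹ : ℝ) / z.1) ∈ convRegion Fan C := by
    intro i
    rw [hfx]
    have e : z.1 * (Complex.I * (δ⁻¹ : ℝ) / z.1 * (u (rayVec Fan C i) : ℂ)) =
        ((δ⁻¹ * u (rayVec Fan C i) : ℝ) : ℂ) * Complex.I := by
      push_cast
      field_simp
    rw [e, Complex.add_im, Complex.im_ofReal_mul, Complex.I_im, mul_one]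
    have h1 : |(z.1 * z.2 (rayVec Fan C i)).im| + 1 ≤ δ⁻¹ * u (rayVec Fan C i) := by
      rw [le_inv_mul_iff₀ hδ]
      exact hle i
    linarith [neg_abs_le (z.1 * z.2 (rayVec Fan C i)).im]
  have hZ0 : (0 : ℂ) ∉ Z := fun h => hbad 0 h (hf0 ▸ hz)
  have hZ1 : Complex.I * (δ⁻¹ : ℝ) / z.1 ∉ Z := fun h =>
    hbad _ h (mem_regularRegion_of_convRegion hreal hconv hz.1)
  have hconn : IsPreconnected (f '' Zᶜ) :=
    ((hZc.isPathConnected_compl_of_one_lt_rank (by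
      rw [Complex.rank_real_complex]; norm_num)).isConnected.image f
        hf.continuousOn).isPreconnected
  have hsub : f '' Zᶜ ⊆ connectedComponentIn (regularRegion Fan deg C) z :=
    hconn.subset_connectedComponentIn ⟨0, hZ0, hf0⟩ (by
      rintro _ ⟨t, ht, rfl⟩
      exact hmem t ht)
  exact ⟨_, hsub ⟨_, hZ1, rfl⟩, hconv⟩

/-- At a regular point the analytic continuation exists, is unique, and is the regularised value
of the series. -/
theorem isContinuationValue_iff {deg : N → ℂ} (hdeg : IsDegreeFunction Fan deg)
    (hreal : ∀ n, (deg n).im = 0) {C : Set (RealSpace r)} (hC : C ∈ Fan.cones)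
    {τ : ℂ} {m : ComplexDual r} (hz : (τ, m) ∈ regularRegion Fan deg C) {v : ℂ}
    (hv : IsReg (latticeChar τ m) (coneWeight deg C) v) (v' : ℂ) :
    IsContinuationValue deg C τ m v' ↔ v' = v := by
  obtain ⟨h, hh⟩ := exists_convAct_coneWeight hdeg hC
  set g := rayPoly (rayGen Fan C) (weight deg) Finset.univ with hg
  have hg0 := evalChar_rayPoly_ne_zero hz
  rw [← hg] at hg0
  have hval : evalChar (latticeChar τ m) h = v * evalChar (latticeChar τ m) g := by
    have h1 : IsReg (latticeChar τ m) (coneWeight deg C)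
        (evalChar (latticeChar τ m) h / evalChar (latticeChar τ m) g) :=
      ⟨g, h, hh, hg0, (div_mul_cancel₀ _ hg0).symm⟩
    rw [← h1.unique hv, div_mul_cancel₀ _ hg0]
  constructor
  · rintro ⟨U, V, F, hUo, hUc, hUτ, hmem, hF, hVo, ⟨z₀, hz₀⟩, hVU, hsum, rfl⟩
    -- With denominators cleared, the identity theorem gives g F = h on all of `U`, even where `U`
    -- crosses zeros of g; only at (τ, m) is division needed.
    have hA : AnalyticOnNhd ℂ (fun z => evalChar (latticeChar z.1 z.2) g * F z) U :=
      fun z hzU => (analyticAt_evalChar g z).mul (hF z hzU)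
    have hB : AnalyticOnNhd ℂ (fun z => evalChar (latticeChar z.1 z.2) h) U :=
      fun z _ => analyticAt_evalChar h z
    have hE := hA.eqOn_of_preconnected_of_eventuallyEq hB hUc (hVU hz₀) (by
      filter_upwards [hVo.mem_nhds hz₀] with z hzV
      exact (evalChar_eq_of_hasSum ((hasSum_coneSummand_iff deg C z.1 z.2 _).mp (hsum z hzV))
        hh).symm)
    have h2 := hE hmem
    simp only at h2
    rw [hval, mul_comm] at h2
    exact mul_right_cancel₀ hg0 h2
  · rintro rfl
    obtain ⟨z₀, hz₀, hz₀c⟩ := exists_connected_to_convRegion hreal hC hz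
    have hUo : IsOpen (connectedComponentIn (regularRegion Fan deg C) (τ, m)) :=
      (isOpen_regularRegion deg C).connectedComponentIn
    have hsub := connectedComponentIn_subset (regularRegion Fan deg C) (τ, m)
    refine ⟨connectedComponentIn (regularRegion Fan deg C) (τ, m),
      connectedComponentIn (regularRegion Fan deg C) (τ, m) ∩ convRegion Fan C,
      fun z => evalChar (latticeChar z.1 z.2) h / evalChar (latticeChar z.1 z.2) g,
      hUo, isPreconnected_connectedComponentIn, fun z hzU => (hsub hzU).1,
      mem_connectedComponentIn hz, fun z hzU => ?_, hUo.inter (isOpen_convRegion C),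
      ⟨z₀, hz₀, hz₀c⟩, Set.inter_subset_left, fun z hzV => ?_, ?_⟩
    · exact (analyticAt_evalChar h z).div (analyticAt_evalChar g z)
        (evalChar_rayPoly_ne_zero (hsub hzU))
    · rw [hasSum_coneSummand_iff]
      change HasSum _ (evalChar (latticeChar z.1 z.2) h / evalChar (latticeChar z.1 z.2) g)
      have hs := (summable_coneWeight hreal hC hzV.2).hasSum
      rw [evalChar_eq_of_hasSum hs hh, mul_div_cancel_left₀ _
        (evalChar_rayPoly_ne_zero (hsub hzV.1))]
      exact hs
    · change evalChar (latticeChar τ m) h / evalChar (latticeChar τ m) g = _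
      rw [hval, mul_div_cancel_right₀ _ hg0]

theorem coneSum_eq {deg : N → ℂ} (hdeg : IsDegreeFunction Fan deg)
    (hreal : ∀ n, (deg n).im = 0) {C : Set (RealSpace r)} (hC : C ∈ Fan.cones)
    {τ : ℂ} {m : ComplexDual r} (hz : (τ, m) ∈ regularRegion Fan deg C) {v : ℂ}
    (hv : IsReg (latticeChar τ m) (coneWeight deg C) v) : coneSum deg C τ m = v := by
  have hex : ∃ v, IsContinuationValue deg C τ m v :=
    ⟨v, (isContinuationValue_iff hdeg hreal hC hz hv v).mpr rfl⟩
  rw [coneSum, dif_pos hex]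
  exact (isContinuationValue_iff hdeg hreal hC hz hv _).mp hex.choose_spec

end Continuation

/-! ### Absolute convergence of the sum over `M`. -/

section Decay

open Filter Topology

variable {r : ℕ} {N : Submodule ℤ (RealSpace r)} {Fan : CompleteFan N}

theorem latticeChar_toComplexDual_norm (τ : ℂ) (m : RealSpace r →L[ℝ] ℝ) (n : N) :
    ‖latticeChar τ (toComplexDual m) (Multiplicative.ofAdd n)‖ =
      Real.exp (-(2 * Real.pi * τ.im * m n)) := by
  rw [norm_latticeChar]
  have : toComplexDual m (n : RealSpace r) = ((m n : ℝ) : ℂ) := rfl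
  rw [this, Complex.im_mul_ofReal]
  congr 1
  ring

/-- Lower bound for the denominators, uniform in `m ∈ M`. -/
theorem exists_denominator_bound {deg : N → ℂ} (hreal : ∀ n, (deg n).im = 0) {d : N}
    (hd : ∀ k : ℤ, deg d ≠ k) {τ : ℂ} (hτ : 0 < τ.im) :
    ∃ c : ℝ, 0 < c ∧ ∀ m : dualLattice N, c * Real.exp (-(2 * Real.pi * τ.im * min (m.1 d) 0)) ≤
      ‖1 - weight deg d * latticeChar τ (toComplexDual m.1) (Multiplicative.ofAdd d)‖ := by
  have hw : weight deg d ≠ 1 := by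
    intro h
    rw [weight, Complex.exp_eq_one_iff] at h
    obtain ⟨k, hk⟩ := h
    rw [mul_comm] at hk
    exact hd k (mul_right_cancel₀ Complex.two_pi_I_ne_zero hk)
  set ρ := 2 * Real.pi * τ.im with hρ
  have hρ0 : 0 < ρ := by positivity
  have h1 : Real.exp (-ρ) < 1 := by
    rw [Real.exp_lt_one_iff]
    linarith
  -- The integer m·d is either zero, where deg(d) ∉ ℤ supplies the first constant, or of absolute
  -- value at least 1, where |q^{m·d}| is bounded away from 1 and gives the second.
  refine ⟨min ‖1 - weight deg d‖ (1 - Real.exp (-ρ)),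
    lt_min (norm_pos_iff.mpr (sub_ne_zero.mpr hw.symm)) (by linarith), fun m => ?_⟩
  obtain ⟨k, hk⟩ := m.2 d d.2
  have hnorm : ‖weight deg d * latticeChar τ (toComplexDual m.1) (Multiplicative.ofAdd d)‖ =
      Real.exp (-(ρ * m.1 d)) := by
    rw [norm_mul, norm_weight hreal, one_mul, latticeChar_toComplexDual_norm]
  rcases lt_trichotomy k 0 with h | h | h
  · have hk1 : m.1 d ≤ -1 := by
      rw [hk]
      exact_mod_cast Int.le_sub_one_of_lt h
    rw [min_eq_left (show m.1 d ≤ 0 by linarith)]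
    have h2 := norm_sub_norm_le (weight deg d *
      latticeChar τ (toComplexDual m.1) (Multiplicative.ofAdd d)) 1
    rw [norm_sub_rev, hnorm, norm_one] at h2
    refine le_trans ?_ h2
    refine (mul_le_mul_of_nonneg_right (min_le_right _ _) (Real.exp_pos _).le).trans ?_
    rw [sub_mul, one_mul, ← Real.exp_add]
    have h3 : 1 ≤ Real.exp (-ρ + -(ρ * m.1 d)) := by
      rw [Real.one_le_exp_iff]
      nlinarith
    linarith
  · have hm : m.1 d = 0 := by rw [hk, h]; simp
    have hχ : latticeChar τ (toComplexDual m.1) (Multiplicative.ofAdd d) = 1 := by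
      rw [latticeChar_apply]
      have : toComplexDual m.1 (d : RealSpace r) = ((m.1 d : ℝ) : ℂ) := rfl
      rw [this, hm]
      simp
    rw [hχ, hm, min_self]
    simp
  · have hk1 : 1 ≤ m.1 d := by
      rw [hk]
      exact_mod_cast h
    rw [min_eq_right (show (0 : ℝ) ≤ m.1 d by linarith)]
    have h2 := norm_sub_norm_le 1 (weight deg d *
      latticeChar τ (toComplexDual m.1) (Multiplicative.ofAdd d))
    rw [hnorm, norm_one] at h2
    refine le_trans ?_ h2
    have h3 : Real.exp (-(ρ * m.1 d)) ≤ Real.exp (-ρ) := by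
      rw [Real.exp_le_exp]
      nlinarith
    simp only [mul_zero, neg_zero, Real.exp_zero, mul_one]
    exact (min_le_right _ _).trans (by linarith)

/-- The uniform lower bound for the denominators is positive, so no pole lies over a point of M. -/
theorem mem_regularRegion {deg : N → ℂ} (hdeg : IsToricData Fan deg)
    (hreal : ∀ n, (deg n).im = 0) (C : Set (RealSpace r)) {τ : ℂ} (hτ : 0 < τ.im)
    (m : dualLattice N) : (τ, toComplexDual m.1) ∈ regularRegion Fan deg C := by
  refine ⟨hτ, fun i h => ?_⟩
  obtain ⟨F, hF, -, hd⟩ := i.2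
  obtain ⟨c, hc, hle⟩ := exists_denominator_bound hreal (hdeg.2 F hF i.1 hd) hτ
  have h1 := hle m
  have h2 : weight deg i.1 *
    latticeChar τ (toComplexDual m.1) (Multiplicative.ofAdd i.1) = 1 := h
  rw [h2, sub_self, norm_zero] at h1
  exact absurd h1 (not_le.mpr (by positivity))

theorem exists_coord_bound {ι : Type*} (v : ι → RealSpace r) (B : Finset ι) :
    ∃ Q : ℝ, 0 < Q ∧ ∀ i ∈ B, ∀ x, |coord v B i x| ≤ Q * ‖x‖ := by
  refine ⟨∑ i ∈ B, ‖LinearMap.toContinuousLinearMap (coord v B i)‖ + 1, by positivity,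
    fun i hi x => ?_⟩
  have h1 := (LinearMap.toContinuousLinearMap (coord v B i)).le_opNorm x
  rw [LinearMap.coe_toContinuousLinearMap', Real.norm_eq_abs] at h1
  refine h1.trans (mul_le_mul_of_nonneg_right ?_ (norm_nonneg x))
  have := Finset.single_le_sum (f := fun i => ‖LinearMap.toContinuousLinearMap (coord v B i)‖)
    (fun j _ => norm_nonneg _) hi
  linarith

/-- If `m · ξ` is very negative, some coordinate of `ξ` in a basis has the opposite sign of the
value of `m` on the basis vector, and that value is comparable to `‖m‖`. -/
theorem exists_opposite_coord {ι : Type*} {v : ι → RealSpace r} {B : Finset ι}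
    (hB : LinearIndepOn ℝ v (B : Set ι)) (hspan : Submodule.span ℝ (v '' (B : Set ι)) = ⊤) :
    ∃ κ : ℝ, 0 < κ ∧ ∀ (m : RealSpace r →L[ℝ] ℝ) (ξ : RealSpace r), ‖ξ‖ < 1 →
      m ξ < -(‖m‖ / 2) → ∃ i ∈ B, coord v B i ξ * m (v i) < 0 ∧ κ * ‖m‖ ≤ |m (v i)| := by
  obtain ⟨Q, hQ, hcoord⟩ := exists_coord_bound v B
  -- Pigeonhole: m ξ is a sum of |B| terms, so one of them is at most -‖m‖/(2(|B| + 1)), and `Q`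
  -- bounds the coordinate of ξ in it. The extra 1 also avoids dividing by zero when `B` is empty.
  refine ⟨(2 * (B.card + 1) * Q)⁻¹, by positivity, fun m ξ hξ hm => ?_⟩
  have hm0 : 0 < ‖m‖ := by
    by_contra h0
    have : m = 0 := norm_le_zero_iff.mp (not_lt.mp h0)
    simp [this] at hm
  set δ := ‖m‖ / (2 * (B.card + 1)) with hδ
  have hδ0 : 0 < δ := by positivity
  obtain ⟨i, hi, hle⟩ : ∃ i ∈ B, coord v B i ξ * m (v i) ≤ -δ := by
    by_contra hcon
    push Not at hcon
    have e : m ξ = ∑ i ∈ B, coord v B i ξ * m (v i) := by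
      conv_lhs => rw [← sum_coord_smul hB (x := ξ) (hspan ▸ Submodule.mem_top)]
      rw [map_sum]
      exact Finset.sum_congr rfl fun i _ => by rw [map_smul, smul_eq_mul]
    have h1 := Finset.card_nsmul_le_sum B (fun i => coord v B i ξ * m (v i)) (-δ)
      fun i hi => (hcon i hi).le
    rw [← e, nsmul_eq_mul] at h1
    have h2 : (B.card + 1) * δ = ‖m‖ / 2 := by
      rw [hδ]
      field_simp
    linarith
  refine ⟨i, hi, by linarith, ?_⟩
  have h1 : δ ≤ |coord v B i ξ| * |m (v i)| := by
    rw [← abs_mul]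
    have := neg_abs_le (coord v B i ξ * m (v i))
    linarith
  have h2 : |coord v B i ξ| ≤ Q :=
    (hcoord i hi ξ).trans (mul_le_of_le_one_right hQ.le hξ.le)
  have h3 : δ ≤ Q * |m (v i)| := h1.trans (mul_le_mul_of_nonneg_right h2 (abs_nonneg _))
  rw [mul_inv, mul_right_comm, ← div_eq_inv_mul, ← div_eq_mul_inv, ← hδ, div_le_iff₀ hQ]
  linarith

/-- By definition of the operator norm the two inequalities define a nonempty open set, and generic
vectors meet every such set. -/
theorem exists_generic_direction (Fan : CompleteFan N) {m : RealSpace r →L[ℝ] ℝ} (hm : m ≠ 0) :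
    ∃ ξ, (‖ξ‖ < 1 ∧ m ξ < -(‖m‖ / 2)) ∧ IsFanGeneric Fan ξ := by
  have hopen : IsOpen {ξ : RealSpace r | ‖ξ‖ < 1 ∧ m ξ < -(‖m‖ / 2)} :=
    (isOpen_lt continuous_norm continuous_const).inter (isOpen_lt m.continuous continuous_const)
  have hm0 : 0 < ‖m‖ := norm_pos_iff.mpr hm
  obtain ⟨x, hx, hmx⟩ := m.exists_lt_apply_of_lt_opNorm (half_lt_self hm0)
  rw [Real.norm_eq_abs] at hmx
  rcases abs_cases (m x) with ⟨h1, -⟩ | ⟨h1, -⟩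
  · exact exists_isFanGeneric hopen (u := -x) ⟨by rwa [norm_neg], by
      rw [map_neg]
      linarith⟩
  · exact exists_isFanGeneric hopen (u := x) ⟨hx, by linarith⟩

variable [DiscreteTopology N] [IsZLattice ℝ N]

/-- For a basis b of N, the map m ↦ ∑ m(b_i) b_i embeds M in N and increases norms by at most a
constant factor, which reduces the claim to N. -/
theorem summable_exp_neg_norm_dualLattice (N : Submodule ℤ (RealSpace r)) [DiscreteTopology N]
    [IsZLattice ℝ N] {ε : ℝ} (hε : 0 < ε) :
    Summable fun m : dualLattice N => Real.exp (-(ε * ‖m.1‖)) := by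
  have : Module.Free ℤ N := ZLattice.module_free ℝ N
  have : Module.Finite ℤ N := ZLattice.module_finite ℝ N
  let b₀ := Module.Free.chooseBasis ℤ N
  let b := b₀.ofZLatticeBasis ℝ N
  have hb : ∀ i, b i = (b₀ i : RealSpace r) := fun i => Module.Basis.ofZLatticeBasis_apply ℝ N b₀ i
  choose k hk using fun (m : dualLattice N) i => m.2 (b₀ i) (b₀ i).2
  let φ : dualLattice N → N := fun m => ∑ i, k m i • b₀ i
  have hφ : Function.Injective φ := by
    intro m m' h
    have h1 : ∀ i, k m i = k m' i := by
      intro i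
      have h2 : ∀ m, b₀.repr (φ m) i = k m i := by
        intro m
        rw [← b₀.equivFun_apply]
        simp only [φ]
        rw [← b₀.equivFun_symm_apply, LinearEquiv.apply_symm_apply]
      rw [← h2, ← h2, h]
    apply Subtype.ext
    apply ContinuousLinearMap.coe_injective
    refine b.ext fun i => ?_
    change m.1 (b i) = m'.1 (b i)
    rw [hb, hk, hk, h1]
  set D := ∑ i, ‖b i‖ * ‖b i‖ + 1 with hD
  have hD0 : 0 < D := by
    have := Finset.sum_nonneg fun i (_ : i ∈ Finset.univ) => mul_self_nonneg ‖b i‖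
    linarith
  have hle : ∀ m, ‖(φ m : RealSpace r)‖ ≤ D * ‖m.1‖ := by
    intro m
    have e : (φ m : RealSpace r) = ∑ i, m.1 (b i) • b i := by
      simp only [φ, Submodule.coe_sum, Submodule.coe_smul_of_tower]
      refine Finset.sum_congr rfl fun i _ => ?_
      rw [hb, hk, Int.cast_smul_eq_zsmul]
    rw [e]
    refine (norm_sum_le _ _).trans ?_
    rw [hD, add_mul, Finset.sum_mul, one_mul]
    refine le_trans ?_ (le_add_of_nonneg_right (norm_nonneg _))
    refine Finset.sum_le_sum fun i _ => ?_
    rw [norm_smul, mul_right_comm, mul_comm ‖b i‖ ‖m.1‖]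
    exact mul_le_mul_of_nonneg_right (m.1.le_opNorm _) (norm_nonneg _)
  refine Summable.of_norm_bounded
    ((summable_exp_neg_norm N (ε := ε / D) (by positivity)).comp_injective hφ) fun m => ?_
  rw [Real.norm_eq_abs, Real.abs_exp, Function.comp_apply, Real.exp_le_exp, neg_le_neg_iff,
    div_mul_eq_mul_div, div_le_iff₀ hD0, mul_assoc]
  refine mul_le_mul_of_nonneg_left ?_ hε.le
  rw [mul_comm]
  exact hle m

/-- The regularised series of a half-open simplicial cone decays exponentially in `m`, provided
that `m` is sufficiently negative on the direction `ξ`. -/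
theorem exists_simplexPart_bound {deg : N → ℂ} (hdeg : IsToricData Fan deg)
    (hreal : ∀ n, (deg n).im = 0) {τ : ℂ} (hτ : 0 < τ.im) {C : Set (RealSpace r)}
    (hC : C ∈ topCones Fan) {B : Finset (coneRays Fan C)} (hB : B ∈ triangulation Fan C)
    (J : Finset (coneRays Fan C)) :
    ∃ b : dualLattice N → ℝ, Summable b ∧ (∀ m, 0 ≤ b m) ∧
      ∀ (m : dualLattice N) (ξ : RealSpace r) (v : ℂ), ‖ξ‖ < 1 → m.1 ξ < -(‖m.1‖ / 2) →
        negSet (rayVec Fan C) B ξ = J →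
        IsReg (latticeChar τ (toComplexDual m.1)) (coneWeight deg (simplexPart Fan C ξ B)) v →
        ‖v‖ ≤ b m := by
  classical
  obtain ⟨hBi, hBs⟩ := triangulation_spec.1 B hB
  have hCm := mem_topCones.mp hC
  rw [span_rayVec Fan hCm.1, hCm.2] at hBs
  obtain ⟨κ, hκ, hopp⟩ := exists_opposite_coord hBi hBs
  have hden : ∀ i : coneRays Fan C, ∃ c : ℝ, 0 < c ∧ ∀ m : dualLattice N,
      c * Real.exp (-(2 * Real.pi * τ.im * min (m.1 (rayVec Fan C i)) 0)) ≤
      ‖1 - weight deg (rayGen Fan C i) *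
        latticeChar τ (toComplexDual m.1) (Multiplicative.ofAdd (rayGen Fan C i))‖ := by
    intro i
    obtain ⟨F, hF, -, hd⟩ := i.2
    exact exists_denominator_bound hreal (hdeg.2 F hF i.1 hd) hτ
  choose c hc hcle using hden
  obtain ⟨Λ, hΛ⟩ := hdeg.1.exists_character hCm.1
  set ρ := 2 * Real.pi * τ.im with hρ
  have hρ0 : 0 < ρ := by positivity
  set box := (finite_box (rayGen Fan C) J hBi).toFinset with hbox
  let t : N → coneRays Fan C → ℝ := fun s i => coord (rayVec Fan C) B i (s : RealSpace r)
  -- The distance of the i-th coordinate of a box point from the excluded end of its interval (0,1]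
  -- or [0,1); positive on the finite box.
  let η : N → coneRays Fan C → ℝ := fun s i => if i ∈ J then t s i else 1 - t s i
  have ht : ∀ s ∈ box, ∀ i ∈ B, 0 ≤ t s i ∧ t s i ≤ 1 ∧ 0 < η s i := by
    intro s hs i hi
    have h := ((finite_box (rayGen Fan C) J hBi).mem_toFinset.mp hs).2 i hi
    refine ⟨h.1, (h.2.2 hi).1, ?_⟩
    by_cases hJ : i ∈ J
    · simp only [η, hJ, if_true]
      exact h.2.1 hJ
    · simp only [η, hJ, if_false]
      have := (h.2.2 hi).2 hJ
      exact sub_pos.mpr this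
  set K := (∏ i ∈ B, c i)⁻¹ with hK
  have hK0 : 0 < K := inv_pos.mpr (Finset.prod_pos fun i _ => hc i)
  refine ⟨fun m => K * ∑ s ∈ box, ∑ i ∈ B, Real.exp (-(ρ * η s i * κ * ‖m.1‖)), ?_, ?_, ?_⟩
  · refine Summable.mul_left K (summable_sum fun s hs => summable_sum fun i hi => ?_)
    have := (ht s hs i hi).2.2
    exact summable_exp_neg_norm_dualLattice N (by positivity)
  · intro m
    positivity
  · intro m ξ v hξ hmξ hJ hv
    have hv' := isReg_conePart (d := rayGen Fan C) J hBi (weight deg) Λ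
      (fun n hn => hΛ n (conePart_subset_cone hCm.1 hB _ hn))
      (latticeChar τ (toComplexDual m.1))
      (fun i _ => (mem_regularRegion hdeg hreal C hτ m).2 i)
    rw [simplexPart, hJ] at hv
    rw [hv.unique hv', norm_div, norm_prod]
    have hdenle : (∏ i ∈ B, c i) * ∏ i ∈ B, Real.exp (-(ρ * min (m.1 (rayVec Fan C i)) 0)) ≤
        ∏ i ∈ B, ‖1 - weight deg (rayGen Fan C i) *
          latticeChar τ (toComplexDual m.1) (Multiplicative.ofAdd (rayGen Fan C i))‖ := by
      rw [← Finset.prod_mul_distrib]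
      exact Finset.prod_le_prod (fun i _ => by have := hc i; positivity) fun i _ => hcle i m
    rw [← Real.exp_sum, Finset.sum_neg_distrib] at hdenle
    have hc0 : 0 < ∏ i ∈ B, c i := Finset.prod_pos fun i _ => hc i
    have hpos : 0 < (∏ i ∈ B, c i) * Real.exp (-∑ i ∈ B, ρ * min (m.1 (rayVec Fan C i)) 0) := by
      positivity
    rw [div_le_iff₀ (hpos.trans_le hdenle)]
    refine le_trans ?_ (mul_le_mul_of_nonneg_left hdenle (by positivity))
    have hKc : ∀ X Y : ℝ, K * X * ((∏ i ∈ B, c i) * Y) = X * Y := by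
      intro X Y
      rw [hK]
      field_simp
    rw [hKc, Finset.sum_mul]
    refine (norm_sum_le _ _).trans (Finset.sum_le_sum fun s hs => ?_)
    obtain ⟨i, hi, hneg, hlarge⟩ := hopp m.1 ξ hξ hmξ
    rw [norm_mul, norm_weight hreal, one_mul, latticeChar_toComplexDual_norm]
    refine le_trans ?_ (mul_le_mul_of_nonneg_right
      (Finset.single_le_sum (f := fun i => Real.exp (-(ρ * η s i * κ * ‖m.1‖)))
        (fun j _ => (Real.exp_pos _).le) hi) (Real.exp_pos _).le)
    rw [← Real.exp_add, Real.exp_le_exp]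
    have es : m.1 (s : RealSpace r) = ∑ j ∈ B, t s j * m.1 (rayVec Fan C j) := by
      conv_lhs => rw [← sum_coord_smul hBi (x := (s : RealSpace r)) (hBs ▸ Submodule.mem_top)]
      rw [map_sum]
      exact Finset.sum_congr rfl fun j _ => by rw [map_smul, smul_eq_mul]
    -- After division by the denominator bound, the exponent is -ρ times the sum of these terms,
    -- each nonnegative because 0 ≤ t ≤ 1.
    have hterm : ∀ j ∈ B, 0 ≤ t s j * m.1 (rayVec Fan C j) - min (m.1 (rayVec Fan C j)) 0 := by
      intro j hj
      obtain ⟨h0, h1, -⟩ := ht s hs j hj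
      rcases le_total (m.1 (rayVec Fan C j)) 0 with h | h
      · rw [min_eq_left h]
        nlinarith
      · rw [min_eq_right h]
        nlinarith
    -- At the index where m and ξ have opposite signs, the excluded end of the interval is precisely
    -- the one at which the term would vanish, so the term is at least η |m·d_i|.
    have hi' : η s i * |m.1 (rayVec Fan C i)| ≤
        t s i * m.1 (rayVec Fan C i) - min (m.1 (rayVec Fan C i)) 0 := by
      by_cases hiJ : i ∈ J
      · have hξi : coord (rayVec Fan C) B i ξ < 0 := by
          rw [← hJ, negSet, Finset.mem_filter] at hiJ
          exact hiJ.2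
        have ha : 0 < m.1 (rayVec Fan C i) := by
          by_contra hcon
          nlinarith [mul_nonneg_of_nonpos_of_nonpos hξi.le (not_lt.mp hcon)]
        simp only [η, hiJ, if_true]
        rw [abs_of_pos ha, min_eq_right ha.le, sub_zero]
      · have hξi : 0 ≤ coord (rayVec Fan C) B i ξ := by
          rw [← hJ, negSet, Finset.mem_filter, not_and] at hiJ
          exact not_lt.mp (hiJ hi)
        have ha : m.1 (rayVec Fan C i) < 0 := by
          by_contra hcon
          nlinarith [mul_nonneg hξi (not_lt.mp hcon)]
        simp only [η, hiJ, if_false]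
        rw [abs_of_neg ha, min_eq_left ha.le]
        linarith
    have hsum : η s i * |m.1 (rayVec Fan C i)| ≤ m.1 (s : RealSpace r) -
        ∑ j ∈ B, min (m.1 (rayVec Fan C j)) 0 := by
      rw [es, ← Finset.sum_sub_distrib]
      exact hi'.trans (Finset.single_le_sum
        (f := fun j => t s j * m.1 (rayVec Fan C j) - min (m.1 (rayVec Fan C j)) 0) hterm hi)
    have hη := (ht s hs i hi).2.2
    have h5 : η s i * (κ * ‖m.1‖) ≤ η s i * |m.1 (rayVec Fan C i)| :=
      mul_le_mul_of_nonneg_left hlarge hη.le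
    have h6 := mul_le_mul_of_nonneg_left (h5.trans hsum) hρ0.le
    rw [← Finset.mul_sum]
    linarith

theorem isReg_coneWeight_coneSum {deg : N → ℂ} (hdeg : IsToricData Fan deg)
    (hreal : ∀ n, (deg n).im = 0) {τ : ℂ} (hτ : 0 < τ.im) (m : dualLattice N)
    {C : Set (RealSpace r)} (hC : C ∈ Fan.cones) :
    IsReg (latticeChar τ (toComplexDual m.1)) (coneWeight deg C)
      (coneSum deg C τ (toComplexDual m.1)) := by
  have hz := mem_regularRegion hdeg hreal C hτ m
  obtain ⟨v, hv⟩ := exists_isReg_coneWeight hdeg.1 hC hz.2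
  rwa [coneSum_eq hdeg.1 hreal hC hz hv]

/-- This frees the alternating sum from the original cones: by uniqueness, any decomposition of the
weighted lattice computes it. -/
theorem isReg_weight_fanSum {deg : N → ℂ} (hdeg : IsToricData Fan deg)
    (hreal : ∀ n, (deg n).im = 0) {τ : ℂ} (hτ : 0 < τ.im) (m : dualLattice N) :
    IsReg (latticeChar τ (toComplexDual m.1)) (weight deg) (fanSum Fan deg τ m) := by
  have h := IsReg.sum Fan.cones fun C hC =>
    (isReg_coneWeight_coneSum hdeg hreal hτ m hC).smul ((-1 : ℂ) ^ (r - coneDim C))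
  rwa [sum_sign_smul_coneWeight] at h

/-- Absolute convergence of the sum over `M`. -/
theorem summable_fanSum {deg : N → ℂ} (hdeg : IsToricData Fan deg)
    (hreal : ∀ n, (deg n).im = 0) {τ : ℂ} (hτ : 0 < τ.im) :
    Summable fun m : dualLattice N => fanSum Fan deg τ m := by
  classical
  -- The direction ξ will depend on m, but it enters the bounds only through the finite set `J` of
  -- removed facets; summing over all `J` gives a majorant independent of ξ.
  have hb := fun (C : topCones Fan) (B : triangulation Fan C.1) (J : Finset (coneRays Fan C.1)) =>
    exists_simplexPart_bound hdeg hreal hτ C.2 B.2 J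
  choose b hbs hb0 hble using hb
  refine Summable.of_norm_bounded_eventually
    (g := fun m => ∑ C : topCones Fan, ∑ B : triangulation Fan C.1,
      ∑ J : Finset (coneRays Fan C.1), b C B J m) ?_ ?_
  · exact summable_sum fun C _ => summable_sum fun B _ => summable_sum fun J _ => hbs C B J
  have h0 : ∀ᶠ m : dualLattice N in cofinite, m ≠ 0 :=
    (Set.finite_singleton (0 : dualLattice N)).compl_mem_cofinite
  filter_upwards [h0] with m hm
  have hm' : m.1 ≠ 0 := fun h => hm (Subtype.ext h)
  obtain ⟨ξ, ⟨hξ1, hξ2⟩, hξg⟩ := exists_generic_direction Fan hm'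
  have hex : ∀ (C : topCones Fan) (B : triangulation Fan C.1), ∃ v,
      IsReg (latticeChar τ (toComplexDual m.1)) (coneWeight deg (simplexPart Fan C.1 ξ B.1)) v := by
    intro C B
    have hCm := mem_topCones.mp C.2
    obtain ⟨Λ, hΛ⟩ := hdeg.1.exists_character hCm.1
    exact ⟨_, isReg_conePart (d := rayGen Fan C.1) _ (triangulation_spec.1 B.1 B.2).1 (weight deg) Λ
      (fun n hn => hΛ n (conePart_subset_cone hCm.1 B.2 _ hn))
      (latticeChar τ (toComplexDual m.1))
      (fun i _ => (mem_regularRegion hdeg hreal C.1 hτ m).2 i)⟩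
  choose v hv using hex
  have hsum : IsReg (latticeChar τ (toComplexDual m.1)) (weight deg)
      (∑ C : topCones Fan, ∑ B : triangulation Fan C.1, v C B) := by
    have h := IsReg.sum Finset.univ fun (C : topCones Fan) _ =>
      IsReg.sum Finset.univ fun (B : triangulation Fan C.1) _ => hv C B
    have e : ∑ C : topCones Fan, ∑ B : triangulation Fan C.1,
        coneWeight deg (simplexPart Fan C.1 ξ B.1) = weight deg := by
      rw [weight_eq_sum_simplexPart hξg deg, ← Finset.sum_coe_sort (topCones Fan)]
      refine Finset.sum_congr rfl fun C _ => ?_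
      rw [← Finset.sum_coe_sort (triangulation Fan C.1)]
    rwa [e] at h
  rw [(isReg_weight_fanSum hdeg hreal hτ m).unique hsum]
  refine (norm_sum_le _ _).trans (Finset.sum_le_sum fun C _ => ?_)
  refine (norm_sum_le _ _).trans (Finset.sum_le_sum fun B _ => ?_)
  refine (hble C B (negSet (rayVec Fan C.1) B.1 ξ) m ξ (v C B) hξ1 hξ2 rfl (hv C B)).trans ?_
  exact Finset.single_le_sum (f := fun J => b C B J m) (fun J _ => hb0 C B J m)
    (Finset.mem_univ _)

theorem isWellDefined {deg : N → ℂ} (hdeg : IsToricData Fan deg)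
    (hreal : ∀ n, (deg n).im = 0) : IsWellDefined Fan deg := by
  intro τ
  refine ⟨fun C hC m => ?_, summable_fanSum hdeg hreal τ.im_pos⟩
  have hz := mem_regularRegion hdeg hreal C τ.im_pos m
  obtain ⟨v, hv⟩ := exists_isReg_coneWeight hdeg.1 hC hz.2
  have hiff := isContinuationValue_iff hdeg.1 hreal hC hz hv
  exact ⟨v, (hiff v).mpr rfl, fun v' hv' => (hiff v').mp hv'⟩

end Decay

/-! ### Averaging over residue classes and the substitution τ ↦ pτ. -/

section Scaling

variable {r : ℕ} {N : Submodule ℤ (RealSpace r)} {Fan : CompleteFan N}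

section DualLattice

theorem exists_dualLattice_equiv (N : Submodule ℤ (RealSpace r)) [DiscreteTopology N]
    [IsZLattice ℝ N] : ∃ (e : dualLattice N ≃+ (Fin r → ℤ)) (b : Module.Basis (Fin r) ℤ N),
      ∀ (m : dualLattice N) i, m.1 (b i) = e m i := by
  have : Module.Free ℤ N := ZLattice.module_free ℝ N
  have : Module.Finite ℤ N := ZLattice.module_finite ℝ N
  have hrank : Module.finrank ℤ N = r := by
    rw [ZLattice.rank ℝ N]
    simp
  let b := Module.finBasisOfFinrankEq ℤ N hrank
  let b' := b.ofZLatticeBasis ℝ N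
  have hb : ∀ i, b' i = (b i : RealSpace r) := fun i => Module.Basis.ofZLatticeBasis_apply ℝ N b i
  choose k hk using fun (m : dualLattice N) i => m.2 (b i) (b i).2
  have hsurj : ∀ a : Fin r → ℤ, ∃ m : dualLattice N, ∀ i, m.1 (b i) = a i := by
    intro a
    let L : RealSpace r →L[ℝ] ℝ :=
      LinearMap.toContinuousLinearMap (b'.constr ℝ fun i => (a i : ℝ))
    have hL : ∀ i, L (b i) = a i := by
      intro i
      rw [← hb, LinearMap.coe_toContinuousLinearMap', Module.Basis.constr_basis]
    refine ⟨⟨L, fun n hn => ⟨∑ i, b.repr ⟨n, hn⟩ i * a i, ?_⟩⟩, hL⟩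
    have h1 := congrArg Subtype.val (b.sum_repr ⟨n, hn⟩)
    simp only [Submodule.coe_sum, Submodule.coe_smul_of_tower] at h1
    conv_lhs => rw [← h1]
    rw [map_sum]
    push_cast
    exact Finset.sum_congr rfl fun i _ => by
      rw [map_zsmul, hL, zsmul_eq_mul]
  let K : dualLattice N →+ (Fin r → ℤ) := AddMonoidHom.mk' k <| by
    intro m m'
    ext i
    have h1 := hk (m + m') i
    have h2 : (m + m').1 (b i : RealSpace r) = m.1 (b i) + m'.1 (b i) := rfl
    rw [h2, hk, hk] at h1
    exact_mod_cast h1.symm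
  refine ⟨AddEquiv.ofBijective K ⟨fun m m' h => ?_, fun a => ?_⟩, b, fun m i => hk m i⟩
  · apply Subtype.ext
    apply ContinuousLinearMap.coe_injective
    refine b'.ext fun i => ?_
    change m.1 (b' i) = m'.1 (b' i)
    rw [hb, hk, hk]
    exact congrArg (fun a : Fin r → ℤ => (a i : ℝ)) h
  · obtain ⟨m, hm⟩ := hsurj a
    refine ⟨m, funext fun i => ?_⟩
    have := (hk m i).symm.trans (hm i)
    exact_mod_cast this

/-- Reduction of the dual lattice modulo `p`. -/
theorem exists_dualLattice_reduction (N : Submodule ℤ (RealSpace r)) [DiscreteTopology N]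
    [IsZLattice ℝ N] (p : ℕ) : ∃ Ψ : dualLattice N → (Fin r → ZMod p), Function.Surjective Ψ ∧
      ∀ m k, Ψ m = Ψ k ↔ ∃ j : dualLattice N, m - k = p • j := by
  obtain ⟨e, b, -⟩ := exists_dualLattice_equiv N
  refine ⟨fun m i => ((e m i : ℤ) : ZMod p), fun c => ?_, fun m k => ?_⟩
  · choose a ha using fun i => ZMod.intCast_surjective (c i)
    exact ⟨e.symm a, funext fun i => by
      change ((e (e.symm a) i : ℤ) : ZMod p) = c i
      rw [AddEquiv.apply_symm_apply, ha]⟩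
  · constructor
    · intro h
      have h1 : ∀ i, ∃ c : ℤ, e m i - e k i = p * c := by
        intro i
        have := congrFun h i
        rw [← sub_eq_zero, ← Int.cast_sub, ZMod.intCast_zmod_eq_zero_iff_dvd] at this
        exact this
      choose c hc using h1
      refine ⟨e.symm c, e.injective ?_⟩
      ext i
      rw [map_sub, map_nsmul, AddEquiv.apply_symm_apply]
      simp [hc]
    · rintro ⟨j, hj⟩
      ext i
      have h1 := congrFun (congrArg e hj) i
      rw [map_sub, map_nsmul] at h1
      rw [← sub_eq_zero, ← Int.cast_sub, ZMod.intCast_zmod_eq_zero_iff_dvd]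
      exact ⟨e j i, by simpa using h1⟩

theorem exists_isCompleteResidueSystem (N : Submodule ℤ (RealSpace r)) [DiscreteTopology N]
    [IsZLattice ℝ N] {p : ℕ} (hp : 0 < p) :
    ∃ R : Finset (dualLattice N), IsCompleteResidueSystem p R := by
  classical
  have : NeZero p := ⟨hp.ne'⟩
  obtain ⟨Ψ, hΨ, hiff⟩ := exists_dualLattice_reduction N p
  refine ⟨Finset.univ.image (Function.surjInv hΨ), fun m =>
    ⟨Function.surjInv hΨ (Ψ m), ⟨by simp, (hiff _ _).mp (Function.surjInv_eq hΨ _).symm⟩, ?_⟩⟩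
  rintro k ⟨hk, hj⟩
  obtain ⟨c, -, rfl⟩ := Finset.mem_image.mp hk
  rw [(hiff _ _).mpr hj, Function.surjInv_eq hΨ]

theorem IsCompleteResidueSystem.eq_of_congr {p : ℕ} {R : Finset (dualLattice N)}
    (hR : IsCompleteResidueSystem p R) {k k' : dualLattice N} (hk : k ∈ R) (hk' : k' ∈ R)
    (h : ∃ j : dualLattice N, k - k' = p • j) : k = k' :=
  (hR k).unique ⟨hk, 0, by simp⟩ ⟨hk', h⟩

theorem exp_two_pi_I_int_div {p : ℕ} (hp : 0 < p) (k : ℤ) :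
    Complex.exp (2 * Real.pi * Complex.I * (((p : ℂ) * k) / p)) = 1 := by
  have hp' : (p : ℂ) ≠ 0 := by exact_mod_cast hp.ne'
  rw [mul_div_cancel_left₀ _ hp', Complex.exp_eq_one_iff]
  exact ⟨k, by ring⟩

/-- The additive character of `M` with values `e^{2πi (m·n)/p}`. -/
def residueChar (p : ℕ) (n : N) (m : dualLattice N) : ℂ :=
  Complex.exp (2 * Real.pi * Complex.I * (((m.1 n : ℝ) : ℂ) / p))

theorem residueChar_add (p : ℕ) (n : N) (m m' : dualLattice N) :
    residueChar p n (m + m') = residueChar p n m * residueChar p n m' := by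
  rw [residueChar, residueChar, residueChar, ← Complex.exp_add]
  congr 1
  have : (m + m').1 (n : RealSpace r) = m.1 n + m'.1 n := rfl
  rw [this]
  push_cast
  ring

theorem residueChar_nsmul {p : ℕ} (hp : 0 < p) (n : N) (j : dualLattice N) :
    residueChar p n (p • j) = 1 := by
  obtain ⟨k, hk⟩ := j.2 n n.2
  have : (p • j).1 (n : RealSpace r) = p * j.1 n := by
    change (p • j.1) (n : RealSpace r) = _
    simp
  rw [residueChar, this, hk]
  push_cast
  exact exp_two_pi_I_int_div hp k

theorem residueChar_of_multiple {p : ℕ} (hp : 0 < p) (n : N) (m : dualLattice N) :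
    residueChar p (p • n) m = 1 := by
  obtain ⟨k, hk⟩ := m.2 n n.2
  have : m.1 ((p • n : N) : RealSpace r) = p * m.1 n := by
    rw [Submodule.coe_smul_of_tower, map_nsmul, nsmul_eq_mul]
  rw [residueChar, this, hk]
  push_cast
  exact exp_two_pi_I_int_div hp k

variable [DiscreteTopology N] [IsZLattice ℝ N]

theorem IsCompleteResidueSystem.card {p : ℕ} (hp : 0 < p) {R : Finset (dualLattice N)}
    (hR : IsCompleteResidueSystem p R) : R.card = p ^ r := by
  have : NeZero p := ⟨hp.ne'⟩
  obtain ⟨Ψ, hΨ, hiff⟩ := exists_dualLattice_reduction N p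
  have hbij : Function.Bijective fun k : R => Ψ k.1 := by
    refine ⟨fun k k' h => Subtype.ext (hR.eq_of_congr k.2 k'.2 ((hiff _ _).mp h)), fun c => ?_⟩
    obtain ⟨m, rfl⟩ := hΨ c
    obtain ⟨k, ⟨hk, hj⟩, -⟩ := hR m
    exact ⟨⟨k, hk⟩, ((hiff _ _).mpr hj).symm⟩
  have h := Fintype.card_of_bijective hbij
  rw [Fintype.card_coe] at h
  rw [h]
  simp [ZMod.card]

/-- Testing with the dual basis: if all these characters were trivial at n, p would divide every
coordinate of n. -/
theorem exists_residueChar_ne_one {p : ℕ} (hp : 0 < p) {n : N} (hn : ¬ ∃ j : N, p • j = n) :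
    ∃ m : dualLattice N, residueChar p n m ≠ 1 := by
  classical
  by_contra hcon
  push Not at hcon
  obtain ⟨e, b, hb⟩ := exists_dualLattice_equiv N
  have hp' : (p : ℂ) ≠ 0 := by exact_mod_cast hp.ne'
  have hdvd : ∀ i, ∃ c : ℤ, b.repr n i = p * c := by
    intro i
    have h := hcon (e.symm (Pi.single i 1))
    set m := e.symm (Pi.single i (1 : ℤ)) with hm
    have hmn : m.1 (n : RealSpace r) = b.repr n i := by
      have h1 := congrArg Subtype.val (b.sum_repr n)
      simp only [Submodule.coe_sum, Submodule.coe_smul_of_tower] at h1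
      conv_lhs => rw [← h1]
      rw [map_sum, Finset.sum_eq_single_of_mem i (Finset.mem_univ i)]
      · rw [map_zsmul, hb, hm, AddEquiv.apply_symm_apply]
        simp
      · intro j _ hj
        rw [map_zsmul, hb, hm, AddEquiv.apply_symm_apply]
        simp [hj]
    rw [residueChar, hmn, Complex.exp_eq_one_iff] at h
    obtain ⟨c, hc⟩ := h
    refine ⟨c, ?_⟩
    rw [mul_comm] at hc
    have h2 := mul_right_cancel₀ Complex.two_pi_I_ne_zero hc
    rw [div_eq_iff hp'] at h2
    have h3 : ((b.repr n i : ℤ) : ℂ) = ((p * c : ℤ) : ℂ) := by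
      push_cast
      rw [mul_comm (p : ℂ), ← h2]
      push_cast
      rfl
    exact_mod_cast h3
  choose c hc using hdvd
  refine hn ⟨∑ i, c i • b i, ?_⟩
  conv_rhs => rw [← b.sum_repr n]
  rw [Finset.smul_sum]
  refine Finset.sum_congr rfl fun i _ => ?_
  rw [hc, mul_smul, natCast_zsmul]

open Classical in
/-- Orthogonality relations for the characters `n ↦ e^{2πi (m·n)/p}`. -/
theorem sum_residueChar {p : ℕ} (hp : 0 < p) {R : Finset (dualLattice N)}
    (hR : IsCompleteResidueSystem p R) (n : N) :
    ∑ k ∈ R, residueChar p n k = if ∃ j : N, p • j = n then (p : ℂ) ^ r else 0 := by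
  split_ifs with h
  · obtain ⟨j, rfl⟩ := h
    rw [Finset.sum_congr rfl fun k _ => residueChar_of_multiple hp j k]
    simp [hR.card hp]
  · obtain ⟨m, hm⟩ := exists_residueChar_ne_one hp h
    -- Translation by m permutes the residue classes and multiplies the sum by a factor different
    -- from 1, so the sum vanishes.
    choose σ hσ using fun k : R => (hR (k.1 + m)).exists
    let s : R → R := fun k => ⟨σ k, (hσ k).1⟩
    have hinj : Function.Injective s := by
      intro k k' hkk
      have hs : σ k = σ k' := congrArg Subtype.val hkk
      obtain ⟨j, hj⟩ := (hσ k).2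
      obtain ⟨j', hj'⟩ := (hσ k').2
      refine Subtype.ext (hR.eq_of_congr k.2 k'.2 ⟨j - j', ?_⟩)
      rw [smul_sub, ← hj, ← hj', hs]
      abel
    have hbij := Finite.injective_iff_bijective.mp hinj
    have hval : ∀ k : R, residueChar p n (s k).1 = residueChar p n m * residueChar p n k.1 := by
      intro k
      obtain ⟨j, hj⟩ := (hσ k).2
      have e : k.1 + m = p • j + σ k := by rw [← hj]; abel
      have h1 := congrArg (residueChar p n) e
      rw [residueChar_add, residueChar_add, residueChar_nsmul hp, one_mul] at h1
      change residueChar p n (σ k) = _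
      rw [← h1, mul_comm]
    have h2 : ∑ k : R, residueChar p n k.1 = residueChar p n m * ∑ k : R, residueChar p n k.1 := by
      rw [Finset.mul_sum, ← Finset.sum_congr rfl fun k _ => hval k]
      exact (hbij.sum_comp fun k : R => residueChar p n k.1).symm
    rw [← Finset.sum_coe_sort R]
    have h3 : (1 - residueChar p n m) * ∑ k : R, residueChar p n k.1 = 0 := by
      rw [sub_mul, one_mul, ← h2, sub_self]
    exact (mul_eq_zero.mp h3).resolve_left (sub_ne_zero.mpr hm.symm)

end DualLattice

theorem IsToricDataOfLevel.im_eq_zero {deg : N → ℂ} {l : ℕ} (h : IsToricDataOfLevel Fan deg l)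
    (n : N) : (deg n).im = 0 := by
  obtain ⟨k, hk⟩ := h.2 n
  have : deg n = (((k : ℝ) / (l : ℝ) : ℝ) : ℂ) := by
    rw [hk]
    push_cast
    rfl
  rw [this, Complex.ofReal_im]

/-- An integral value k of the shifted degree at a ray generator d would give deg(d) = p k - m·d, an
integer. -/
theorem IsToricDataOfLevel.shiftedDeg {deg : N → ℂ} {l p : ℕ} (hl : 0 < l) (hp : 0 < p)
    (h : IsToricDataOfLevel Fan deg l) (m : dualLattice N) :
    IsToricDataOfLevel Fan (shiftedDeg deg p m) (p * l) := by
  have hp' : (p : ℂ) ≠ 0 := by exact_mod_cast hp.ne'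
  have hl' : (l : ℂ) ≠ 0 := by exact_mod_cast hl.ne'
  refine ⟨⟨fun C hC => ?_, fun C hC d hd k hk => ?_⟩, fun n => ?_⟩
  · obtain ⟨L, hL⟩ := h.1.1 C hC
    refine ⟨(p : ℂ)⁻¹ • (L + toComplexDual m.1), fun n hn => ?_⟩
    rw [ToricForm.shiftedDeg, hL n hn]
    change _ = (p : ℂ)⁻¹ * (L n + ((m.1 n : ℝ) : ℂ))
    ring
  · obtain ⟨j, hj⟩ := m.2 d d.2
    refine h.1.2 C hC d hd (p * k - j) ?_
    rw [ToricForm.shiftedDeg, hj, ← add_div, div_eq_iff hp'] at hk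
    push_cast at hk ⊢
    linear_combination hk
  · obtain ⟨k, hk⟩ := h.2 n
    obtain ⟨j, hj⟩ := m.2 n n.2
    refine ⟨k + j * l, ?_⟩
    rw [ToricForm.shiftedDeg, hk, hj]
    push_cast
    field_simp

theorem weight_shiftedDeg (deg : N → ℂ) (p : ℕ) (m : dualLattice N) (n : N) :
    weight (shiftedDeg deg p m) n =
      Complex.exp (2 * Real.pi * Complex.I * (deg n / p)) * residueChar p n m := by
  rw [weight, residueChar, ← Complex.exp_add, shiftedDeg, mul_add]

theorem IsDegreeFunction.nsmul {deg : N → ℂ} (hdeg : IsDegreeFunction Fan deg)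
    {C : Set (RealSpace r)} (hC : C ∈ Fan.cones) {n : N} (hn : (n : RealSpace r) ∈ C) (p : ℕ) :
    deg (p • n) = p * deg n := by
  obtain ⟨L, hL⟩ := hdeg C hC
  have h1 : ((p • n : N) : RealSpace r) = (p : ℝ) • (n : RealSpace r) := by
    rw [Submodule.coe_smul_of_tower, Nat.cast_smul_eq_nsmul]
  rw [hL n hn, hL _ (by rw [h1]; exact CompleteFan.smul_mem hC hn (Nat.cast_nonneg p)), h1,
    map_smul, Complex.real_smul]
  push_cast
  rfl

variable [DiscreteTopology N] [IsZLattice ℝ N]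

/-- Averaging the shifted weights selects the sublattice `pN`. -/
theorem extend_coneWeight {deg : N → ℂ} (hdeg : IsDegreeFunction Fan deg) {p : ℕ} (hp : 0 < p)
    {R : Finset (dualLattice N)} (hR : IsCompleteResidueSystem p R) {C : Set (RealSpace r)}
    (hC : C ∈ Fan.cones) :
    Function.extend (nsmulAddMonoidHom (α := N) p) (coneWeight deg C) 0 =
      ((p : ℂ) ^ r)⁻¹ • ∑ k ∈ R, coneWeight (shiftedDeg deg p k) C := by
  classical
  have hp' : (p : ℂ) ≠ 0 := by exact_mod_cast hp.ne'
  have hpr : (p : ℝ) ≠ 0 := by exact_mod_cast hp.ne'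
  have hcoe : ∀ j : N, ((p • j : N) : RealSpace r) = (p : ℝ) • (j : RealSpace r) := fun j => by
    rw [Submodule.coe_smul_of_tower, Nat.cast_smul_eq_nsmul]
  have hinj : Function.Injective (nsmulAddMonoidHom (α := N) p) := by
    intro x y hxy
    have hxy : p • x = p • y := hxy
    have := congrArg Subtype.val hxy
    rw [hcoe, hcoe] at this
    exact Subtype.ext (smul_right_injective _ hpr this)
  ext n
  have hsum : (((p : ℂ) ^ r)⁻¹ • ∑ k ∈ R, coneWeight (shiftedDeg deg p k) C) n =
      if (n : RealSpace r) ∈ C ∧ ∃ j : N, p • j = n then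
        Complex.exp (2 * Real.pi * Complex.I * (deg n / p)) else 0 := by
    simp only [Pi.smul_apply, Finset.sum_apply, coneWeight, Set.indicator_apply,
      Set.mem_ofPred_eq, smul_eq_mul]
    by_cases hn : (n : RealSpace r) ∈ C
    · simp only [hn, if_true, true_and, weight_shiftedDeg, ← Finset.mul_sum,
        sum_residueChar hp hR]
      split_ifs
      · field_simp
      · simp
    · simp [hn]
  rw [hsum]
  by_cases h : ∃ j : N, p • j = n
  · obtain ⟨j, rfl⟩ := h
    have e : Function.extend (nsmulAddMonoidHom (α := N) p) (coneWeight deg C) 0 (p • j) =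
        coneWeight deg C j := hinj.extend_apply _ _ j
    have hmem : ((p • j : N) : RealSpace r) ∈ C ↔ (j : RealSpace r) ∈ C := by
      rw [hcoe]
      constructor
      · intro h
        have := CompleteFan.smul_mem hC h (t := (p : ℝ)⁻¹) (by positivity)
        rwa [inv_smul_smul₀ hpr] at this
      · exact fun h => CompleteFan.smul_mem hC h (Nat.cast_nonneg p)
    rw [e, hmem, coneWeight, Set.indicator_apply]
    simp only [Set.mem_ofPred_eq, exists_apply_eq_apply, and_true]
    split_ifs with hj
    · rw [hdeg.nsmul hC hj, mul_div_cancel_left₀ _ hp', weight]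
    · rfl
  · have h' : ¬ ∃ j, (nsmulAddMonoidHom (α := N) p) j = n := h
    rw [if_neg fun h' => h h'.2, Function.extend_apply' _ _ _ h']
    rfl

/-- The character at pτ is the one at τ composed with n ↦ p n, so `IsReg.map` moves the series onto
pN. By `extend_coneWeight` the result is the average of the shifted series, and uniqueness of
regularised values concludes without returning to analytic continuation. -/
theorem coneSum_scale {deg : N → ℂ} {l p : ℕ} (hl : 0 < l) (hp : 0 < p)
    (hdeg : IsToricDataOfLevel Fan deg l) {R : Finset (dualLattice N)}
    (hR : IsCompleteResidueSystem p R) {C : Set (RealSpace r)} (hC : C ∈ Fan.cones)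
    {τ : ℂ} (hτ : 0 < τ.im) (m : dualLattice N) :
    coneSum deg C (p * τ) (toComplexDual m.1) =
      ((p : ℂ) ^ r)⁻¹ * ∑ k ∈ R, coneSum (shiftedDeg deg p k) C τ (toComplexDual m.1) := by
  have hpr : (p : ℝ) ≠ 0 := by exact_mod_cast hp.ne'
  have hpτ : 0 < ((p : ℂ) * τ).im := by
    rw [← Complex.ofReal_natCast, Complex.im_ofReal_mul]
    have : (0 : ℝ) < p := by exact_mod_cast hp
    positivity
  have h1 := isReg_coneWeight_coneSum hdeg.1 hdeg.im_eq_zero hpτ m hC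
  have hχ : latticeChar ((p : ℂ) * τ) (toComplexDual m.1) =
      (latticeChar τ (toComplexDual m.1)).comp
        (AddMonoidHom.toMultiplicative (nsmulAddMonoidHom (α := N) p)) := by
    ext n
    change Complex.exp (2 * Real.pi * Complex.I * ((p * τ) * toComplexDual m.1 (n : RealSpace r))) =
      Complex.exp (2 * Real.pi * Complex.I *
      (τ * toComplexDual m.1 ((p • n : N) : RealSpace r)))
    rw [Submodule.coe_smul_of_tower, map_nsmul, nsmul_eq_mul]
    congr 1
    ring
  rw [hχ] at h1
  have hinj : Function.Injective (nsmulAddMonoidHom (α := N) p) := by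
    intro x y hxy
    have hxy : p • x = p • y := hxy
    have := congrArg Subtype.val hxy
    rw [Submodule.coe_smul_of_tower, Submodule.coe_smul_of_tower, ← Nat.cast_smul_eq_nsmul ℝ,
      ← Nat.cast_smul_eq_nsmul ℝ] at this
    exact Subtype.ext (smul_right_injective _ hpr this)
  have h2 := h1.map hinj
  rw [extend_coneWeight hdeg.1.1 hp hR hC] at h2
  refine h2.unique (IsReg.smul _ (IsReg.sum R fun k _ => ?_))
  have hk := hdeg.shiftedDeg hl hp k
  exact isReg_coneWeight_coneSum hk.1 hk.im_eq_zero hτ m hC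

theorem fanSum_scale {deg : N → ℂ} {l p : ℕ} (hl : 0 < l) (hp : 0 < p)
    (hdeg : IsToricDataOfLevel Fan deg l) {R : Finset (dualLattice N)}
    (hR : IsCompleteResidueSystem p R) {τ : ℂ} (hτ : 0 < τ.im) (m : dualLattice N) :
    fanSum Fan deg (p * τ) m =
      ((p : ℂ) ^ r)⁻¹ * ∑ k ∈ R, fanSum Fan (shiftedDeg deg p k) τ m := by
  simp only [fanSum]
  rw [Finset.sum_comm, Finset.mul_sum]
  refine Finset.sum_congr rfl fun C hC => ?_
  rw [coneSum_scale hl hp hdeg hR hC hτ m, ← Finset.mul_sum]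
  ring

/-- Absolute convergence for each shifted degree permits exchanging the sum over `R` with the sum
over M. -/
theorem toricForm_scale {deg : N → ℂ} {l p : ℕ} (hl : 0 < l) (hp : 0 < p)
    (hdeg : IsToricDataOfLevel Fan deg l) {R : Finset (dualLattice N)}
    (hR : IsCompleteResidueSystem p R) (τ : UpperHalfPlane) :
    toricForm Fan deg (scale p hp τ) =
      ((p : ℂ) ^ r)⁻¹ * ∑ k ∈ R, toricForm Fan (shiftedDeg deg p k) τ := by
  simp only [toricForm]
  have hcoe : ((scale p hp τ : UpperHalfPlane) : ℂ) = p * (τ : ℂ) := rfl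
  rw [hcoe, tsum_congr fun m => fanSum_scale hl hp hdeg hR τ.im_pos m, tsum_mul_left,
    Summable.tsum_finsetSum]
  intro k _
  have hk := hdeg.shiftedDeg hl hp k
  exact summable_fanSum hk.1 hk.im_eq_zero τ.im_pos

theorem comp_scale_mem_toricSpace {r l p : ℕ} (hl : 0 < l) (hp : 0 < p)
    {f : UpperHalfPlane → ℂ} (hf : f ∈ toricSpace r l) :
    (fun τ => f (scale p hp τ)) ∈ toricSpace r (p * l) := by
  induction hf using Submodule.span_induction with
  | mem f hf =>
    obtain ⟨N, _, _, Fan, deg, hdeg, rfl⟩ := hf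
    obtain ⟨R, hR⟩ := exists_isCompleteResidueSystem N hp
    have e : (fun τ => toricForm Fan deg (scale p hp τ)) =
        ((p : ℂ) ^ r)⁻¹ • ∑ k ∈ R, toricForm Fan (shiftedDeg deg p k) := by
      ext τ
      rw [toricForm_scale hl hp hdeg hR]
      simp
    rw [e]
    refine Submodule.smul_mem _ _ (Submodule.sum_mem _ fun k _ => Submodule.subset_span ?_)
    exact ⟨N, inferInstance, inferInstance, Fan, _, hdeg.shiftedDeg hl hp k, rfl⟩
  | zero => exact Submodule.zero_mem _
  | add f g _ _ hf hg => exact Submodule.add_mem _ hf hg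
  | smul c f _ hf => exact Submodule.smul_mem _ c hf

theorem comp_scale_mem_toricRing {l p : ℕ} (hl : 0 < l) (hp : 0 < p)
    {f : UpperHalfPlane → ℂ} (hf : f ∈ toricRing l) :
    (fun τ => f (scale p hp τ)) ∈ toricRing (p * l) := by
  rw [toricRing] at hf
  induction hf using Submodule.iSup_induction' with
  | mem r f hf =>
    exact Submodule.mem_iSup_of_mem r (comp_scale_mem_toricSpace hl hp hf)
  | zero => exact Submodule.zero_mem _
  | add f g _ _ hf hg => exact Submodule.add_mem _ hf hg

end Scaling

end ToricForm

end

theorem mainTheorem10 (l p : ℕ) (hl : 0 < l) (hp : 0 < p) :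
    (∀ (r : ℕ) (f : UpperHalfPlane → ℂ), f ∈ ToricForm.toricSpace r l →
      (fun τ => f (ToricForm.scale p hp τ)) ∈ ToricForm.toricSpace r (p * l)) ∧
    (∀ f : UpperHalfPlane → ℂ, f ∈ ToricForm.toricRing l →
      (fun τ => f (ToricForm.scale p hp τ)) ∈ ToricForm.toricRing (p * l)) ∧
    (∀ (r : ℕ) (N : Submodule ℤ (ToricForm.RealSpace r)) [DiscreteTopology N] [IsZLattice ℝ N]
      (Fan : ToricForm.CompleteFan N) (deg : N → ℂ),
      ToricForm.IsToricDataOfLevel Fan deg l →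
      ∀ R : Finset (ToricForm.dualLattice N), ToricForm.IsCompleteResidueSystem p R →
        ToricForm.IsWellDefined Fan deg ∧
        (∀ k ∈ R, ToricForm.IsToricDataOfLevel Fan (ToricForm.shiftedDeg deg p k) (p * l) ∧
          ToricForm.IsWellDefined Fan (ToricForm.shiftedDeg deg p k)) ∧
        ∀ τ : UpperHalfPlane, ToricForm.toricForm Fan deg (ToricForm.scale p hp τ) =
          ((p : ℂ) ^ r)⁻¹ *
            ∑ k ∈ R, ToricForm.toricForm Fan (ToricForm.shiftedDeg deg p k) τ) := by
  refine ⟨fun r f hf => ToricForm.comp_scale_mem_toricSpace hl hp hf,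
    fun f hf => ToricForm.comp_scale_mem_toricRing hl hp hf, ?_⟩
  intro r N _ _ Fan deg hdeg R hR
  refine ⟨ToricForm.isWellDefined hdeg.1 hdeg.im_eq_zero, fun k _ => ?_,
    fun τ => ToricForm.toricForm_scale hl hp hdeg hR τ⟩
  have hk := hdeg.shiftedDeg hl hp k
  exact ⟨hk, ToricForm.isWellDefined hk.1 hk.im_eq_zero⟩
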